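/- Fix an alphabet $\Sigma$. **Precubical sets.** A lo-set is a finite totally ordered (event order $\dashrightarrow$) $\Sigma$-labelled set; an ilo-set ${}_SU_T$ is a lo-set $U$ with subsets $S,T\subseteq U$ (source and target interface). A coface map $d_{A,B}:U\to V$ of lo-sets is an order and label preserving injection together with a partition $A\sqcup B$ of the complement of its image ($A$: unstarted, $B$: terminated events); for ilo-sets one also requires $S_U$, $T_U$ to be the preimages of $S_V$, $T_V$, and $A\cap S_V=\emptyset=B\cap T_V$. Up to isomorphism this gives small categories $\square$ (lo-sets) and $\mathrm{I}\square$ (ilo-sets). A precubical set (ipc-set) is a presheaf of sets on $\square$ (on $\mathrm{I}\square$), with face maps $\delta_{A,B}=X[d_{A,B}]$, $\delta^0_A=\delta_{A,\emptyset}$, $\delta^1_B=\delta_{\emptyset,B}$; elements of $X[U]$ are cells with events $U$. An HDA is a finite precubical set $X$ with sets $X_\bot$, $X^\top$ of start and accept cells; an iHDA is a finite ipc-set with such sets, where start cells $x\in X[{}_SU_T]$ have $S=U$ and accept cells have $T=U$. **Ipomsets.** A labelled iposet is a finite $\Sigma$-labelled set $P$ with strict partial orders $<$ (precedence) and $\dashrightarrow$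 (event order) such that any two distinct elements are comparable by $<$ or by $\dashrightarrow$, and subsets $S_P$ of $<$-minimal and $T_P$ of $<$-maximal elements. A subsumption $P\sqsubseteq Q$ is a label preserving bijection $f:P\to Q$ with $f(S_P)=S_Q$, $f(T_P)=T_Q$, such that $f(x)<f(y)$ implies $x<y$, and $x\dashrightarrow y$ for $<$-incomparable $x,y$ implies $f(x)\dashrightarrow f(y)$. An isomorphism is a subsumption that is an isomorphism for $<$; ipomsets are isomorphism classes. $P$ is interval if there are $b,e:P\to\mathbb R$ with $b\le e$ and $x<y\iff e(x)<b(y)$. If $T_P\simeq S_Q$ as lo-sets, $P*Q$ is the quotient of $P\sqcup Q$ that identifies $T_P$ with $S_Q$, with interfaces $S_P$, $T_Q$, event order the transitive closure of the union of the two event orders, and $x<y$ iff $x<_Py$, or $x<_Qy$, or $x\in P\setminus T_P$ and $y\in Q\setminus S_Q$. For sets $L,M$ of ipomsets, $L*M$ is the set of interval ipomsets $R$ with $R\sqsubseteq P*Q$ for some $P\in L$, $Q\in M$ with $T_P\simeq S_Q$. **Languages.** A path is a finite sequence of cells with steps that are up-steps from $\delta^0_A(x)$ to $x$, with ipomset ${}_{U\setminus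 A}U_U$ ($U$ the events of $x$), or down-steps from $x$ to $\delta^1_B(x)$, with ipomset ${}_UU_{U\setminus B}$. The ipomset $\mathrm{ev}(\alpha)$ of a path is the gluing of those of its steps (${}_UU_U$ for a path of length $0$ at a cell with events $U$). $\mathrm{Lang}(X)$ is the set of $\mathrm{ev}(\alpha)$ for paths $\alpha$ from a start cell to an accept cell. **Properness.** An iHDA is start (accept) simple if it has exactly one start (accept) cell, and simple if both. Its start (accept) map is the map from the disjoint union of the representable presheaves of the ilo-sets of its start (accept) cells to $X$ that is given by these cells. An injective map is an initial (final) inclusion if its image is down-closed (up-closed) for the reachability preorder ($x\preceq y$ iff there is a path from $x$ to $y$). $X$ is start proper if its start map is an initial inclusion, accept proper if its accept map is a final inclusion, and proper if it is both and the images of the two maps are disjoint. **Closure.** For an iHDA $X$, $\mathrm{Cl}(X)$ is the HDA with $\mathrm{Cl}(X)[U]$ the set of all $[x;A,B]$ with $x\in X[{}_SV_T]$, $A\subseteq S$, $B\subseteq T$, $A\cap B=\emptyset$, $U=V\setminus(A\cup B)$, with face maps $\delta_{C,D}[x;A,B]=[\delta_{C\setminus S,D\setminus T}(x);A\cup(C\cap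 S),B\cup(D\cap T)]$; its start (accept) cells are the $[x;\emptyset,\emptyset]$ with $x\in X_\bot$ ($x\in X^\top$). **Proposition.** Let $X_1,\dots,X_n$ ($n\ge1$) be iHDAs such that $X_1$ is accept simple and accept proper, $X_2,\dots,X_{n-1}$ are simple and proper, and $X_n$ is start simple and start proper. For $1\le k<n$ let $x^\top_k$ be the accept cell of $X_k$ and $x_\bot^{k+1}$ the start cell of $X_{k+1}$, and assume that both have the same lo-set $U_k$ of events. Let $X_1*\dots*X_n$ be the HDA whose precubical set is the colimit of $$\mathrm{Cl}(X_1)\leftarrow\square^{U_1}\to\mathrm{Cl}(X_2)\leftarrow\square^{U_2}\to\dots\leftarrow\square^{U_{n-1}}\to\mathrm{Cl}(X_n),$$ where $\square^{U_k}$ is the presheaf represented by $U_k$ and the maps from it are those given by the cells $[x^\top_k;\emptyset,\emptyset]$ and $[x^{k+1}_\bot;\emptyset,\emptyset]$, with the start cells of $\mathrm{Cl}(X_1)$ as start cells and the accept cells of $\mathrm{Cl}(X_n)$ as accept cells. Then $$\mathrm{Lang}(X_1*\dots*X_n)=\mathrm{Lang}(X_1)*\dots*\mathrm{Lang}(X_n).$$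 -/

import Mathlib

open CategoryTheory Opposite

universe u

namespace HDAGluing

/-! ### Lo-sets and the labelled precube categories -/

/-- An object of the (skeletal) labelled precube category: a lo-set up to isomorphism, that is,
a finite word over the alphabet. The event order is the order of `Fin len`. -/
structure LoSet (Alph : Type u) : Type u where
  len : ℕ
  lab : Fin len → Alph

/-- An object of the (skeletal) labelled precube category with interfaces: a lo-set with a source
interface `S` and a target interface `T`. -/
structure ILoSet (Alph : Type u) : Type u extends LoSet Alph where
  S : Set (Fin len)
  T : Set (Fin len)

variable {Alph : Type u}

/-- A coface map `d_{A,B} : U → V` of lo-sets: an order and label preserving injection whose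
missed events are split into unstarted ones (`A`) and terminated ones (`B`). -/
@[ext]
structure LoSet.Hom (U V : LoSet Alph) : Type u where
  emb : Fin U.len ↪o Fin V.len
  A : Set (Fin V.len)
  B : Set (Fin V.len)
  lab_emb : ∀ i, V.lab (emb i) = U.lab i
  disj : Disjoint A B
  union : A ∪ B = (Set.range emb)ᶜ

/-- A coface map of ilo-sets: a coface map of lo-sets such that the interfaces of `U` are the
preimages of those of `V`, no event of `S_V` is unstarted and no event of `T_V` is terminated. -/
@[ext]
structure ILoSet.Hom (U V : ILoSet Alph) : Type u extends LoSet.Hom U.toLoSet V.toLoSet where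
  S_pre : U.S = emb ⁻¹' V.S
  T_pre : U.T = emb ⁻¹' V.T
  A_S : Disjoint A V.S
  B_T : Disjoint B V.T

/-- The identity coface map. -/
def LoSet.Hom.id (U : LoSet Alph) : LoSet.Hom U U where
  emb := RelEmbedding.refl _
  A := ∅
  B := ∅
  lab_emb _ := rfl
  disj := by simp
  union := by ext; simp

/-- Composition of coface maps, `d_{C,D} ∘ d_{A,B}`, with unstarted events `d_{C,D}(A) ∪ C` and
terminated events `d_{C,D}(B) ∪ D`. -/
def LoSet.Hom.comp {U V W : LoSet Alph} (f : LoSet.Hom U V) (g : LoSet.Hom V W) :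
    LoSet.Hom U W where
  emb := f.emb.trans g.emb
  A := g.emb '' f.A ∪ g.A
  B := g.emb '' f.B ∪ g.B
  lab_emb i := by simp [f.lab_emb, g.lab_emb]
  disj := by
    have hg : ∀ x, x ∈ g.A ∪ g.B ↔ x ∉ Set.range g.emb := fun x => by rw [g.union]; rfl
    have hgd := Set.disjoint_left.1 g.disj
    have hfd := Set.disjoint_left.1 f.disj
    rw [Set.disjoint_left]
    rintro x (⟨y, hy, rfl⟩ | hx) (⟨z, hz, hzx⟩ | hx')
    · exact hfd hy (g.emb.injective hzx ▸ hz)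
    · exact (hg _).1 (Or.inr hx') ⟨y, rfl⟩
    · exact (hg _).1 (Or.inl hx) ⟨z, hzx⟩
    · exact hgd hx hx'
  union := by
    have hg : ∀ x, x ∈ g.A ∪ g.B ↔ x ∉ Set.range g.emb := fun x => by rw [g.union]; rfl
    have hf : ∀ x, x ∈ f.A ∪ f.B ↔ x ∉ Set.range f.emb := fun x => by rw [f.union]; rfl
    ext x
    constructor
    · rintro ((⟨y, hy, rfl⟩ | hx) | (⟨y, hy, rfl⟩ | hx)) ⟨i, hi⟩
      · exact (hf y).1 (Or.inl hy) ⟨i, g.emb.injective hi⟩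
      · exact (hg x).1 (Or.inl hx) ⟨f.emb i, hi⟩
      · exact (hf y).1 (Or.inr hy) ⟨i, g.emb.injective hi⟩
      · exact (hg x).1 (Or.inr hx) ⟨f.emb i, hi⟩
    · intro hx
      by_cases hxg : x ∈ Set.range g.emb
      · obtain ⟨y, rfl⟩ := hxg
        have : y ∉ Set.range f.emb := by
          rintro ⟨i, rfl⟩; exact hx ⟨i, rfl⟩
        rcases (hf y).2 this with h | h
        · exact Or.inl (Or.inl ⟨y, h, rfl⟩)
        · exact Or.inr (Or.inl ⟨y, h, rfl⟩)
      · rcases (hg x).2 hxg with h | h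
        · exact Or.inl (Or.inr h)
        · exact Or.inr (Or.inr h)

/-- The labelled precube category. -/
instance : SmallCategory (LoSet Alph) where
  Hom := LoSet.Hom
  id := LoSet.Hom.id
  comp := LoSet.Hom.comp
  id_comp f := by ext <;> simp [LoSet.Hom.comp, LoSet.Hom.id]
  comp_id f := by ext <;> simp [LoSet.Hom.comp, LoSet.Hom.id]
  assoc f g h := by
    apply LoSet.Hom.ext
    · rfl
    · simp [LoSet.Hom.comp, Set.image_union, Set.image_image, Set.union_assoc]
    · simp [LoSet.Hom.comp, Set.image_union, Set.image_image, Set.union_assoc]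

/-- The labelled precube category with interfaces. -/
instance : SmallCategory (ILoSet Alph) where
  Hom := ILoSet.Hom
  id U :=
    { LoSet.Hom.id U.toLoSet with
      S_pre := by ext; simp [LoSet.Hom.id]
      T_pre := by ext; simp [LoSet.Hom.id]
      A_S := by simp [LoSet.Hom.id]
      B_T := by simp [LoSet.Hom.id] }
  comp {U V W} f g :=
    { LoSet.Hom.comp f.toHom g.toHom with
      S_pre := by rw [f.S_pre, g.S_pre]; rfl
      T_pre := by rw [f.T_pre, g.T_pre]; rfl
      A_S := by
        have h1 := Set.disjoint_left.1 f.A_S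
        have h2 := Set.disjoint_left.1 g.A_S
        rw [Set.disjoint_left]
        rintro x (⟨y, hy, rfl⟩ | hx) hS
        · exact h1 hy (by rw [g.S_pre]; exact hS)
        · exact h2 hx hS
      B_T := by
        have h1 := Set.disjoint_left.1 f.B_T
        have h2 := Set.disjoint_left.1 g.B_T
        rw [Set.disjoint_left]
        rintro x (⟨y, hy, rfl⟩ | hx) hS
        · exact h1 hy (by rw [g.T_pre]; exact hS)
        · exact h2 hx hS }
  id_comp f := ILoSet.Hom.ext
    (congrArg LoSet.Hom.emb (Category.id_comp (obj := LoSet Alph) f.toHom))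
    (congrArg LoSet.Hom.A (Category.id_comp (obj := LoSet Alph) f.toHom))
    (congrArg LoSet.Hom.B (Category.id_comp (obj := LoSet Alph) f.toHom))
  comp_id f := ILoSet.Hom.ext
    (congrArg LoSet.Hom.emb (Category.comp_id (obj := LoSet Alph) f.toHom))
    (congrArg LoSet.Hom.A (Category.comp_id (obj := LoSet Alph) f.toHom))
    (congrArg LoSet.Hom.B (Category.comp_id (obj := LoSet Alph) f.toHom))
  assoc f g h := ILoSet.Hom.ext rfl
    (congrArg LoSet.Hom.A (Category.assoc (obj := LoSet Alph) f.toHom g.toHom h.toHom))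
    (congrArg LoSet.Hom.B (Category.assoc (obj := LoSet Alph) f.toHom g.toHom h.toHom))

/-- The functor that forgets the interfaces. -/
def forgetIface (Alph : Type u) : ILoSet Alph ⥤ LoSet Alph where
  obj U := U.toLoSet
  map f := f.toHom
  map_id _ := rfl
  map_comp _ _ := rfl

/-! ### (i)HDAs -/

section Presheaf

variable {C : Type u} [SmallCategory C]

/-- The cells of a presheaf. -/
abbrev Cells (X : Cᵒᵖ ⥤ Type u) : Type u := Σ U : C, X.obj (op U)

/-- Paths in a presheaf `X` over one of the two precube categories; `G` is the functor to lo-sets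
(`forgetIface` for ipc-sets, the identity for precubical sets). An up-step goes from
`δ⁰_A(y)` to `y`, a down-step from `x` to `δ¹_B(x)`. -/
inductive Path (G : C ⥤ LoSet Alph) (X : Cᵒᵖ ⥤ Type u) : Cells X → Cells X → Type u
  | nil (x : Cells X) : Path G X x x
  | up {x y z : Cells X} (d : x.1 ⟶ y.1) (hd : (G.map d).B = ∅)
      (hx : x.2 = X.map d.op y.2) (p : Path G X y z) : Path G X x z
  | down {x y z : Cells X} (d : y.1 ⟶ x.1) (hd : (G.map d).A = ∅)
      (hy : y.2 = X.map d.op x.2) (p : Path G X y z) : Path G X x z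

/-- The disjoint union of the standard cubes `□^{U i}`. -/
def sigmaCubes {ι : Type u} (U : ι → C) : Cᵒᵖ ⥤ Type u where
  obj W := Σ i, (W.unop ⟶ U i)
  map f := TypeCat.ofHom fun p => ⟨p.1, f.unop ≫ p.2⟩
  map_id W := by
    apply TypeCat.homEquiv.injective
    funext p
    exact Sigma.ext rfl (heq_of_eq (Category.id_comp p.2))
  map_comp f g := by
    apply TypeCat.homEquiv.injective
    funext p
    exact Sigma.ext rfl (heq_of_eq (Category.assoc g.unop f.unop p.2))

/-- The map from the disjoint union of the cubes `□^{ev(x)}`, `x ∈ s`, which on each summand is the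
Yoneda embedding of the cell `x`. -/
def cellsMap {X : Cᵒᵖ ⥤ Type u} (s : Set (Cells X)) :
    sigmaCubes (fun x : s => x.1.1) ⟶ X where
  app W := TypeCat.ofHom fun p => X.map p.2.op p.1.1.2
  naturality W W' f := by
    apply TypeCat.homEquiv.injective
    funext p
    exact Functor.map_comp_apply X p.2.op f p.1.1.2

/-- The image of a map of presheaves, as a set of cells. -/
def imageCells {Y X : Cᵒᵖ ⥤ Type u} (f : Y ⟶ X) : Set (Cells X) :=
  {x | ∃ y : Y.obj (op x.1), f.app (op x.1) y = x.2}

/-- Initial inclusions: injective maps with image down-closed for reachability. -/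
def IsInitialInclusion (G : C ⥤ LoSet Alph) {Y X : Cᵒᵖ ⥤ Type u} (f : Y ⟶ X) : Prop :=
  (∀ W, Function.Injective (f.app W)) ∧
    ∀ x y : Cells X, Nonempty (Path G X x y) → y ∈ imageCells f → x ∈ imageCells f

/-- Final inclusions: injective maps with image up-closed for reachability. -/
def IsFinalInclusion (G : C ⥤ LoSet Alph) {Y X : Cᵒᵖ ⥤ Type u} (f : Y ⟶ X) : Prop :=
  (∀ W, Function.Injective (f.app W)) ∧
    ∀ x y : Cells X, Nonempty (Path G X x y) → x ∈ imageCells f → y ∈ imageCells f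

end Presheaf

/-- Higher-dimensional automata: finite precubical sets with start and accept cells. -/
structure HDA (Alph : Type u) where
  cell : (LoSet Alph)ᵒᵖ ⥤ Type u
  finite : Finite (Cells cell)
  start : Set (Cells cell)
  accept : Set (Cells cell)

/-- Higher-dimensional automata with interfaces: finite ipc-sets with start and accept cells, such
that all events of a start cell are in its source interface and all events of an accept cell are in
its target interface. -/
structure IHDA (Alph : Type u) where
  cell : (ILoSet Alph)ᵒᵖ ⥤ Type u
  finite : Finite (Cells cell)
  start : Set (Cells cell)
  accept : Set (Cells cell)
  start_iface : ∀ x ∈ start, x.1.S = Set.univ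
  accept_iface : ∀ x ∈ accept, x.1.T = Set.univ

namespace IHDA

variable (X : IHDA Alph)

/-- Exactly one start cell. -/
def StartSimple : Prop := ∃ x, X.start = {x}

/-- Exactly one accept cell. -/
def AcceptSimple : Prop := ∃ x, X.accept = {x}

/-- Start simple and accept simple. -/
def Simple : Prop := X.StartSimple ∧ X.AcceptSimple

/-- The start map is an initial inclusion. -/
def StartProper : Prop := IsInitialInclusion (forgetIface Alph) (cellsMap X.start)

/-- The accept map is a final inclusion. -/
def AcceptProper : Prop := IsFinalInclusion (forgetIface Alph) (cellsMap X.accept)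

/-- Start proper, accept proper, and the images of the start and the accept map are disjoint. -/
def Proper : Prop :=
  X.StartProper ∧ X.AcceptProper ∧
    Disjoint (imageCells (cellsMap X.start)) (imageCells (cellsMap X.accept))

end IHDA

/-! ### Closure -/

/-- A factorisation of `m : U → F(V)` as `U → F(V') → F(V)`, where the second map comes from a
coface map `e` of ilo-sets, and the first one only inserts unstarted events in the source
interface and terminated events in the target interface of `V'`. -/
structure Factor {U : LoSet Alph} {V : ILoSet Alph} (m : U ⟶ V.toLoSet) where
  mid : ILoSet Alph
  e : mid ⟶ V
  d : U ⟶ mid.toLoSet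
  fac : d ≫ e.toHom = m
  hA : d.A ⊆ mid.S
  hB : d.B ⊆ mid.T

theorem Factor.e_A {U : LoSet Alph} {V : ILoSet Alph} {m : U ⟶ V.toLoSet} (f : Factor m) :
    f.e.A = m.A \ V.S := by
  have h : f.e.emb '' f.d.A ∪ f.e.A = m.A := congrArg LoSet.Hom.A f.fac
  have hS := Set.disjoint_left.1 f.e.A_S
  rw [← h]
  ext x
  constructor
  · intro hx
    exact ⟨Or.inr hx, hS hx⟩
  · rintro ⟨⟨y, hy, rfl⟩ | hx, hn⟩
    · exact absurd (by have := f.hA hy; rw [f.e.S_pre] at this; exact this) hn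
    · exact hx

theorem Factor.e_B {U : LoSet Alph} {V : ILoSet Alph} {m : U ⟶ V.toLoSet} (f : Factor m) :
    f.e.B = m.B \ V.T := by
  have h : f.e.emb '' f.d.B ∪ f.e.B = m.B := congrArg LoSet.Hom.B f.fac
  have hS := Set.disjoint_left.1 f.e.B_T
  rw [← h]
  ext x
  constructor
  · intro hx
    exact ⟨Or.inr hx, hS hx⟩
  · rintro ⟨⟨y, hy, rfl⟩ | hx, hn⟩
    · exact absurd (by have := f.hB hy; rw [f.e.T_pre] at this; exact this) hn
    · exact hx

theorem Factor.e_range {U : LoSet Alph} {V : ILoSet Alph} {m : U ⟶ V.toLoSet} (f : Factor m) :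
    Set.range f.e.emb = (m.A \ V.S ∪ m.B \ V.T)ᶜ := by
  rw [← f.e_A, ← f.e_B, f.e.union, compl_compl]

/-- Such a factorisation is unique. -/
theorem Factor.eq {U : LoSet Alph} {V : ILoSet Alph} {m : U ⟶ V.toLoSet} (f g : Factor m) :
    f = g := by
  have hr : Set.range f.e.emb = Set.range g.e.emb := by rw [f.e_range, g.e_range]
  have hA : f.e.A = g.e.A := by rw [f.e_A, g.e_A]
  have hB : f.e.B = g.e.B := by rw [f.e_B, g.e_B]
  obtain ⟨⟨⟨n₁, l₁⟩, S₁, T₁⟩, ⟨⟨e₁, A₁, B₁, lab₁, dj₁, un₁⟩, sp₁, tp₁, as₁, bt₁⟩,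
    ⟨d₁, dA₁, dB₁, dl₁, dd₁, du₁⟩, fac₁, hA₁, hB₁⟩ := f
  obtain ⟨⟨⟨n₂, l₂⟩, S₂, T₂⟩, ⟨⟨e₂, A₂, B₂, lab₂, dj₂, un₂⟩, sp₂, tp₂, as₂, bt₂⟩,
    ⟨d₂, dA₂, dB₂, dl₂, dd₂, du₂⟩, fac₂, hA₂, hB₂⟩ := g
  dsimp only at *
  subst hA hB
  have hn : n₁ = n₂ := by
    have h1 := Set.ncard_range_of_injective e₁.injective
    have h2 := Set.ncard_range_of_injective e₂.injective
    rw [hr] at h1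
    simpa using h1.symm.trans h2
  subst hn
  have he : e₁ = e₂ := OrderEmbedding.range_inj.1 hr
  subst he
  have hl : l₁ = l₂ := funext fun i => (lab₁ i).symm.trans (lab₂ i)
  subst hl
  have hS : S₁ = S₂ := sp₁.trans sp₂.symm
  have hT : T₁ = T₂ := tp₁.trans tp₂.symm
  subst hS hT
  have hfac := fac₁.trans fac₂.symm
  have h1 : d₁.trans e₁ = d₂.trans e₁ := congrArg LoSet.Hom.emb hfac
  have h2 : e₁ '' dA₁ ∪ A₁ = e₁ '' dA₂ ∪ A₁ := congrArg LoSet.Hom.A hfac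
  have h3 : e₁ '' dB₁ ∪ B₁ = e₁ '' dB₂ ∪ B₁ := congrArg LoSet.Hom.B hfac
  have hd : d₁ = d₂ := by
    ext i : 1
    exact e₁.injective (congrArg (fun k => k i) h1)
  have hnot : ∀ i, e₁ i ∉ A₁ ∪ B₁ := fun i hi => by rw [un₁] at hi; exact hi ⟨i, rfl⟩
  have key : ∀ (P Q R : Set _), (∀ i, e₁ i ∉ R) → e₁ '' P ∪ R = e₁ '' Q ∪ R → P = Q := by
    intro P Q R hR h
    ext i
    have := congrArg (fun s => e₁ i ∈ s) h
    simpa [hR i] using this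
  have hdA : dA₁ = dA₂ := key _ _ _ (fun i hi => hnot i (Or.inl hi)) h2
  have hdB : dB₁ = dB₂ := key _ _ _ (fun i hi => hnot i (Or.inr hi)) h3
  subst hd hdA hdB
  rfl

/-- The order embedding that enumerates a set of positions. -/
noncomputable def enumEmb {n : ℕ} (K : Set (Fin n)) : Fin K.ncard ↪o Fin n :=
  K.toFinite.toFinset.orderEmbOfFin (Set.ncard_eq_toFinset_card K).symm

theorem range_enumEmb {n : ℕ} (K : Set (Fin n)) : Set.range (enumEmb K) = K := by
  simp [enumEmb]

/-- The factorisation: `e` omits the unstarted events outside of `S_V` and the terminated events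
outside of `T_V`. -/
noncomputable def factor {U : LoSet Alph} {V : ILoSet Alph} (m : U ⟶ V.toLoSet) : Factor m :=
  have hm : m.A ∪ m.B = (Set.range m.emb)ᶜ := m.union
  let K : Set (Fin V.len) := (m.A \ V.S ∪ m.B \ V.T)ᶜ
  have hK : Set.range (enumEmb K) = K := range_enumEmb K
  have hmK : ∀ i, m.emb i ∈ Set.range (enumEmb K) := fun i => by
    have hn : m.emb i ∉ m.A ∪ m.B := by rw [hm]; exact fun h => h ⟨i, rfl⟩
    rw [hK]
    rintro (h | h)
    · exact hn (Or.inl h.1)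
    · exact hn (Or.inr h.1)
  have hsymm : ∀ i, enumEmb K ((enumEmb K).orderIso.symm ⟨m.emb i, hmK i⟩) = m.emb i := fun i =>
    congrArg Subtype.val ((enumEmb K).orderIso.apply_symm_apply ⟨m.emb i, hmK i⟩)
  { mid :=
      { len := K.ncard
        lab := fun i => V.lab (enumEmb K i)
        S := enumEmb K ⁻¹' V.S
        T := enumEmb K ⁻¹' V.T }
    e :=
      { emb := enumEmb K
        A := m.A \ V.S
        B := m.B \ V.T
        lab_emb := fun _ => rfl
        disj := m.disj.mono Set.sdiff_subset Set.sdiff_subset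
        union := by rw [hK, compl_compl]
        S_pre := rfl
        T_pre := rfl
        A_S := Set.disjoint_sdiff_left
        B_T := Set.disjoint_sdiff_left }
    d :=
      { emb := OrderEmbedding.ofMapLEIff
          (fun i => (enumEmb K).orderIso.symm ⟨m.emb i, hmK i⟩)
          (fun i j => by simp)
        A := enumEmb K ⁻¹' m.A
        B := enumEmb K ⁻¹' m.B
        lab_emb := fun i => (congrArg V.lab (hsymm i)).trans (m.lab_emb i)
        disj := m.disj.preimage _
        union := by
          rw [← Set.preimage_union, hm]
          ext j
          constructor
          · rintro h ⟨i, rfl⟩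
            exact h ⟨i, (hsymm i).symm⟩
          · rintro h ⟨i, hi⟩
            exact h ⟨i, (enumEmb K).injective ((hsymm i).trans hi)⟩ }
    fac := by
      apply LoSet.Hom.ext
      · ext i : 1
        exact hsymm i
      · change enumEmb K '' (enumEmb K ⁻¹' m.A) ∪ m.A \ V.S = m.A
        rw [Set.image_preimage_eq_inter_range, hK]
        ext x
        have : x ∈ m.A → x ∉ m.B := fun h => Set.disjoint_left.1 m.disj h
        simp only [K, Set.mem_union, Set.mem_inter_iff, Set.mem_compl_iff, Set.mem_sdiff]
        tauto
      · change enumEmb K '' (enumEmb K ⁻¹' m.B) ∪ m.B \ V.T = m.B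
        rw [Set.image_preimage_eq_inter_range, hK]
        ext x
        have : x ∈ m.A → x ∉ m.B := fun h => Set.disjoint_left.1 m.disj h
        simp only [K, Set.mem_union, Set.mem_inter_iff, Set.mem_compl_iff, Set.mem_sdiff]
        tauto
    hA := by
      intro i hi
      by_contra hS
      have h1 : enumEmb K i ∈ K := hK.subset ⟨i, rfl⟩
      exact h1 (Or.inl ⟨hi, hS⟩)
    hB := by
      intro i hi
      by_contra hS
      have h1 : enumEmb K i ∈ K := hK.subset ⟨i, rfl⟩
      exact h1 (Or.inr ⟨hi, hS⟩) }

/-- The cells `[x; A, B]` of `Cl(X)[U]`: a cell `x ∈ X[V]` and disjoint sets `A ⊆ S_V`,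
`B ⊆ T_V` such that `U = V ∖ (A ∪ B)`. The sets `A`, `B` and the identification of `U` with
`V ∖ (A ∪ B)` are given by a coface map `d = d_{A,B} : U → V` of lo-sets. -/
structure ClosureCell (X : (ILoSet Alph)ᵒᵖ ⥤ Type u) (U : LoSet Alph) : Type u where
  base : ILoSet Alph
  x : X.obj (op base)
  d : U ⟶ base.toLoSet
  hA : d.A ⊆ base.S
  hB : d.B ⊆ base.T

/-- The face of `[x; A, B]` obtained from a factorisation. -/
def ClosureCell.faceOf {X : (ILoSet Alph)ᵒᵖ ⥤ Type u} {U W : LoSet Alph} (c : ClosureCell X U)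
    {m : W ⟶ c.base.toLoSet} (f : Factor m) : ClosureCell X W :=
  ⟨f.mid, X.map f.e.op c.x, f.d, f.hA, f.hB⟩

/-- The face maps
`δ_{C,D}[x; A, B] = [δ_{C∖S,D∖T}(x); A ∪ (C ∩ S), B ∪ (D ∩ T)]` of the closure. -/
noncomputable def ClosureCell.face {X : (ILoSet Alph)ᵒᵖ ⥤ Type u} {U W : LoSet Alph}
    (c : ClosureCell X U) (g : W ⟶ U) : ClosureCell X W :=
  c.faceOf (factor (g ≫ c.d))

theorem ClosureCell.face_eq {X : (ILoSet Alph)ᵒᵖ ⥤ Type u} {U W : LoSet Alph}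
    (c : ClosureCell X U) (g : W ⟶ U) (f : Factor (g ≫ c.d)) : c.face g = c.faceOf f := by
  rw [Factor.eq f (factor (g ≫ c.d))]; rfl

/-- The closure of an ipc-set. -/
noncomputable def closurePresheaf (X : (ILoSet Alph)ᵒᵖ ⥤ Type u) : (LoSet Alph)ᵒᵖ ⥤ Type u where
  obj U := ClosureCell X U.unop
  map g := TypeCat.ofHom fun c => c.face g.unop
  map_id U := by
    ext c
    have h := c.face_eq (𝟙 _)
      ⟨c.base, 𝟙 _, c.d, by rw [Category.id_comp]; exact Category.comp_id c.d, c.hA, c.hB⟩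
    refine h.trans ?_
    simp [ClosureCell.faceOf]
  map_comp {U V W} g h := by
    ext c
    let f₁ := factor (g.unop ≫ c.d)
    let f₂ := factor (h.unop ≫ f₁.d)
    have key := c.face_eq (h.unop ≫ g.unop)
      ⟨f₂.mid, f₂.e ≫ f₁.e, f₂.d, by
        change f₂.d ≫ (f₂.e.toHom ≫ f₁.e.toHom : f₂.mid.toLoSet ⟶ c.base.toLoSet) = _
        rw [← Category.assoc, f₂.fac, Category.assoc, f₁.fac, Category.assoc], f₂.hA, f₂.hB⟩
    refine key.trans ?_
    simp [ClosureCell.face, ClosureCell.faceOf, f₁, f₂]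

/-- The cell `[x; ∅, ∅]` of the closure. -/
def closureCellOf {X : (ILoSet Alph)ᵒᵖ ⥤ Type u} {V : ILoSet Alph} (x : X.obj (op V)) :
    (closurePresheaf X).obj (op V.toLoSet) :=
  (⟨V, x, 𝟙 V.toLoSet, Set.empty_subset _, Set.empty_subset _⟩ : ClosureCell X V.toLoSet)

/-- Only finitely many coface maps end in a given lo-set. -/
theorem finite_homs (V : LoSet Alph) : Finite (Σ U : LoSet Alph, (U ⟶ V)) := by
  let φ : (Σ U : LoSet Alph, (U ⟶ V)) →
      (Σ m : Fin (V.len + 1), (Fin m → Fin V.len) × Set (Fin V.len) × Set (Fin V.len)) :=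
    fun p => ⟨⟨p.1.len, by
      have := Fintype.card_le_of_injective _ p.2.emb.injective
      simp at this
      omega⟩, p.2.emb, p.2.A, p.2.B⟩
  refine Finite.of_injective φ ?_
  rintro ⟨⟨n₁, l₁⟩, ⟨e₁, A₁, B₁, lab₁, _, _⟩⟩ ⟨⟨n₂, l₂⟩, ⟨e₂, A₂, B₂, lab₂, _, _⟩⟩ h
  dsimp only [φ] at h
  have hn : n₁ = n₂ := by
    have := congrArg (fun q => (q.1 : ℕ)) h
    exact this
  subst hn
  simp only [Sigma.mk.injEq, heq_eq_eq, Prod.mk.injEq, true_and] at h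
  obtain ⟨he, rfl, rfl⟩ := h
  have he' : e₁ = e₂ := DFunLike.coe_injective he
  subst he'
  have hl : l₁ = l₂ := funext fun i => (lab₁ i).symm.trans (lab₂ i)
  subst hl
  rfl

theorem finite_closure (X : (ILoSet Alph)ᵒᵖ ⥤ Type u) (hX : Finite (Cells X)) :
    Finite (Cells (closurePresheaf X)) := by
  have := hX
  have : ∀ c : Cells X, Finite (Σ U : LoSet Alph, (U ⟶ c.1.toLoSet)) := fun c =>
    finite_homs _
  let φ : Cells (closurePresheaf X) → Σ c : Cells X, Σ U : LoSet Alph, (U ⟶ c.1.toLoSet) :=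
    fun c => ⟨⟨ClosureCell.base c.2, ClosureCell.x c.2⟩, c.1, ClosureCell.d c.2⟩
  refine Finite.of_injective φ ?_
  rintro ⟨U₁, ⟨V₁, x₁, d₁, _, _⟩⟩ ⟨U₂, ⟨V₂, x₂, d₂, _, _⟩⟩ h
  simp only [φ, Sigma.mk.injEq] at h
  obtain ⟨⟨rfl, hx⟩, h⟩ := h
  cases hx
  simp only [heq_eq_eq, Sigma.mk.injEq] at h
  obtain ⟨rfl, h⟩ := h
  cases h
  rfl

/-- The closure of an iHDA; its start (accept) cells are the `[x; ∅, ∅]` with `x` a start (accept)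
cell. -/
noncomputable def IHDA.closure (X : IHDA Alph) : HDA Alph where
  cell := closurePresheaf X.cell
  finite := finite_closure X.cell X.finite
  start := (fun x => ⟨x.1.toLoSet, closureCellOf x.2⟩) '' X.start
  accept := (fun x => ⟨x.1.toLoSet, closureCellOf x.2⟩) '' X.accept

/-! ### Sequential gluing -/

section Gluing

variable {C : Type u} [SmallCategory C] {n : ℕ}
  (X : Fin (n + 1) → Cᵒᵖ ⥤ Type u) (Y : Fin n → Cᵒᵖ ⥤ Type u)
  (f : ∀ k : Fin n, Y k ⟶ X k.succ) (g : ∀ k : Fin n, Y k ⟶ X k.castSucc)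

/-- The identification of `g_k(y) ∈ X_k` with `f_k(y) ∈ X_{k+1}`. -/
inductive GlueStep (W : Cᵒᵖ) : (Σ k, (X k).obj W) → (Σ k, (X k).obj W) → Prop
  | mk (k : Fin n) (y : (Y k).obj W) :
      GlueStep W ⟨k.castSucc, (g k).app W y⟩ ⟨k.succ, (f k).app W y⟩

/-- The colimit of the zigzag `X_0 ← Y_0 → X_1 ← Y_1 → ⋯ ← Y_{n-1} → X_n`, computed pointwise as
a quotient of the disjoint union of the `X_k`. -/
def seqGluing : Cᵒᵖ ⥤ Type u where
  obj W := Quot (GlueStep X Y f g W)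
  map {W W'} h := TypeCat.ofHom (Quot.map (fun p => ⟨p.1, (X p.1).map h p.2⟩) (by
    rintro _ _ ⟨k, y⟩
    have h1 := NatTrans.naturality_apply (g k) h y
    have h2 := NatTrans.naturality_apply (f k) h y
    dsimp only
    rw [← h1, ← h2]
    exact GlueStep.mk k _))
  map_id W := by
    ext p
    induction p using Quot.ind
    simp [Quot.map]
  map_comp h h' := by
    ext p
    induction p using Quot.ind
    simp [Quot.map]

/-- The structural map `j_k`, on cells. -/
def seqGluingIncl (k : Fin (n + 1)) (x : Cells (X k)) : Cells (seqGluing X Y f g) :=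
  ⟨x.1, Quot.mk _ ⟨k, x.2⟩⟩

theorem finite_seqGluing (hX : ∀ k, Finite (Cells (X k))) :
    Finite (Cells (seqGluing X Y f g)) := by
  have := hX
  refine Finite.of_surjective
    (fun p : Σ k, Cells (X k) => seqGluingIncl X Y f g p.1 p.2) ?_
  rintro ⟨W, q⟩
  obtain ⟨⟨k, x⟩, rfl⟩ := Quot.exists_rep q
  exact ⟨⟨k, W, x⟩, rfl⟩

end Gluing

/-- The sequential composition of the iHDAs `X_0, …, X_n`: the sequential gluing of their closures
along the cubes `□^{U_k}`, which are mapped by the Yoneda embeddings of the accept cell `xacc k` of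
`X_k` and the start cell `xst k` of `X_{k+1}`. -/
noncomputable def seqComp {n : ℕ} (X : Fin (n + 1) → IHDA Alph) (U : Fin n → LoSet Alph)
    (S T : ∀ k, Set (Fin (U k).len))
    (xacc : ∀ k : Fin n, (X k.castSucc).cell.obj (op ⟨U k, S k, Set.univ⟩))
    (xst : ∀ k : Fin n, (X k.succ).cell.obj (op ⟨U k, Set.univ, T k⟩)) : HDA Alph :=
  let Z : Fin (n + 1) → (LoSet Alph)ᵒᵖ ⥤ Type u := fun k => (X k).closure.cell
  let Y : Fin n → (LoSet Alph)ᵒᵖ ⥤ Type u := fun k => yoneda.obj (U k)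
  let f : ∀ k : Fin n, Y k ⟶ Z k.succ := fun k => yonedaEquiv.symm (closureCellOf (xst k))
  let g : ∀ k : Fin n, Y k ⟶ Z k.castSucc := fun k => yonedaEquiv.symm (closureCellOf (xacc k))
  { cell := seqGluing Z Y f g
    finite := finite_seqGluing Z Y f g fun k => (X k).closure.finite
    start := seqGluingIncl Z Y f g 0 '' (X 0).closure.start
    accept := seqGluingIncl Z Y f g (Fin.last n) '' (X (Fin.last n)).closure.accept }

/-! ### Ipomsets -/

/-- A labelled iposet: precedence order `lt`, event order `ev`, source interface `S`, target
interface `T` and labelling `lab`. -/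
structure Iposet (Alph : Type u) where
  carrier : Type
  finite : Finite carrier
  lt : carrier → carrier → Prop
  ev : carrier → carrier → Prop
  lt_strict : IsStrictOrder carrier lt
  ev_strict : IsStrictOrder carrier ev
  total : ∀ x y, x = y ∨ lt x y ∨ lt y x ∨ ev x y ∨ ev y x
  S : Set carrier
  T : Set carrier
  S_min : ∀ s ∈ S, ∀ x, ¬ lt x s
  T_max : ∀ t ∈ T, ∀ x, ¬ lt t x
  lab : carrier → Alph

namespace Iposet

/-- Subsumptions: bijections which respect labels and interfaces, reflect precedence and preserve
the event order of concurrent events. -/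
structure IsSubsumption (P Q : Iposet Alph) (f : P.carrier ≃ Q.carrier) : Prop where
  lab : ∀ x, Q.lab (f x) = P.lab x
  S : f '' P.S = Q.S
  T : f '' P.T = Q.T
  lt : ∀ x y, Q.lt (f x) (f y) → P.lt x y
  ev : ∀ x y, P.ev x y → ¬ P.lt x y → ¬ P.lt y x → Q.ev (f x) (f y)

/-- `P ⊑ Q`. -/
def Subsumed (P Q : Iposet Alph) : Prop := ∃ f, IsSubsumption P Q f

/-- Isomorphisms: subsumptions which are isomorphisms for the precedence order. (The event order
between events ordered by precedence is irrelevant.) -/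
def Isomorphic (P Q : Iposet Alph) : Prop :=
  ∃ f, IsSubsumption P Q f ∧ ∀ x y, P.lt x y → Q.lt (f x) (f y)

theorem Isomorphic.refl (P : Iposet Alph) : Isomorphic P P :=
  ⟨Equiv.refl _, ⟨fun _ => rfl, by simp, by simp, fun _ _ h => h, fun _ _ h _ _ => h⟩,
    fun _ _ h => h⟩

theorem Isomorphic.symm {P Q : Iposet Alph} (h : Isomorphic P Q) : Isomorphic Q P := by
  obtain ⟨f, hf, hlt⟩ := h
  refine ⟨f.symm, ⟨fun x => ?_, ?_, ?_, fun x y h => ?_, fun x y h h1 h2 => ?_⟩, fun x y h => ?_⟩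
  · rw [← hf.lab, f.apply_symm_apply]
  · rw [← hf.S]; simp
  · rw [← hf.T]; simp
  · simpa using hlt _ _ h
  · have h1' : ¬ P.lt (f.symm x) (f.symm y) := fun h => h1 (by simpa using hlt _ _ h)
    have h2' : ¬ P.lt (f.symm y) (f.symm x) := fun h => h2 (by simpa using hlt _ _ h)
    have := Q.ev_strict
    rcases P.total (f.symm x) (f.symm y) with h3 | h3 | h3 | h3 | h3
    · rw [f.symm.injective h3] at h
      exact absurd h (irrefl_of Q.ev y)
    · exact absurd h3 h1'
    · exact absurd h3 h2'
    · exact h3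
    · have h4 := hf.ev _ _ h3 h2' h1'
      simp only [f.apply_symm_apply] at h4
      exact absurd (trans_of Q.ev h h4) (irrefl_of Q.ev x)
  · exact hf.lt _ _ (by simpa using h)

theorem Isomorphic.trans {P Q R : Iposet Alph} (h : Isomorphic P Q) (h' : Isomorphic Q R) :
    Isomorphic P R := by
  obtain ⟨f, hf, hlt⟩ := h
  obtain ⟨g, hg, hlt'⟩ := h'
  refine ⟨f.trans g, ⟨fun x => ?_, ?_, ?_, fun x y h => ?_, fun x y h h1 h2 => ?_⟩,
    fun x y h => hlt' _ _ (hlt _ _ h)⟩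
  · exact (hg.lab _).trans (hf.lab _)
  · rw [← hg.S, ← hf.S, Set.image_image]; rfl
  · rw [← hg.T, ← hf.T, Set.image_image]; rfl
  · exact hf.lt _ _ (hg.lt _ _ h)
  · exact hg.ev _ _ (hf.ev _ _ h h1 h2) (fun h => h1 (hf.lt _ _ h)) (fun h => h2 (hf.lt _ _ h))

instance setoid (Alph : Type u) : Setoid (Iposet Alph) where
  r := Isomorphic
  iseqv := ⟨Isomorphic.refl, Isomorphic.symm, Isomorphic.trans⟩

/-- Existence of an interval representation. -/
def IsInterval (P : Iposet Alph) : Prop :=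
  ∃ b e : P.carrier → ℝ, (∀ x, b x ≤ e x) ∧ ∀ x y, P.lt x y ↔ e x < b y

/-- An ilo-set as a discrete iposet. -/
def ofILoSet (V : ILoSet Alph) : Iposet Alph where
  carrier := Fin V.len
  finite := inferInstance
  lt _ _ := False
  ev i j := i < j
  lt_strict := { irrefl := fun _ h => h, trans := fun _ _ _ h _ => h }
  ev_strict := { irrefl := lt_irrefl, trans := fun _ _ _ => lt_trans }
  total i j := by
    rcases lt_trichotomy i j with h | h | h
    · exact Or.inr (Or.inr (Or.inr (Or.inl h)))
    · exact Or.inl h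
    · exact Or.inr (Or.inr (Or.inr (Or.inr h)))
  S := V.S
  T := V.T
  S_min _ _ _ h := h
  T_max _ _ _ h := h
  lab := V.lab

/-- A lo-isomorphism `T_P ≃ S_Q`. -/
structure Matching (P Q : Iposet Alph) where
  equiv : {p // p ∈ P.T} ≃ {q // q ∈ Q.S}
  ev_iff : ∀ a b, P.ev a.1 b.1 ↔ Q.ev (equiv a).1 (equiv b).1
  lab : ∀ a, Q.lab (equiv a).1 = P.lab a.1

section Glue

variable (P Q : Iposet Alph) (f : Matching P Q)

/-- The carrier of `P * Q`: the quotient of `P ⊔ Q` by `T_P ≃ S_Q`, represented as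
`P ⊔ (Q ∖ S_Q)`. -/
abbrev GlueCarrier : Type := P.carrier ⊕ {q : Q.carrier // q ∉ Q.S}

variable {P Q}

open Classical in
/-- The structural inclusion of `Q` in `P * Q`; the one of `P` is `Sum.inl`. -/
noncomputable def glueInr (q : Q.carrier) : GlueCarrier P Q :=
  if h : q ∈ Q.S then Sum.inl (f.equiv.symm ⟨q, h⟩).1 else Sum.inr ⟨q, h⟩

/-- The precedence order of `P * Q`. -/
inductive GlueLt : GlueCarrier P Q → GlueCarrier P Q → Prop
  | left {p p'} : P.lt p p' → GlueLt (Sum.inl p) (Sum.inl p')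
  | right {q q'} : Q.lt q q' → GlueLt (glueInr f q) (glueInr f q')
  | cross {p q} : p ∉ P.T → q ∉ Q.S → GlueLt (Sum.inl p) (glueInr f q)

/-- The union of the event orders of `P` and `Q`. -/
inductive GlueEvStep : GlueCarrier P Q → GlueCarrier P Q → Prop
  | left {p p'} : P.ev p p' → GlueEvStep (Sum.inl p) (Sum.inl p')
  | right {q q'} : Q.ev q q' → GlueEvStep (glueInr f q) (glueInr f q')

theorem glueInr_mem {q : Q.carrier} (h : q ∈ Q.S) :
    glueInr f q = Sum.inl (f.equiv.symm ⟨q, h⟩).1 := dif_pos h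

theorem glueInr_not_mem {q : Q.carrier} (h : q ∉ Q.S) :
    glueInr f q = Sum.inr ⟨q, h⟩ := dif_neg h

theorem glueInr_equiv (t : {p // p ∈ P.T}) : glueInr f (f.equiv t).1 = Sum.inl t.1 := by
  rw [glueInr_mem f (f.equiv t).2]
  simp

theorem glueInr_eq_inl {q : Q.carrier} {p : P.carrier} (h : glueInr f q = Sum.inl p) :
    ∃ t : {p // p ∈ P.T}, t.1 = p ∧ (f.equiv t).1 = q := by
  by_cases hq : q ∈ Q.S
  · rw [glueInr_mem f hq] at h
    exact ⟨f.equiv.symm ⟨q, hq⟩, Sum.inl.inj h, by simp⟩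
  · rw [glueInr_not_mem f hq] at h
    cases h

theorem glueInr_eq_inr {q : Q.carrier} {q' : {q : Q.carrier // q ∉ Q.S}}
    (h : glueInr f q = Sum.inr q') : q = q'.1 := by
  by_cases hq : q ∈ Q.S
  · rw [glueInr_mem f hq] at h
    cases h
  · rw [glueInr_not_mem f hq] at h
    cases h
    rfl

/-- Precedence in `P * Q`, case by case. -/
def GlueLt' : GlueCarrier P Q → GlueCarrier P Q → Prop
  | Sum.inl p, Sum.inl p' => P.lt p p'
  | Sum.inl p, Sum.inr q => p ∉ P.T ∨ ∃ t, t.1 = p ∧ Q.lt (f.equiv t).1 q.1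
  | Sum.inr _, Sum.inl _ => False
  | Sum.inr q, Sum.inr q' => Q.lt q.1 q'.1

theorem glueLt_iff (x y : GlueCarrier P Q) : GlueLt f x y ↔ GlueLt' f x y := by
  constructor
  · rintro (h | h | ⟨hp, hq⟩)
    · exact h
    · rename_i q q'
      have hq' : q' ∉ Q.S := fun hS => Q.S_min _ hS _ h
      rw [glueInr_not_mem f hq']
      by_cases hq : q ∈ Q.S
      · rw [glueInr_mem f hq]
        exact Or.inr ⟨f.equiv.symm ⟨q, hq⟩, rfl, by simpa using h⟩
      · rw [glueInr_not_mem f hq]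
        exact h
    · rw [glueInr_not_mem f hq]
      exact Or.inl hp
  · rcases x with p | q <;> rcases y with p' | q' <;> intro h
    · exact GlueLt.left h
    · rw [← glueInr_not_mem f q'.2]
      rcases h with h | ⟨t, rfl, h⟩
      · exact GlueLt.cross h q'.2
      · rw [← glueInr_equiv f t]
        exact GlueLt.right h
    · exact h.elim
    · rw [← glueInr_not_mem f q.2, ← glueInr_not_mem f q'.2]
      exact GlueLt.right h

theorem glueLt_strict : IsStrictOrder (GlueCarrier P Q) (GlueLt f) where
  irrefl x := by
    rw [glueLt_iff]
    have := P.lt_strict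
    have := Q.lt_strict
    rcases x with p | q
    · exact irrefl_of P.lt p
    · exact irrefl_of Q.lt q.1
  trans x y z := by
    simp only [glueLt_iff]
    have := P.lt_strict
    have := Q.lt_strict
    rcases x with p | q <;> rcases y with p' | q' <;> rcases z with p'' | q'' <;> intro h h'
    · exact trans_of P.lt h h'
    · exact Or.inl fun hT => P.T_max _ hT _ h
    · exact h'.elim
    · rcases h with h | ⟨t, rfl, h⟩
      · exact Or.inl h
      · exact Or.inr ⟨t, rfl, trans_of Q.lt h h'⟩
    · exact h.elim
    · exact h.elim
    · exact h'.elim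
    · exact trans_of Q.lt h h'

/-- The event order of `P * Q`, case by case. -/
def GlueEv' : GlueCarrier P Q → GlueCarrier P Q → Prop
  | Sum.inl p, Sum.inl p' => P.ev p p'
  | Sum.inl p, Sum.inr q => ∃ t, (p = t.1 ∨ P.ev p t.1) ∧ Q.ev (f.equiv t).1 q.1
  | Sum.inr q, Sum.inl p => ∃ t, Q.ev q.1 (f.equiv t).1 ∧ (t.1 = p ∨ P.ev t.1 p)
  | Sum.inr q, Sum.inr q' => Q.ev q.1 q'.1

theorem glueEv'_of_step {x y : GlueCarrier P Q} (h : GlueEvStep f x y) : GlueEv' f x y := by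
  rcases h with h | h
  · exact h
  · rename_i q q'
    by_cases hq : q ∈ Q.S <;> by_cases hq' : q' ∈ Q.S
    · rw [glueInr_mem f hq, glueInr_mem f hq']
      exact (f.ev_iff _ _).2 (by simpa using h)
    · rw [glueInr_mem f hq, glueInr_not_mem f hq']
      exact ⟨_, Or.inl rfl, by simpa using h⟩
    · rw [glueInr_not_mem f hq, glueInr_mem f hq']
      exact ⟨_, by simpa using h, Or.inl rfl⟩
    · rw [glueInr_not_mem f hq, glueInr_not_mem f hq']
      exact h

theorem glueEv'_trans {x y z : GlueCarrier P Q} (h : GlueEv' f x y) (h' : GlueEv' f y z) :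
    GlueEv' f x z := by
  have := P.ev_strict
  have := Q.ev_strict
  rcases x with p | q <;> rcases y with p' | q' <;> rcases z with p'' | q''
  · exact trans_of P.ev h h'
  · obtain ⟨t, rfl | ht, h'⟩ := h'
    · exact ⟨t, Or.inr h, h'⟩
    · exact ⟨t, Or.inr (trans_of P.ev h ht), h'⟩
  · obtain ⟨t, ht, h⟩ := h
    obtain ⟨t', h', ht'⟩ := h'
    have htt : P.ev t.1 t'.1 := (f.ev_iff t t').2 (trans_of Q.ev h h')
    have h1 : P.ev p t'.1 := by
      rcases ht with rfl | ht
      · exact htt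
      · exact trans_of P.ev ht htt
    rcases ht' with rfl | ht'
    · exact h1
    · exact trans_of P.ev h1 ht'
  · obtain ⟨t, ht, h⟩ := h
    exact ⟨t, ht, trans_of Q.ev h h'⟩
  · obtain ⟨t, h, ht⟩ := h
    refine ⟨t, h, Or.inr ?_⟩
    rcases ht with rfl | ht
    · exact h'
    · exact trans_of P.ev ht h'
  · obtain ⟨t, h, ht⟩ := h
    obtain ⟨t', ht', h'⟩ := h'
    have htt : t = t' ∨ P.ev t.1 t'.1 := by
      rcases ht with rfl | ht <;> rcases ht' with ht' | ht'
      · exact Or.inl (Subtype.ext ht')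
      · exact Or.inr ht'
      · exact Or.inr (ht' ▸ ht)
      · exact Or.inr (trans_of P.ev ht ht')
    rcases htt with rfl | htt
    · exact trans_of Q.ev h h'
    · exact trans_of Q.ev (trans_of Q.ev h ((f.ev_iff t t').1 htt)) h'
  · obtain ⟨t, h', ht⟩ := h'
    exact ⟨t, trans_of Q.ev h h', ht⟩
  · exact trans_of Q.ev h h'

theorem glueEv'_of_transGen {x y : GlueCarrier P Q}
    (h : Relation.TransGen (GlueEvStep f) x y) : GlueEv' f x y := by
  induction h with
  | single h => exact glueEv'_of_step f h
  | tail _ h ih => exact glueEv'_trans f ih (glueEv'_of_step f h)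

/-- The gluing composition `P * Q` of iposets with `T_P ≃ S_Q`. -/
noncomputable def glue : Iposet Alph where
  carrier := GlueCarrier P Q
  finite := by
    have := P.finite
    have := Q.finite
    infer_instance
  lt := GlueLt f
  ev := Relation.TransGen (GlueEvStep f)
  lt_strict := glueLt_strict f
  ev_strict :=
    { irrefl := fun x h => by
        have h' := glueEv'_of_transGen f h
        have := P.ev_strict
        have := Q.ev_strict
        rcases x with p | q
        · exact irrefl_of P.ev p h'
        · exact irrefl_of Q.ev q.1 h'
      trans := fun _ _ _ => Relation.TransGen.trans }
  total := by
    have hQ : ∀ q q' : Q.carrier, glueInr f q = glueInr f q' ∨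
        GlueLt f (glueInr f q) (glueInr f q') ∨ GlueLt f (glueInr f q') (glueInr f q) ∨
        Relation.TransGen (GlueEvStep f) (glueInr f q) (glueInr f q') ∨
        Relation.TransGen (GlueEvStep f) (glueInr f q') (glueInr f q) := by
      intro q q'
      rcases Q.total q q' with h | h | h | h | h
      · exact Or.inl (h ▸ rfl)
      · exact Or.inr (Or.inl (GlueLt.right h))
      · exact Or.inr (Or.inr (Or.inl (GlueLt.right h)))
      · exact Or.inr (Or.inr (Or.inr (Or.inl (.single (GlueEvStep.right h)))))
      · exact Or.inr (Or.inr (Or.inr (Or.inr (.single (GlueEvStep.right h)))))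
    rintro (p | q) (p' | q')
    · rcases P.total p p' with h | h | h | h | h
      · exact Or.inl (h ▸ rfl)
      · exact Or.inr (Or.inl (GlueLt.left h))
      · exact Or.inr (Or.inr (Or.inl (GlueLt.left h)))
      · exact Or.inr (Or.inr (Or.inr (Or.inl (.single (GlueEvStep.left h)))))
      · exact Or.inr (Or.inr (Or.inr (Or.inr (.single (GlueEvStep.left h)))))
    · rw [← glueInr_not_mem f q'.2]
      by_cases hp : p ∈ P.T
      · have := hQ (f.equiv ⟨p, hp⟩).1 q'.1
        rwa [glueInr_equiv] at this
      · exact Or.inr (Or.inl (GlueLt.cross hp q'.2))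
    · rw [← glueInr_not_mem f q.2]
      by_cases hp : p' ∈ P.T
      · have := hQ q.1 (f.equiv ⟨p', hp⟩).1
        rwa [glueInr_equiv] at this
      · exact Or.inr (Or.inr (Or.inl (GlueLt.cross hp q.2)))
    · have := hQ q.1 q'.1
      rwa [glueInr_not_mem f q.2, glueInr_not_mem f q'.2] at this
  S := Sum.inl '' P.S
  T := glueInr f '' Q.T
  S_min := by
    rintro _ ⟨s, hs, rfl⟩ x h
    rw [glueLt_iff] at h
    rcases x with p | q
    · exact P.S_min s hs p h
    · exact h
  T_max := by
    rintro _ ⟨t, ht, rfl⟩ x h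
    rw [glueLt_iff] at h
    by_cases hS : t ∈ Q.S
    · rw [glueInr_mem f hS] at h
      rcases x with p | q
      · exact P.T_max _ (f.equiv.symm ⟨t, hS⟩).2 _ h
      · rcases h with h | ⟨t', ht', h⟩
        · exact h (f.equiv.symm ⟨t, hS⟩).2
        · have h2 : f.equiv t' = ⟨t, hS⟩ := by rw [Subtype.ext ht']; simp
          rw [h2] at h
          exact Q.T_max t ht _ h
    · rw [glueInr_not_mem f hS] at h
      rcases x with p | q
      · exact h
      · exact Q.T_max t ht _ h
  lab := Sum.elim P.lab fun q => Q.lab q.1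

end Glue

end Iposet

/-- Ipomsets: isomorphism classes of labelled iposets. -/
def Ipomset (Alph : Type u) : Type (max 1 u) := Quotient (Iposet.setoid Alph)

/-- The gluing product of languages: the interval ipomsets subsumed by some `P * Q`, `P ∈ L`,
`Q ∈ M`, `T_P ≃ S_Q`. -/
def langMul (L M : Set (Ipomset Alph)) : Set (Ipomset Alph) :=
  {R | ∃ (P Q R' : Iposet Alph) (f : Iposet.Matching P Q),
    (Quotient.mk _ P : Ipomset Alph) ∈ L ∧ (Quotient.mk _ Q : Ipomset Alph) ∈ M ∧
    R = Quotient.mk _ R' ∧ R'.IsInterval ∧ R'.Subsumed (Iposet.glue f)}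

/-- The product `L_0 * ⋯ * L_n`. -/
def langProd : ∀ {n : ℕ}, (Fin (n + 1) → Set (Ipomset Alph)) → Set (Ipomset Alph)
  | 0, L => L 0
  | _ + 1, L => langMul (L 0) (langProd fun k => L k.succ)

/-! ### Ipomsets of paths and languages -/

/-- A lo-isomorphism from a lo-set to the source interface of an iposet. -/
structure SrcIso (U : LoSet Alph) (P : Iposet Alph) where
  equiv : Fin U.len ≃ {p // p ∈ P.S}
  ev_iff : ∀ i j, i < j ↔ P.ev (equiv i).1 (equiv j).1
  lab : ∀ i, P.lab (equiv i).1 = U.lab i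

/-- The ipomset `_U U_U`. -/
def idIposet (U : LoSet Alph) : Iposet Alph := .ofILoSet ⟨U, Set.univ, Set.univ⟩

/-- The ipomset `_{V∖A} V_V` of an up-step along `d⁰_A : U → V`. -/
def upIposet {U V : LoSet Alph} (d : U ⟶ V) : Iposet Alph :=
  .ofILoSet ⟨V, Set.range d.emb, Set.univ⟩

/-- The ipomset `_U U_{U∖B}` of a down-step along `d¹_B : V → U`. -/
def downIposet {U V : LoSet Alph} (d : V ⟶ U) : Iposet Alph :=
  .ofILoSet ⟨U, Set.univ, Set.range d.emb⟩

/-- The whole lo-set as source interface. -/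
def univSrc (U : LoSet Alph) (T : Set (Fin U.len)) :
    SrcIso U (.ofILoSet ⟨U, Set.univ, T⟩) where
  equiv := (Equiv.Set.univ _).symm
  ev_iff _ _ := Iff.rfl
  lab _ := rfl

/-- The source interface of the ipomset of an up-step. -/
noncomputable def upSrc {U V : LoSet Alph} (d : U ⟶ V) : SrcIso U (upIposet d) where
  equiv := d.emb.orderIso.toEquiv
  ev_iff _ _ := d.emb.lt_iff_lt.symm
  lab i := d.lab_emb i

/-- The target interface of an up-step matches a source interface isomorphic to `V`. -/
def upMatching {U V : LoSet Alph} (d : U ⟶ V) {Q : Iposet Alph} (s : SrcIso V Q) :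
    Iposet.Matching (upIposet d) Q where
  equiv := (Equiv.Set.univ _).trans s.equiv
  ev_iff _ _ := s.ev_iff _ _
  lab _ := s.lab _

/-- The target interface of a down-step matches a source interface isomorphic to `V`. -/
noncomputable def downMatching {U V : LoSet Alph} (d : V ⟶ U) {Q : Iposet Alph} (s : SrcIso V Q) :
    Iposet.Matching (downIposet d) Q where
  equiv := d.emb.orderIso.symm.toEquiv.trans s.equiv
  ev_iff a b :=
    (d.emb.orderIso.symm.lt_iff_lt (x := a) (y := b)).symm.trans (s.ev_iff _ _)
  lab a := (s.lab _).trans ((d.lab_emb _).symm.trans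
    (congrArg (fun x => U.lab x.1) (d.emb.orderIso.apply_symm_apply a)))

/-- The source interface of `P * Q` is that of `P`. -/
noncomputable def glueSrc {U : LoSet Alph} {P Q : Iposet Alph} (s : SrcIso U P)
    (f : Iposet.Matching P Q) : SrcIso U (Iposet.glue f) where
  equiv := s.equiv.trans (Equiv.Set.image Sum.inl P.S Sum.inl_injective)
  ev_iff i j :=
    ⟨fun h => .single (.left ((s.ev_iff i j).1 h)),
      fun h => (s.ev_iff i j).2 (Iposet.glueEv'_of_transGen f h)⟩
  lab i := s.lab i

section Language

variable {C : Type u} [SmallCategory C] (G : C ⥤ LoSet Alph) {X : Cᵒᵖ ⥤ Type u}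

/-- The ipomset `ev(α)` of a path `α`, the gluing of the ipomsets of its steps, with the
identification of its source interface with the events of the first cell. -/
noncomputable def evAux : {x y : Cells X} → Path G X x y →
    Σ P : Iposet Alph, SrcIso (G.obj x.1) P
  | _, _, .nil x => ⟨idIposet (G.obj x.1), univSrc _ _⟩
  | _, _, .up d _ _ p =>
      ⟨Iposet.glue (upMatching (G.map d) (evAux p).2),
        glueSrc (upSrc (G.map d)) (upMatching (G.map d) (evAux p).2)⟩
  | _, _, .down d _ _ p =>
      ⟨Iposet.glue (downMatching (G.map d) (evAux p).2),
        glueSrc (univSrc _ _) (downMatching (G.map d) (evAux p).2)⟩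

/-- The ipomset of a path. -/
noncomputable def pathEv {x y : Cells X} (p : Path G X x y) : Ipomset Alph :=
  Quotient.mk _ (evAux G p).1

/-- The ipomsets of the paths from a cell in `start` to a cell in `accept`. -/
def langOf (start accept : Set (Cells X)) : Set (Ipomset Alph) :=
  {P | ∃ x ∈ start, ∃ y ∈ accept, ∃ p : Path G X x y, pathEv G p = P}

end Language

/-- The language of an HDA. -/
def HDA.Lang (X : HDA Alph) : Set (Ipomset Alph) := langOf (𝟭 (LoSet Alph)) X.start X.accept

/-- The language of an iHDA. -/
def IHDA.Lang (X : IHDA Alph) : Set (Ipomset Alph) := langOf (forgetIface Alph) X.start X.accept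

end HDAGluing

namespace HDAGluing

variable {Alph : Type u}

/-! ### Target interfaces and gluing of tracked iposets -/

namespace Iposet

/-! The composition is treated by splitting off its first automaton: it is the union of the images
of `Cl(X 0)` and of the composition of the remaining automata (`tailComp`), glued along the cube of
the accept cell `headAcc`. Properness enters through `IsFinalCube`: this cube embeds in `X 0` and is
closed under up-steps, and both properties pass to the closure (`IsFinalCube.closure_inj`,
`IsFinalCube.closure_closed`). Therefore the tail embeds in the composition (`tailMap_injective`),
it meets the image of `Cl(X 0)` only in faces of the accept cell (`exists_of_seqIncl_eq_tailMap`),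
and a path that has entered the tail stays there (`exists_tail_path`). The statement follows by
induction (`seqComp_lang`) from two inclusions for one splitting.

From the product to the composition: the track object of an iposet `R` is the precubical set of its
cuts (`Cut`) into unstarted, active and terminated events. A map from it to a precubical set that
sends the interfaces of `R` to given cells (`HasTrack`) exists when `R` is the ipomset of a path
between these cells (`hasTrack_evAux`). Such maps can be glued (`HasTrack.glue`) and pulled back
along subsumptions (`HasTrack.of_subsumption`), and for interval `R` they yield a path with ipomset
exactly `R` (`HasTrack.exists_path`). So every interval `R` subsumed by a product of two path
ipomsets is realised by a path.

From the composition to the product: a path in the composition may visit cells `[z; A, B]` with `A`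
or `B` nonempty, which are no cells of the automata. It is lifted by replacing such a cell by `z`,
so that the events of `A` start early and those of `B` terminate late. The invariant is `ExtendsTo`,
propagated from the end of the path to its beginning by `ExtendsTo.of_down`, `ExtendsTo.of_up` and,
for a change of representative, `ExtendsTo.of_common_face`. On entering the tail, the lifted path
runs to the accept cell and continues from the next start cell. Moving starts forward and
terminations back only removes precedence, so the ipomset of the original path is subsumed by the
product of those of the lifted pieces. The bookkeeping is done by `Tracks`: all paths are executions
of the events of one iposet `R`, and `Tracks.embeds`, `Embeds.glue` and `Embeds.subsumed` turn this
into a subsumption.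

For a single automaton the product takes no closure under subsumption, so the languages of `X` and
`Cl(X)` have to agree exactly. They do because a path in `Cl(X)` between cells with empty `A` and
`B` meets only such cells (`exists_path_of_closed_path`). -/

theorem ev_irrefl (P : Iposet Alph) (x : P.carrier) : ¬ P.ev x x :=
  have := P.ev_strict
  irrefl_of P.ev x

theorem ev_trans (P : Iposet Alph) {x y z : P.carrier} (h : P.ev x y) (h' : P.ev y z) :
    P.ev x z :=
  have := P.ev_strict
  trans_of P.ev h h'

theorem lt_irrefl (P : Iposet Alph) (x : P.carrier) : ¬ P.lt x x :=
  have := P.lt_strict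
  irrefl_of P.lt x

theorem lt_trans (P : Iposet Alph) {x y z : P.carrier} (h : P.lt x y) (h' : P.lt y z) :
    P.lt x z :=
  have := P.lt_strict
  trans_of P.lt h h'

variable {P Q : Iposet Alph} (f : Matching P Q)

theorem glueInr_injective : Function.Injective (glueInr f) := by
  intro q q' h
  by_cases hq : q' ∈ Q.S
  · rw [glueInr_mem f hq] at h
    obtain ⟨t, ht, rfl⟩ := glueInr_eq_inl f h
    have : t = f.equiv.symm ⟨q', hq⟩ := Subtype.ext ht
    rw [this]; simp
  · rw [glueInr_not_mem f hq] at h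
    exact glueInr_eq_inr f h

theorem glue_lab_glueInr (q : Q.carrier) : (glue f).lab (glueInr f q) = Q.lab q := by
  by_cases hq : q ∈ Q.S
  · rw [glueInr_mem f hq]
    have := f.lab (f.equiv.symm ⟨q, hq⟩)
    rw [Equiv.apply_symm_apply] at this
    exact this.symm
  · rw [glueInr_not_mem f hq]; rfl

theorem glue_ev_glueInr_iff (q q' : Q.carrier) (h : q = q' ∨ Q.ev q q' ∨ Q.ev q' q) :
    (glue f).ev (glueInr f q) (glueInr f q') ↔ Q.ev q q' := by
  refine ⟨fun h' => ?_, fun h' => .single (.right h')⟩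
  rcases h with rfl | h | h
  · exact absurd h' ((glue f).ev_irrefl _)
  · exact h
  · exact absurd ((glue f).ev_trans h' (.single (.right h))) ((glue f).ev_irrefl _)

/-- The extension to `P * Q` of compatible maps on `P` and `Q`. -/
def glueElim {α : Type*} (g : P.carrier → α) (h : Q.carrier → α) : (glue f).carrier → α :=
  Sum.elim g fun q => h q.1

theorem glueElim_glueInr {α : Type*} {g : P.carrier → α} {h : Q.carrier → α}
    (hgh : ∀ t, g t.1 = h (f.equiv t).1) (q : Q.carrier) :
    glueElim f g h (glueInr f q) = h q := by
  by_cases hq : q ∈ Q.S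
  · rw [glueInr_mem f hq]
    have := hgh (f.equiv.symm ⟨q, hq⟩)
    rw [Equiv.apply_symm_apply] at this
    exact this
  · rw [glueInr_not_mem f hq]; rfl

/-- Move the intervals of `Q` far to the right of those of `P`, and let each shared event begin as
in `P` and end as in `Q`. -/
theorem glue_interval (hP : P.IsInterval) (hQ : Q.IsInterval) : (glue f).IsInterval := by
  obtain ⟨b, e, hbe, hlt⟩ := hP
  obtain ⟨b', e', hbe', hlt'⟩ := hQ
  have := P.finite
  have := Q.finite
  -- By finiteness there is a shift after which every end in `P` lies before every beginning in `Q`;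
  -- this creates precisely the precedences between `P ∖ T_P` and `Q ∖ S_Q`.
  obtain ⟨K, hK⟩ : ∃ K : ℝ, ∀ p q, e p < b' q + K := by
    obtain ⟨K, hK⟩ := (Set.finite_range fun x : P.carrier × Q.carrier => e x.1 - b' x.2).bddAbove
    refine ⟨K + 1, fun p q => ?_⟩
    have := hK ⟨(p, q), rfl⟩
    dsimp only at this
    linarith
  classical
  refine ⟨Sum.elim b fun q => b' q.1 + K,
    Sum.elim (fun p => if h : p ∈ P.T then e' (f.equiv ⟨p, h⟩).1 + K else e p)
      fun q => e' q.1 + K, ?_, ?_⟩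
  · rintro (p | q)
    · by_cases hp : p ∈ P.T
      · simp only [Sum.elim_inl, hp, dite_true]
        linarith [hbe p, hK p (f.equiv ⟨p, hp⟩).1, hbe' (f.equiv ⟨p, hp⟩).1]
      · simp only [Sum.elim_inl, hp, dite_false]
        exact hbe p
    · simp only [Sum.elim_inr]
      linarith [hbe' q.1]
  · intro x y
    refine (glueLt_iff f x y).trans ?_
    rcases x with p | q <;> rcases y with p' | q'
    · simp only [GlueLt', Sum.elim_inl]
      by_cases hp : p ∈ P.T
      · simp only [hp, dite_true]
        refine iff_of_false (P.T_max p hp p') ?_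
        linarith [hbe p', hK p' (f.equiv ⟨p, hp⟩).1, hbe' (f.equiv ⟨p, hp⟩).1]
      · simp only [hp, dite_false]
        exact hlt p p'
    · simp only [GlueLt', Sum.elim_inl, Sum.elim_inr]
      by_cases hp : p ∈ P.T
      · simp only [hp, dite_true, not_true, false_or, add_lt_add_iff_right, ← hlt']
        constructor
        · rintro ⟨t, rfl, h⟩
          exact h
        · exact fun h => ⟨_, rfl, h⟩
      · simp only [hp, dite_false, not_false_eq_true, true_or, true_iff]
        exact hK p q'.1
    · simp only [GlueLt', Sum.elim_inl, Sum.elim_inr, false_iff]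
      linarith [hbe p', hK p' q.1, hbe' q.1]
    · simp only [GlueLt', Sum.elim_inr, add_lt_add_iff_right]
      exact hlt' _ _

/-- The map `g` presents `Q` as the part of `R` that lies between two stages of an execution, where
`F` and `F'` are the sets of events of `R` not terminated at these stages. The order of `R` refines
that of `Q`; if `st` holds, then it agrees with that of `Q`. -/
structure Embeds (R : Iposet Alph) (st : Prop) (Q : Iposet Alph) (g : Q.carrier → R.carrier)
    (F F' : Set R.carrier) : Prop where
  inj : Function.Injective g
  lab : ∀ q, R.lab (g q) = Q.lab q
  mem : ∀ q, g q ∈ F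
  sub : F' ⊆ F
  cover : ∀ x ∈ F, x ∈ F' ∨ x ∈ Set.range g
  mem_iff : ∀ q, g q ∈ F' ↔ q ∈ Q.T
  cross : ∀ q ∉ Q.T, ∀ y ∈ F', y ∉ Set.range g → R.lt (g q) y
  lt : ∀ a b, Q.lt a b → R.lt (g a) (g b)
  ev : ∀ a b, R.ev (g a) (g b) → ¬ R.lt (g a) (g b) → ¬ R.lt (g b) (g a) → Q.ev a b
  lt_of_strict : st → ∀ a b, R.lt (g a) (g b) → Q.lt a b

/-- The only precedences of `P * Q` not inherited from a factor lead from `P ∖ T_P` to `Q ∖ S_Q`.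
They hold in `R` by `cross`: an event terminated during the first part precedes everything that
remains and does not take part in it. -/
theorem Embeds.glue {R : Iposet Alph} {st : Prop} {g : P.carrier → R.carrier}
    {h : Q.carrier → R.carrier} {F F' F'' : Set R.carrier} (hP : R.Embeds st P g F F')
    (hQ : R.Embeds st Q h F' F'') (hf : ∀ t, g t.1 = h (f.equiv t).1) :
    R.Embeds st (Iposet.glue f) (glueElim f g h) F F'' := by
  have hr := glueElim_glueInr f hf
  -- The two images overlap only in the interface: the events of the second part lie in `F'`, and an
  -- event of `P` is there only if it belongs to `T_P`.
  have hov : ∀ p q, g p = h q → ∃ hp : p ∈ P.T, (f.equiv ⟨p, hp⟩).1 = q := fun p q hpq => by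
    have hp : p ∈ P.T := (hP.mem_iff p).1 (hpq ▸ hQ.mem q)
    exact ⟨hp, hQ.inj ((hf ⟨p, hp⟩).symm.trans hpq)⟩
  have hno : ∀ q ∉ Q.S, h q ∉ Set.range g := by
    rintro q hq ⟨p, hp⟩
    obtain ⟨hpT, rfl⟩ := hov p q hp
    exact hq (f.equiv ⟨p, hpT⟩).2
  have hcr : ∀ p ∉ P.T, ∀ q ∉ Q.S, R.lt (g p) (h q) := fun p hp q hq =>
    hP.cross p hp _ (hQ.mem q) (hno q hq)
  have hrange : ∀ y, y ∉ Set.range (glueElim f g h) → y ∉ Set.range g ∧ y ∉ Set.range h := by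
    intro y hy
    exact ⟨fun ⟨p, hp⟩ => hy ⟨Sum.inl p, hp⟩, fun ⟨q, hq⟩ => hy ⟨glueInr f q, (hr q).trans hq⟩⟩
  have hTl : ∀ p, (Sum.inl p ∈ (Iposet.glue f).T) ↔
      ∃ hp : p ∈ P.T, (f.equiv ⟨p, hp⟩).1 ∈ Q.T := by
    intro p
    constructor
    · rintro ⟨q, hq, h⟩
      obtain ⟨t, rfl, rfl⟩ := glueInr_eq_inl f h
      exact ⟨t.2, hq⟩
    · rintro ⟨hp, hq⟩
      exact ⟨_, hq, glueInr_equiv f ⟨p, hp⟩⟩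
  have hTr : ∀ q : {q // q ∉ Q.S}, (Sum.inr q ∈ (Iposet.glue f).T) ↔ q.1 ∈ Q.T := by
    intro q
    constructor
    · rintro ⟨q', hq, h⟩
      exact glueInr_eq_inr f h ▸ hq
    · intro hq
      exact ⟨_, hq, glueInr_not_mem f q.2⟩
  refine ⟨?_, ?_, ?_, hQ.sub.trans hP.sub, ?_, ?_, ?_, ?_, ?_, ?_⟩
  · rintro (p | q) (p' | q') hpq
    · exact congrArg _ (hP.inj hpq)
    · exact absurd ⟨p, hpq⟩ (hno q'.1 q'.2)
    · exact absurd ⟨p', hpq.symm⟩ (hno q.1 q.2)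
    · exact congrArg _ (Subtype.ext (hQ.inj hpq))
  · rintro (p | q)
    · exact hP.lab p
    · exact hQ.lab q.1
  · rintro (p | q)
    · exact hP.mem p
    · exact hP.sub (hQ.mem q.1)
  · intro x hx
    rcases hP.cover x hx with hx | ⟨p, hp⟩
    · rcases hQ.cover x hx with hx | ⟨q, hq⟩
      · exact Or.inl hx
      · exact Or.inr ⟨glueInr f q, (hr q).trans hq⟩
    · exact Or.inr ⟨Sum.inl p, hp⟩
  · rintro (p | q)
    · refine Iff.trans ?_ (hTl p).symm
      constructor
      · intro hm
        have hp := (hP.mem_iff p).1 (hQ.sub hm)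
        exact ⟨hp, (hQ.mem_iff _).1 (hf ⟨p, hp⟩ ▸ hm)⟩
      · rintro ⟨hp, hq⟩
        have := (hQ.mem_iff _).2 hq
        rwa [← hf ⟨p, hp⟩] at this
    · exact (hQ.mem_iff q.1).trans (hTr q).symm
  · rintro (p | q) hnT y hy hyr
    · obtain ⟨h1, h2⟩ := hrange y hyr
      by_cases hp : p ∈ P.T
      · have := hQ.cross (f.equiv ⟨p, hp⟩).1 (fun hq => hnT ((hTl p).2 ⟨hp, hq⟩)) y hy h2
        rwa [← hf ⟨p, hp⟩] at this
      · exact hP.cross p hp y (hQ.sub hy) h1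
    · exact hQ.cross q.1 (fun hq => hnT ((hTr q).2 hq)) y hy (hrange y hyr).2
  · rintro a b (hl | hl | ⟨hp, hq⟩)
    · exact hP.lt _ _ hl
    · rw [hr, hr]; exact hQ.lt _ _ hl
    · rw [hr]; exact hcr _ hp _ hq
  · have key : ∀ q q', R.ev (h q) (h q') → ¬ R.lt (h q) (h q') → ¬ R.lt (h q') (h q) →
        (Iposet.glue f).ev (glueInr f q) (glueInr f q') := fun q q' h1 h2 h3 =>
      .single (.right (hQ.ev q q' h1 h2 h3))
    rintro (p | q) (p' | q') h1 h2 h3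
    · exact .single (.left (hP.ev p p' h1 h2 h3))
    · by_cases hp : p ∈ P.T
      · have := key (f.equiv ⟨p, hp⟩).1 q'.1
        rw [← hf ⟨p, hp⟩, glueInr_equiv, glueInr_not_mem f q'.2] at this
        exact this h1 h2 h3
      · exact absurd (hcr p hp q'.1 q'.2) h2
    · by_cases hp : p' ∈ P.T
      · have := key q.1 (f.equiv ⟨p', hp⟩).1
        rw [← hf ⟨p', hp⟩, glueInr_equiv, glueInr_not_mem f q.2] at this
        exact this h1 h2 h3
      · exact absurd (hcr p' hp q.1 q.2) h3
    · have := key q.1 q'.1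
      rw [glueInr_not_mem f q.2, glueInr_not_mem f q'.2] at this
      exact this h1 h2 h3
  · intro hst
    have key : ∀ q q', R.lt (h q) (h q') →
        (Iposet.glue f).lt (glueInr f q) (glueInr f q') := fun q q' h1 =>
      .right (hQ.lt_of_strict hst q q' h1)
    rintro (p | q) (p' | q') h1
    · exact .left (hP.lt_of_strict hst p p' h1)
    · by_cases hp : p ∈ P.T
      · have := key (f.equiv ⟨p, hp⟩).1 q'.1
        rw [← hf ⟨p, hp⟩, glueInr_equiv, glueInr_not_mem f q'.2] at this
        exact this h1
      · have := GlueLt.cross (f := f) hp q'.2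
        rwa [glueInr_not_mem f q'.2] at this
    · by_cases hp : p' ∈ P.T
      · have := key q.1 (f.equiv ⟨p', hp⟩).1
        rw [← hf ⟨p', hp⟩, glueInr_equiv, glueInr_not_mem f q.2] at this
        exact this h1
      · exact absurd (R.lt_trans h1 (hcr p' hp q.1 q.2)) (R.lt_irrefl _)
    · have := key q.1 q'.1
      rw [glueInr_not_mem f q.2, glueInr_not_mem f q'.2] at this
      exact this h1

/-- When the part is the whole execution, `g` is a bijection, and its inverse is the subsumption.
With `st` precedence also agrees, so that it is an isomorphism. -/
theorem Embeds.subsumed {R : Iposet Alph} {st : Prop} {g : Q.carrier → R.carrier}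
    (h : R.Embeds st Q g Set.univ R.T) (hS : g '' Q.S = R.S) (hT : R.T ⊆ Set.range g) :
    ∃ k, IsSubsumption R Q k ∧ (st → ∀ x y, R.lt x y → Q.lt (k x) (k y)) := by
  have hb : Function.Bijective g := ⟨h.inj, fun x => by
    rcases h.cover x trivial with hx | hx
    · exact hT hx
    · exact hx⟩
  obtain ⟨k, rfl⟩ : ∃ k : Q.carrier ≃ R.carrier, g = k := ⟨Equiv.ofBijective g hb, rfl⟩
  refine ⟨k.symm, ⟨fun x => ?_, ?_, ?_, fun x y hl => ?_, fun x y h1 h2 h3 => ?_⟩,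
    fun hst x y hl => ?_⟩
  · rw [← h.lab, k.apply_symm_apply]
  · rw [← hS]; simp [Set.image_image]
  · ext q
    rw [← h.mem_iff]
    constructor
    · rintro ⟨x, hx, rfl⟩
      rwa [k.apply_symm_apply]
    · intro hq
      exact ⟨_, hq, k.symm_apply_apply q⟩
  · simpa using h.lt _ _ hl
  · apply h.ev <;> simpa
  · apply h.lt_of_strict hst; simpa

theorem ofILoSet_interval (V : ILoSet Alph) : (ofILoSet V).IsInterval :=
  ⟨fun _ => 0, fun _ => 0, fun _ => le_rfl, fun _ _ => by simp [ofILoSet]⟩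

end Iposet

/-- A lo-isomorphism from a lo-set to the target interface of an iposet. -/
structure TgtIso (U : LoSet Alph) (P : Iposet Alph) where
  equiv : Fin U.len ≃ {p // p ∈ P.T}
  ev_iff : ∀ i j, i < j ↔ P.ev (equiv i).1 (equiv j).1
  lab : ∀ i, P.lab (equiv i).1 = U.lab i

/-- The matching of interfaces that are isomorphic to the same lo-set. -/
def matchingOfIso {U : LoSet Alph} {P Q : Iposet Alph} (t : TgtIso U P) (s : SrcIso U Q) :
    Iposet.Matching P Q where
  equiv := t.equiv.symm.trans s.equiv
  ev_iff a b := by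
    have h1 := t.ev_iff (t.equiv.symm a) (t.equiv.symm b)
    have h2 := s.ev_iff (t.equiv.symm a) (t.equiv.symm b)
    simp only [Equiv.apply_symm_apply] at h1
    exact h1.symm.trans h2
  lab a := by
    have h1 := t.lab (t.equiv.symm a)
    rw [Equiv.apply_symm_apply] at h1
    exact (s.lab _).trans h1.symm

/-- The target interface of `P * Q` is that of `Q`. -/
noncomputable def glueTgt {U : LoSet Alph} {P Q : Iposet Alph} (t : TgtIso U Q)
    (f : Iposet.Matching P Q) : TgtIso U (Iposet.glue f) where
  equiv := t.equiv.trans (Equiv.Set.image _ Q.T (Iposet.glueInr_injective f))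
  ev_iff i j := by
    refine (t.ev_iff i j).trans (Iposet.glue_ev_glueInr_iff f _ _ ?_).symm
    rcases lt_trichotomy i j with h | rfl | h
    · exact Or.inr (Or.inl ((t.ev_iff _ _).1 h))
    · exact Or.inl rfl
    · exact Or.inr (Or.inr ((t.ev_iff _ _).1 h))
  lab i := (Iposet.glue_lab_glueInr f _).trans (t.lab i)

/-! ### Tracking a path -/

namespace Iposet

/-- A stage of the execution of `R`: `F` is the set of events that are not terminated, and `s`
enumerates the active ones. -/
structure IsStage (R : Iposet Alph) (st : Prop) (U : LoSet Alph) (F : Set R.carrier)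
    (s : Fin U.len → R.carrier) : Prop where
  inj : Function.Injective s
  mem : ∀ i, s i ∈ F
  lab : ∀ i, R.lab (s i) = U.lab i
  ev : ∀ i j, R.ev (s i) (s j) → ¬ R.lt (s i) (s j) → ¬ R.lt (s j) (s i) → i < j
  anti : st → ∀ i j, ¬ R.lt (s i) (s j)

theorem IsStage.comp {R : Iposet Alph} {st : Prop} {U V : LoSet Alph} {F F' : Set R.carrier}
    {s : Fin V.len → R.carrier} (h : R.IsStage st V F s) (d : U ⟶ V)
    (hF : ∀ i, s (d.emb i) ∈ F') : R.IsStage st U F' (s ∘ d.emb) where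
  inj := h.inj.comp d.emb.injective
  mem := hF
  lab i := (h.lab _).trans (d.lab_emb i)
  ev _ _ h1 h2 h3 := d.emb.lt_iff_lt.1 (h.ev _ _ h1 h2 h3)
  anti hst _ _ := h.anti hst _ _

/-- A single step embeds through the enumeration of the active events; the events outside `T` are
those it terminates. -/
theorem IsStage.embeds {R : Iposet Alph} {st : Prop} {U : LoSet Alph} {S T : Set (Fin U.len)}
    {F F' : Set R.carrier} {s : Fin U.len → R.carrier} (h : R.IsStage st U F s)
    (hF : F' = F \ s '' Tᶜ) (hc : ∀ i ∉ T, ∀ y ∈ F, y ∉ Set.range s → R.lt (s i) y) :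
    R.Embeds st (ofILoSet ⟨U, S, T⟩) s F F' where
  inj := h.inj
  lab := h.lab
  mem := h.mem
  sub := hF ▸ Set.sdiff_subset
  cover x hx := by
    by_cases hs : x ∈ Set.range s
    · exact Or.inr hs
    · refine Or.inl (hF ▸ ⟨hx, fun h' => hs (Set.image_subset_range _ _ h')⟩)
  mem_iff q := by
    subst hF
    constructor
    · intro hq
      by_contra hT
      exact hq.2 ⟨q, hT, rfl⟩
    · intro hq
      refine ⟨h.mem q, ?_⟩
      rintro ⟨q', hq', he⟩
      exact hq' (h.inj he ▸ hq)
  cross q hq y hy hyr := hc q hq y (hF ▸ hy : y ∈ F \ s '' Tᶜ).1 hyr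
  lt _ _ h := h.elim
  ev i j h1 h2 h3 := h.ev i j h1 h2 h3
  lt_of_strict hst i j h' := h.anti hst i j h'

end Iposet

section Tracks

variable {C : Type u} [SmallCategory C] (G : C ⥤ LoSet Alph) {X : Cᵒᵖ ⥤ Type u}

/-- The target interface of the ipomset of a path. -/
noncomputable def evTgt : {x y : Cells X} → (p : Path G X x y) →
    TgtIso (G.obj y.1) (evAux G p).1
  | _, _, .nil _ => ⟨(Equiv.Set.univ _).symm, fun _ _ => Iff.rfl, fun _ => rfl⟩
  | _, _, .up _ _ _ p => glueTgt (evTgt p) _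
  | _, _, .down _ _ _ p => glueTgt (evTgt p) _

theorem evAux_interval {x y : Cells X} (p : Path G X x y) : (evAux G p).1.IsInterval := by
  induction p with
  | nil => exact Iposet.ofILoSet_interval _
  | up d hd hx p ih => exact Iposet.glue_interval _ (Iposet.ofILoSet_interval _) ih
  | down d hd hx p ih => exact Iposet.glue_interval _ (Iposet.ofILoSet_interval _) ih

/-- The path is an execution of the events of `R` in `F ∖ F'` together with those active at its
end, starting at the stage `(F, s)` and ending at the stage `(F', s')`. -/
def Tracks (R : Iposet Alph) (st : Prop) : {x y : Cells X} → Path G X x y → (F : Set R.carrier) →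
    (Fin (G.obj x.1).len → R.carrier) → (F' : Set R.carrier) →
    (Fin (G.obj y.1).len → R.carrier) → Prop
  | _, _, .nil x, F, s, F', s' => R.IsStage st (G.obj x.1) F s ∧ F = F' ∧ s = s'
  | x, _, .up d _ _ p, F, s, F', s' => R.IsStage st (G.obj x.1) F s ∧
      ∃ s₁, s = s₁ ∘ (G.map d).emb ∧ Tracks R st p F s₁ F' s'
  | x, _, .down d _ _ p, F, s, F', s' => R.IsStage st (G.obj x.1) F s ∧
      (∀ i ∉ Set.range (G.map d).emb, ∀ y ∈ F, y ∉ Set.range s → R.lt (s i) y) ∧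
      Tracks R st p (F \ s '' (Set.range (G.map d).emb)ᶜ) (s ∘ (G.map d).emb) F' s'

variable {G} {R : Iposet Alph} {st : Prop}

theorem Tracks.stage {x y : Cells X} {p : Path G X x y} {F F' : Set R.carrier}
    {s : Fin (G.obj x.1).len → R.carrier} {s' : Fin (G.obj y.1).len → R.carrier}
    (h : Tracks G R st p F s F' s') : R.IsStage st (G.obj x.1) F s := by
  cases p <;> exact h.1

/-- Each step is embedded by `IsStage.embeds`, and consecutive embeddings agree on the shared
interface, so `Embeds.glue` assembles them along the path. -/
theorem Tracks.embeds {x y : Cells X} {p : Path G X x y} {F F' : Set R.carrier}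
    {s : Fin (G.obj x.1).len → R.carrier} {s' : Fin (G.obj y.1).len → R.carrier}
    (h : Tracks G R st p F s F' s') :
    ∃ g, R.Embeds st (evAux G p).1 g F F' ∧ (∀ i, g ((evAux G p).2.equiv i).1 = s i) ∧
      ∀ i, g ((evTgt G p).equiv i).1 = s' i := by
  induction p generalizing F with
  | nil x =>
    obtain ⟨h, rfl, rfl⟩ := h
    exact ⟨s, h.embeds (by simp) (by simp), fun _ => rfl, fun _ => rfl⟩
  | up d hd hx p ih =>
    obtain ⟨h, s₁, rfl, hp⟩ := h
    obtain ⟨g, hg, hs, ht⟩ := ih hp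
    have hm : ∀ t : {t // t ∈ (upIposet (G.map d)).T},
        s₁ t.1 = g ((upMatching (G.map d) (evAux G p).2).equiv t).1 := fun t => (hs t.1).symm
    refine ⟨Iposet.glueElim _ s₁ g,
      (Iposet.IsStage.embeds hp.stage (by simp) (by simp)).glue _ hg hm, fun _ => rfl,
      fun i => (Iposet.glueElim_glueInr _ hm _).trans (ht i)⟩
  | down d hd hx p ih =>
    obtain ⟨h, hc, hp⟩ := h
    obtain ⟨g, hg, hs, ht⟩ := ih hp
    have hm : ∀ t : {t // t ∈ (downIposet (G.map d)).T},
        s t.1 = g ((downMatching (G.map d) (evAux G p).2).equiv t).1 := fun t => by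
      refine Eq.trans ?_ (hs ((G.map d).emb.orderIso.symm t)).symm
      exact congrArg s (congrArg Subtype.val
        ((G.map d).emb.orderIso.apply_symm_apply t)).symm
    exact ⟨Iposet.glueElim _ s g, (h.embeds rfl hc).glue _ hg hm, fun _ => rfl,
      fun i => (Iposet.glueElim_glueInr _ hm _).trans (ht i)⟩

end Tracks

/-! ### Tracking inside larger iposets, and the canonical tracking of a path -/

namespace Iposet

/-- Injections of iposets that preserve labels and precedence and reflect the event order of
concurrent events. -/
structure IsFull {R R' : Iposet Alph} (h : R.carrier → R'.carrier) : Prop where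
  inj : Function.Injective h
  lab : ∀ a, R'.lab (h a) = R.lab a
  lt : ∀ a b, R.lt a b → R'.lt (h a) (h b)
  ev : ∀ a b, R'.ev (h a) (h b) → ¬ R'.lt (h a) (h b) → ¬ R'.lt (h b) (h a) → R.ev a b

theorem isFull_glueInr {P Q : Iposet Alph} (f : Matching P Q) :
    IsFull (R := Q) (R' := glue f) (glueInr f) where
  inj := glueInr_injective f
  lab := glue_lab_glueInr f
  lt _ _ h := .right h
  ev a b h1 h2 h3 := by
    refine (glue_ev_glueInr_iff f a b ?_).1 h1
    rcases Q.total a b with h | h | h | h | h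
    · exact Or.inl h
    · exact absurd (.right h) h2
    · exact absurd (.right h) h3
    · exact Or.inr (Or.inl h)
    · exact Or.inr (Or.inr h)

theorem isFull_inl {P Q : Iposet Alph} (f : Matching P Q) :
    IsFull (R := P) (R' := glue f) Sum.inl where
  inj := Sum.inl_injective
  lab _ := rfl
  lt _ _ h := .left h
  ev _ _ h1 _ _ := glueEv'_of_transGen f h1

end Iposet

section Tracks

variable {C : Type u} [SmallCategory C] {G : C ⥤ LoSet Alph} {X : Cᵒᵖ ⥤ Type u}

/-- All conditions of non-strict tracking are positive statements about precedence and labels, or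
statements about the event order of concurrent events; these are what `IsFull` carries over. The
strict condition `anti` would need precedence to be reflected as well. -/
theorem Tracks.transport {R R' : Iposet Alph} {h : R.carrier → R'.carrier}
    (hh : Iposet.IsFull h)
    {x y : Cells X} {p : Path G X x y} {F F' : Set R.carrier}
    {s : Fin (G.obj x.1).len → R.carrier} {s' : Fin (G.obj y.1).len → R.carrier}
    (ht : Tracks G R False p F s F' s') :
    Tracks G R' False p (h '' F) (h ∘ s) (h '' F') (h ∘ s') := by
  have hst : ∀ {U : LoSet Alph} {F : Set R.carrier} {s : Fin U.len → R.carrier},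
      R.IsStage False U F s → R'.IsStage False U (h '' F) (h ∘ s) := fun hs =>
    { inj := hh.inj.comp hs.inj
      mem := fun i => ⟨_, hs.mem i, rfl⟩
      lab := fun i => (hh.lab _).trans (hs.lab i)
      ev := fun i j h1 h2 h3 => hs.ev i j (hh.ev _ _ h1 h2 h3) (fun h => h2 (hh.lt _ _ h))
        fun h => h3 (hh.lt _ _ h)
      anti := fun h => h.elim }
  induction p generalizing F with
  | nil x =>
    obtain ⟨h, rfl, rfl⟩ := ht
    exact ⟨hst h, rfl, rfl⟩
  | up d hd hx p ih =>
    obtain ⟨h, s₁, rfl, hp⟩ := ht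
    exact ⟨hst h, _, rfl, ih hp⟩
  | down d hd hx p ih =>
    obtain ⟨h', hc, hp⟩ := ht
    refine ⟨hst h', ?_, ?_⟩
    · rintro i hi _ ⟨y, hy, rfl⟩ hys
      exact hh.lt _ _ (hc i hi y hy fun ⟨j, hj⟩ => hys ⟨j, congrArg h hj⟩)
    · have := ih hp
      rwa [Set.image_sdiff hh.inj, ← Set.image_comp] at this

theorem SrcIso.isStage {U : LoSet Alph} {P : Iposet Alph} (s : SrcIso U P) :
    P.IsStage False U Set.univ fun i => (s.equiv i).1 where
  inj _ _ h := s.equiv.injective (Subtype.ext h)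
  mem _ := trivial
  lab := s.lab
  ev i j h _ _ := (s.ev_iff i j).2 h
  anti h := h.elim

/-- A path is tracked by its ipomset. -/
theorem tracks_evAux {x y : Cells X} (p : Path G X x y) :
    Tracks G (evAux G p).1 False p Set.univ (fun i => ((evAux G p).2.equiv i).1)
      (evAux G p).1.T (fun i => ((evTgt G p).equiv i).1) := by
  -- The inductive step: a path tracked by `Q` is tracked by `P * Q` from the stage whose
  -- unterminated events are exactly the image of `Q`.
  have key : ∀ {P Q : Iposet Alph} (f : Iposet.Matching P Q) {x y : Cells X} {p : Path G X x y}
      {s : Fin (G.obj x.1).len → Q.carrier} {s' : Fin (G.obj y.1).len → Q.carrier},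
      Tracks G Q False p Set.univ s Q.T s' → ∀ (F : Set (Iposet.glue f).carrier)
        (r : Fin (G.obj x.1).len → (Iposet.glue f).carrier),
        (∀ w, w ∈ F ↔ ∃ q, Iposet.glueInr f q = w) → (∀ i, Iposet.glueInr f (s i) = r i) →
        Tracks G (Iposet.glue f) False p F r (Iposet.glue f).T (Iposet.glueInr f ∘ s') := by
    intro P Q f x y p s s' h F r hF hr
    let k : Q.carrier → (Iposet.glue f).carrier := Iposet.glueInr f
    obtain rfl : F = k '' Set.univ := by
      ext w; exact (hF w).trans ⟨fun ⟨q, h⟩ => ⟨q, trivial, h⟩, fun ⟨q, _, h⟩ => ⟨q, h⟩⟩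
    obtain rfl : r = k ∘ s := funext fun i => (hr i).symm
    exact h.transport (Iposet.isFull_glueInr f)
  induction p with
  | nil x => exact ⟨(univSrc _ _).isStage, rfl, rfl⟩
  | @up x y z d hd hx p ih =>
    refine ⟨SrcIso.isStage _, fun j => Sum.inl j, rfl, ?_⟩
    have hs : ∀ j, Iposet.glueInr (upMatching (G.map d) (evAux G p).2)
        ((evAux G p).2.equiv j).1 = Sum.inl j := fun j =>
      Iposet.glueInr_equiv (upMatching (G.map d) (evAux G p).2) ⟨j, trivial⟩
    refine key (upMatching (G.map d) (evAux G p).2) ih _ _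
      (fun w => ⟨fun _ => ?_, fun _ => trivial⟩) hs
    rcases w with j | q
    · exact ⟨_, hs j⟩
    · exact ⟨q.1, Iposet.glueInr_not_mem _ q.2⟩
  | @down x y z d hd hx p ih =>
    refine ⟨SrcIso.isStage _, ?_, ?_⟩
    · rintro i hi (j | q) - hq
      · exact absurd ⟨j, rfl⟩ hq
      · have := Iposet.GlueLt.cross (f := downMatching (G.map d) (evAux G p).2) (p := i) hi q.2
        rwa [Iposet.glueInr_not_mem _ q.2] at this
    · have hs : ∀ j, Iposet.glueInr (downMatching (G.map d) (evAux G p).2)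
          ((evAux G p).2.equiv j).1 = Sum.inl ((G.map d).emb j) := fun j => by
        refine Eq.trans ?_ (Iposet.glueInr_equiv (downMatching (G.map d) (evAux G p).2)
          ⟨(G.map d).emb j, ⟨j, rfl⟩⟩)
        refine congrArg (fun k => Iposet.glueInr _ ((evAux G p).2.equiv k).1) ?_
        exact ((G.map d).emb.orderIso.symm_apply_apply j).symm
      -- After the down-step, the unterminated events of the gluing are exactly those of the
      -- remaining path.
      refine key (downMatching (G.map d) (evAux G p).2) ih _ _ (fun w => ⟨?_, ?_⟩) hs
      · rintro ⟨-, hw⟩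
        rcases w with j | q
        · have : j ∈ Set.range (G.map d).emb := by
            by_contra hj
            exact hw ⟨j, hj, rfl⟩
          obtain ⟨k, rfl⟩ := this
          exact ⟨_, hs k⟩
        · exact ⟨q.1, Iposet.glueInr_not_mem _ q.2⟩
      · rintro ⟨q, rfl⟩
        refine ⟨trivial, ?_⟩
        rintro ⟨j, hj, hq⟩
        obtain ⟨t, rfl, -⟩ := Iposet.glueInr_eq_inl _ hq.symm
        exact hj t.2

/-- Concatenation of paths. -/
def Path.comp : {x y z : Cells X} → Path G X x y → Path G X y z → Path G X x z
  | _, _, _, .nil _, q => q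
  | _, _, _, .up d hd hx p, q => .up d hd hx (p.comp q)
  | _, _, _, .down d hd hy p, q => .down d hd hy (p.comp q)

theorem Tracks.comp {R : Iposet Alph} {st : Prop} {x y z : Cells X} {p : Path G X x y}
    {q : Path G X y z} {F F' F'' : Set R.carrier} {s : Fin (G.obj x.1).len → R.carrier}
    {s' : Fin (G.obj y.1).len → R.carrier} {s'' : Fin (G.obj z.1).len → R.carrier}
    (hp : Tracks G R st p F s F' s') (hq : Tracks G R st q F' s' F'' s'') :
    Tracks G R st (p.comp q) F s F'' s'' := by
  induction p generalizing F with
  | nil x =>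
    obtain ⟨-, rfl, rfl⟩ := hp
    exact hq
  | up d hd hx p ih =>
    obtain ⟨h, s₁, hs, hp⟩ := hp
    exact ⟨h, s₁, hs, ih hp hq⟩
  | down d hd hx p ih =>
    obtain ⟨h, hc, hp⟩ := hp
    exact ⟨h, hc, ih hp hq⟩

/-! ### Maps to precubical sets and their action on paths -/

variable (G X) in
/-- Maps from a presheaf `X` over `C` to a precubical set. -/
structure CellMap (Z : (LoSet Alph)ᵒᵖ ⥤ Type u) where
  app : ∀ U : C, X.obj (op U) → Z.obj (op (G.obj U))
  naturality : ∀ {U V : C} (d : U ⟶ V) (x : X.obj (op V)),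
    app U (X.map d.op x) = Z.map (G.map d).op (app V x)

variable {Z : (LoSet Alph)ᵒᵖ ⥤ Type u} (h : CellMap G X Z)

/-- The action of a map on cells. -/
def CellMap.cell (x : Cells X) : Cells Z := ⟨G.obj x.1, h.app x.1 x.2⟩

/-- The action of a map on paths. -/
def CellMap.path (h : CellMap G X Z) : {x y : Cells X} → Path G X x y →
    Path (𝟭 (LoSet Alph)) Z (h.cell x) (h.cell y)
  | _, _, .nil x => .nil (h.cell x)
  | _, _, .up (x := x) (y := y) d hd hx p =>
      .up (x := h.cell x) (y := h.cell y) (G.map d) hd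
        ((congrArg (h.app x.1) hx).trans (h.naturality d y.2)) (CellMap.path h p)
  | _, _, .down (x := x) (y := y) d hd hy p =>
      .down (x := h.cell x) (y := h.cell y) (G.map d) hd
        ((congrArg (h.app y.1) hy).trans (h.naturality d x.2)) (CellMap.path h p)

theorem CellMap.evAux_path {x y : Cells X} (p : Path G X x y) :
    evAux (𝟭 (LoSet Alph)) (h.path p) = evAux G p := by
  induction p with
  | nil x => rfl
  | up d hd hx p ih =>
    change (⟨Iposet.glue (upMatching (G.map d) (evAux _ (h.path p)).2), glueSrc (upSrc (G.map d)) _⟩ :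
      Σ P : Iposet Alph, SrcIso _ P) = _
    rw [ih]
    rfl
  | down d hd hx p ih =>
    change (⟨Iposet.glue (downMatching (G.map d) (evAux _ (h.path p)).2),
      glueSrc (univSrc _ _) _⟩ : Σ P : Iposet Alph, SrcIso _ P) = _
    rw [ih]
    rfl

theorem CellMap.pathEv_path {x y : Cells X} (p : Path G X x y) :
    pathEv (𝟭 (LoSet Alph)) (h.path p) = pathEv G p :=
  congrArg (fun e => (Quotient.mk _ (Sigma.fst e) : Ipomset Alph)) (h.evAux_path p)

theorem CellMap.tracks_path {R : Iposet Alph} {st : Prop} {x y : Cells X} (p : Path G X x y)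
    {F F' : Set R.carrier} {s : Fin (G.obj x.1).len → R.carrier}
    {s' : Fin (G.obj y.1).len → R.carrier} :
    Tracks (𝟭 (LoSet Alph)) R st (h.path p) F s F' s' ↔ Tracks G R st p F s F' s' := by
  induction p generalizing F with
  | nil x => rfl
  | up d hd hx p ih => exact and_congr Iff.rfl (exists_congr fun s₁ => and_congr Iff.rfl ih)
  | down d hd hx p ih => exact and_congr Iff.rfl (and_congr Iff.rfl ih)

end Tracks

/-! ### Track objects -/

namespace Iposet

/-- A cell with events `U` of the track object of `R`: the events of `R` are split into unstarted
ones (`A`), active ones (enumerated by `emb`) and terminated ones (`B`). -/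
@[ext]
structure Cut (R : Iposet Alph) (U : LoSet Alph) where
  emb : Fin U.len → R.carrier
  A : Set R.carrier
  B : Set R.carrier
  inj : Function.Injective emb
  lab : ∀ i, R.lab (emb i) = U.lab i
  ev : ∀ i j, i < j → R.ev (emb i) (emb j)
  disj : Disjoint A B
  union : A ∪ B = (Set.range emb)ᶜ
  cut : ∀ x y, R.lt x y → x ∈ B ∨ y ∈ A

namespace Cut

variable {R : Iposet Alph} {U V : LoSet Alph}

theorem emb_not_mem (c : Cut R U) (i : Fin U.len) : c.emb i ∉ c.A ∧ c.emb i ∉ c.B := by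
  have : c.emb i ∉ c.A ∪ c.B := by rw [c.union]; exact fun h => h ⟨i, rfl⟩
  exact ⟨fun h => this (Or.inl h), fun h => this (Or.inr h)⟩

theorem mem_range (c : Cut R U) {x : R.carrier} (hA : x ∉ c.A) (hB : x ∉ c.B) :
    x ∈ Set.range c.emb := by
  by_contra h
  have : x ∈ c.A ∪ c.B := by rw [c.union]; exact h
  exact this.elim hA hB

theorem not_lt (c : Cut R U) (i j : Fin U.len) : ¬ R.lt (c.emb i) (c.emb j) := fun h =>
  (c.cut _ _ h).elim (c.emb_not_mem i).2 (c.emb_not_mem j).1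

theorem lt_of_ev (c : Cut R U) {i j : Fin U.len} (h : R.ev (c.emb i) (c.emb j)) : i < j := by
  rcases lt_trichotomy i j with h' | rfl | h'
  · exact h'
  · exact absurd h (R.ev_irrefl _)
  · exact absurd (R.ev_trans h (c.ev _ _ h')) (R.ev_irrefl _)

theorem isStage (c : Cut R U) (st : Prop) : R.IsStage st U c.Bᶜ c.emb where
  inj := c.inj
  mem i := (c.emb_not_mem i).2
  lab := c.lab
  ev _ _ h _ _ := c.lt_of_ev h
  anti _ := c.not_lt

/-- The faces of a cell of a track object. -/
def face (c : Cut R V) (d : U ⟶ V) : Cut R U where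
  emb := c.emb ∘ d.emb
  A := c.emb '' d.A ∪ c.A
  B := c.emb '' d.B ∪ c.B
  inj := c.inj.comp d.emb.injective
  lab i := (c.lab _).trans (d.lab_emb i)
  ev i j h := c.ev _ _ (d.emb.lt_iff_lt.2 h)
  disj := by
    have h1 := fun i => c.emb_not_mem i
    have h2 := Set.disjoint_left.1 c.disj
    have h3 := Set.disjoint_left.1 d.disj
    rw [Set.disjoint_left]
    rintro x (⟨y, hy, rfl⟩ | hx) (⟨z, hz, hzx⟩ | hx')
    · exact h3 hy (c.inj hzx ▸ hz)
    · exact (h1 y).2 hx'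
    · exact (h1 z).1 (hzx ▸ hx)
    · exact h2 hx hx'
  union := by
    have hd : ∀ i, i ∈ d.A ∨ i ∈ d.B ↔ i ∉ Set.range d.emb := fun i => by
      rw [← Set.mem_compl_iff, ← d.union]; rfl
    ext x
    constructor
    · rintro ((⟨y, hy, rfl⟩ | hx) | (⟨y, hy, rfl⟩ | hx)) ⟨i, hi⟩
      · exact (hd y).1 (Or.inl hy) ⟨i, c.inj hi⟩
      · exact (c.emb_not_mem (d.emb i)).1 (by rwa [← hi] at hx)
      · exact (hd y).1 (Or.inr hy) ⟨i, c.inj hi⟩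
      · exact (c.emb_not_mem (d.emb i)).2 (by rwa [← hi] at hx)
    · intro hx
      by_cases hA : x ∈ c.A
      · exact Or.inl (Or.inr hA)
      by_cases hB : x ∈ c.B
      · exact Or.inr (Or.inr hB)
      obtain ⟨i, rfl⟩ := c.mem_range hA hB
      rcases (hd i).2 fun ⟨j, hj⟩ => hx ⟨j, congrArg c.emb hj⟩ with h | h
      · exact Or.inl (Or.inl ⟨i, h, rfl⟩)
      · exact Or.inr (Or.inl ⟨i, h, rfl⟩)
  cut x y h := (c.cut x y h).imp Or.inr Or.inr

/-- The active events of `c'` are active in `c`, and both are listed in event order, so the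
comparison of the two enumerations is a coface map; it is labelled by what `c'` newly leaves
unstarted or terminates. -/
theorem exists_face (c : Cut R V) (c' : Cut R U) (hA : c.A ⊆ c'.A) (hB : c.B ⊆ c'.B) :
    ∃ d : U ⟶ V, c' = c.face d := by
  have h : ∀ i, ∃ j, c.emb j = c'.emb i := fun i =>
    c.mem_range (fun h => (c'.emb_not_mem i).1 (hA h)) fun h => (c'.emb_not_mem i).2 (hB h)
  choose k hk using h
  have hmono : StrictMono k := fun i j hij => c.lt_of_ev (by rw [hk, hk]; exact c'.ev i j hij)
  have hkr : ∀ j, j ∈ Set.range k ↔ c.emb j ∈ Set.range c'.emb := fun j => by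
    constructor
    · rintro ⟨i, rfl⟩
      exact ⟨i, (hk i).symm⟩
    · rintro ⟨i, hi⟩
      exact ⟨i, c.inj ((hk i).trans hi)⟩
  refine ⟨{ emb := OrderEmbedding.ofStrictMono k hmono
            A := c.emb ⁻¹' c'.A
            B := c.emb ⁻¹' c'.B
            lab_emb := fun i => ?_
            disj := c'.disj.preimage _
            union := ?_ }, ?_⟩
  · rw [← c.lab]
    exact (congrArg R.lab (hk i)).trans (c'.lab i)
  · rw [← Set.preimage_union, c'.union]
    ext j
    exact not_congr (hkr j).symm
  · have h1 := Set.disjoint_left.1 c.disj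
    have h2 := Set.disjoint_left.1 c'.disj
    apply Cut.ext
    · exact funext fun i => (hk i).symm
    · ext x
      constructor
      · intro hx
        by_cases hA' : x ∈ c.A
        · exact Or.inr hA'
        · obtain ⟨i, rfl⟩ := c.mem_range hA' fun h => h2 hx (hB h)
          exact Or.inl ⟨i, hx, rfl⟩
      · rintro (⟨i, hi, rfl⟩ | hx)
        · exact hi
        · exact hA hx
    · ext x
      constructor
      · intro hx
        by_cases hB' : x ∈ c.B
        · exact Or.inr hB'
        · obtain ⟨i, rfl⟩ := c.mem_range (fun h => h2 (hA h) hx) hB'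
          exact Or.inl ⟨i, hx, rfl⟩
      · rintro (⟨i, hi, rfl⟩ | hx)
        · exact hi
        · exact hB hx

theorem face_A_eq (c : Cut R V) (d : U ⟶ V) (h : (c.face d).A = c.A) : d.A = ∅ := by
  rw [Set.eq_empty_iff_forall_notMem]
  intro i hi
  exact (c.emb_not_mem i).1 (h ▸ Or.inl ⟨i, hi, rfl⟩)

theorem face_B_eq (c : Cut R V) (d : U ⟶ V) (h : (c.face d).B = c.B) : d.B = ∅ := by
  rw [Set.eq_empty_iff_forall_notMem]
  intro i hi
  exact (c.emb_not_mem i).2 (h ▸ Or.inl ⟨i, hi, rfl⟩)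

/-- Cells of the track object exist for all admissible sets of unstarted and terminated events. -/
theorem exists_of_disjoint (A B : Set R.carrier) (disj : Disjoint A B)
    (cut : ∀ x y, R.lt x y → x ∈ B ∨ y ∈ A) : ∃ U, ∃ c : Cut R U, c.A = A ∧ c.B = B := by
  classical
  have := R.finite
  let I := {x : R.carrier // x ∉ A ∪ B}
  have hlt : ∀ x y : I, ¬ R.lt x.1 y.1 := fun x y h =>
    (cut _ _ h).elim (fun h => x.2 (Or.inr h)) fun h => y.2 (Or.inl h)
  let r : I → I → Prop := fun x y => R.ev x.1 y.1
  have : IsStrictTotalOrder I r :=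
    { irrefl := fun x => R.ev_irrefl x.1
      trans := fun _ _ _ => R.ev_trans
      trichotomous := fun x y h1 h2 => by
        rcases R.total x.1 y.1 with h | h | h | h | h
        · exact Subtype.ext h
        · exact absurd h (hlt _ _)
        · exact absurd h (hlt _ _)
        · exact absurd h h1
        · exact absurd h h2 }
  let _ : LinearOrder I := linearOrderOfSTO r
  let _ : Fintype I := Fintype.ofFinite I
  let e : Fin (Fintype.card I) ≃o I := Fintype.orderIsoFinOfCardEq I rfl
  refine ⟨⟨Fintype.card I, fun i => R.lab (e i).1⟩,
    { emb := fun i => (e i).1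
      A := A
      B := B
      inj := Subtype.val_injective.comp e.injective
      lab := fun _ => rfl
      ev := fun i j hij => (e.lt_iff_lt.2 hij : r (e i) (e j))
      disj := disj
      union := ?_
      cut := cut }, rfl, rfl⟩
  ext x
  constructor
  · rintro hx ⟨i, rfl⟩
    exact (e i).2 hx
  · intro hx
    by_contra h
    exact hx ⟨e.symm ⟨x, h⟩, by simp⟩

/-- The restriction of a cell of a track object to a part that contains all active events. -/
noncomputable def restrict {P : Iposet Alph} {k : P.carrier → R.carrier} (hk : IsFull k)
    (c : Cut R U) (h : ∀ i, ∃ p, k p = c.emb i) : Cut P U where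
  emb i := (h i).choose
  A := k ⁻¹' c.A
  B := k ⁻¹' c.B
  inj i j hij := c.inj ((h i).choose_spec.symm.trans ((congrArg k hij).trans (h j).choose_spec))
  lab i := by rw [← hk.lab, (h i).choose_spec, c.lab]
  ev i j hij := by
    have h1 := c.ev i j hij
    have h2 := c.not_lt i j
    have h3 := c.not_lt j i
    rw [← (h i).choose_spec, ← (h j).choose_spec] at h1 h2 h3
    exact hk.ev _ _ h1 h2 h3
  disj := c.disj.preimage _
  union := by
    rw [← Set.preimage_union, c.union]
    ext p
    refine not_congr ?_
    constructor
    · rintro ⟨i, hi⟩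
      exact ⟨i, hk.inj ((h i).choose_spec.trans hi)⟩
    · rintro ⟨i, rfl⟩
      exact ⟨i, (h i).choose_spec.symm⟩
  cut x y hxy := c.cut _ _ (hk.lt x y hxy)

theorem restrict_emb {P : Iposet Alph} {k : P.carrier → R.carrier} (hk : IsFull k)
    (c : Cut R U) (h : ∀ i, ∃ p, k p = c.emb i) (i : Fin U.len) :
    k ((c.restrict hk h).emb i) = c.emb i := (h i).choose_spec

theorem restrict_face {P : Iposet Alph} {k : P.carrier → R.carrier} (hk : IsFull k)
    (c : Cut R V) (h : ∀ i, ∃ p, k p = c.emb i) (d : U ⟶ V) :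
    (c.face d).restrict hk (fun i => h (d.emb i)) = (c.restrict hk h).face d := by
  have key : ∀ s t, k ⁻¹' (c.emb '' s ∪ t) = (c.restrict hk h).emb '' s ∪ k ⁻¹' t := by
    intro s t
    ext p
    refine or_congr ⟨?_, ?_⟩ Iff.rfl
    · rintro ⟨i, hi, hp⟩
      exact ⟨i, hi, hk.inj ((restrict_emb hk c h i).trans hp)⟩
    · rintro ⟨i, hi, rfl⟩
      exact ⟨i, hi, (restrict_emb hk c h i).symm⟩
  exact Cut.ext rfl (key _ _) (key _ _)

/-- The image of a cell of a track object under a subsumption. -/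
def map {P : Iposet Alph} {f : P.carrier ≃ R.carrier} (hf : IsSubsumption P R f)
    (c : Cut P U) : Cut R U where
  emb := f ∘ c.emb
  A := f '' c.A
  B := f '' c.B
  inj := f.injective.comp c.inj
  lab i := (hf.lab _).trans (c.lab i)
  ev i j hij := hf.ev _ _ (c.ev i j hij) (c.not_lt i j) (c.not_lt j i)
  disj := (Set.disjoint_image_iff f.injective).2 c.disj
  union := by
    rw [← Set.image_union, c.union, Set.range_comp, Set.image_compl_eq f.bijective]
  cut x y h := by
    have := c.cut (f.symm x) (f.symm y) (hf.lt _ _ (by simpa using h))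
    rcases this with h | h
    · exact Or.inl ⟨_, h, by simp⟩
    · exact Or.inr ⟨_, h, by simp⟩

/-- The inverse image under a subsumption of a cell of a track object. -/
def comap {P : Iposet Alph} {f : P.carrier ≃ R.carrier} (hf : IsSubsumption P R f)
    (c : Cut R U) (h : ∀ x y, P.lt x y → f x ∈ c.B ∨ f y ∈ c.A) : Cut P U where
  emb := f.symm ∘ c.emb
  A := f ⁻¹' c.A
  B := f ⁻¹' c.B
  inj := f.symm.injective.comp c.inj
  lab i := by rw [← c.lab i, ← hf.lab]; simp
  ev i j hij := by
    have h1 : ∀ i j, ¬ P.lt (f.symm (c.emb i)) (f.symm (c.emb j)) := fun i j hl => by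
      have := h _ _ hl
      rw [f.apply_symm_apply, f.apply_symm_apply] at this
      exact this.elim (c.emb_not_mem i).2 (c.emb_not_mem j).1
    rcases P.total (f.symm (c.emb i)) (f.symm (c.emb j)) with h' | h' | h' | h' | h'
    · exact absurd (c.inj (f.symm.injective h')) hij.ne
    · exact absurd h' (h1 _ _)
    · exact absurd h' (h1 _ _)
    · exact h'
    · have := hf.ev _ _ h' (h1 _ _) (h1 _ _)
      simp only [f.apply_symm_apply] at this
      exact absurd (c.lt_of_ev this) hij.not_gt
  disj := c.disj.preimage _
  union := by
    rw [← Set.preimage_union, c.union]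
    ext p
    refine not_congr (exists_congr fun _ => ?_)
    exact (Equiv.symm_apply_eq f).symm
  cut := h

theorem map_comap {P : Iposet Alph} {f : P.carrier ≃ R.carrier} (hf : IsSubsumption P R f)
    (c : Cut R U) (h : ∀ x y, P.lt x y → f x ∈ c.B ∨ f y ∈ c.A) :
    (c.comap hf h).map hf = c :=
  Cut.ext (funext fun _ => f.apply_symm_apply _) (Set.image_preimage_eq _ f.surjective)
    (Set.image_preimage_eq _ f.surjective)

theorem map_face {P : Iposet Alph} {f : P.carrier ≃ R.carrier} (hf : IsSubsumption P R f)
    (c : Cut P V) (d : U ⟶ V) : (c.face d).map hf = (c.map hf).face d := by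
  have key : ∀ s t, f '' (c.emb '' s ∪ t) = (f ∘ c.emb) '' s ∪ f '' t := by
    intro s t
    rw [Set.image_union, Set.image_comp]
  exact Cut.ext rfl (key _ _) (key _ _)

end Cut

variable {X : (LoSet Alph)ᵒᵖ ⥤ Type u}

/-- Maps from the track object of `R` to a precubical set. -/
structure CutMap (R : Iposet Alph) (X : (LoSet Alph)ᵒᵖ ⥤ Type u) where
  app : ∀ {U : LoSet Alph}, Cut R U → X.obj (op U)
  face : ∀ {U V : LoSet Alph} (c : Cut R V) (d : U ⟶ V), app (c.face d) = X.map d.op (app c)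

/-- There is a map from the track object of `R` to `X` that maps the source interface, enumerated
by `s`, to `x`, and the target interface, enumerated by `t`, to `y`. -/
def HasTrack (R : Iposet Alph) (x y : Cells X) (s : Fin x.1.len → R.carrier)
    (t : Fin y.1.len → R.carrier) : Prop :=
  ∃ φ : CutMap R X,
    (∃ a : Cut R x.1, a.emb = s ∧ a.B = ∅ ∧ Set.range s = R.S ∧ φ.app a = x.2) ∧
    ∃ b : Cut R y.1, b.emb = t ∧ b.A = ∅ ∧ Set.range t = R.T ∧ φ.app b = y.2

theorem Cut.A_eq {R : Iposet Alph} {U : LoSet Alph} (c : Cut R U) (h : c.B = ∅) :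
    c.A = (Set.range c.emb)ᶜ := by
  rw [← c.union, h, Set.union_empty]

theorem Cut.B_eq {R : Iposet Alph} {U : LoSet Alph} (c : Cut R U) (h : c.A = ∅) :
    c.B = (Set.range c.emb)ᶜ := by
  rw [← c.union, h, Set.empty_union]

/-- A subsumption sends cuts of `P` to cuts of `R`, because `P` has at least the precedence of `R`;
so maps from the track object of `R` restrict to that of `P`. The initial and final cuts are in the
image since interfaces consist of minimal and maximal events. -/
theorem HasTrack.of_subsumption {P R : Iposet Alph} {f : P.carrier ≃ R.carrier}
    (hf : IsSubsumption P R f) {x y : Cells X} {s : Fin x.1.len → R.carrier}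
    {t : Fin y.1.len → R.carrier} (h : HasTrack R x y s t) :
    HasTrack P x y (f.symm ∘ s) (f.symm ∘ t) := by
  obtain ⟨φ, ⟨a, rfl, haB, haS, ha⟩, b, rfl, hbA, hbT, hb⟩ := h
  have hS : P.S = f ⁻¹' R.S := by rw [← hf.S, Set.preimage_image_eq _ f.injective]
  have hT : P.T = f ⁻¹' R.T := by rw [← hf.T, Set.preimage_image_eq _ f.injective]
  refine ⟨⟨fun c => φ.app (c.map hf), fun c d => by rw [Cut.map_face, φ.face]⟩,
    ⟨a.comap hf fun x y hl => Or.inr ?_, rfl, ?_, ?_, ?_⟩,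
    ⟨b.comap hf fun x y hl => Or.inl ?_, rfl, ?_, ?_, ?_⟩⟩
  · rw [a.A_eq haB, haS]
    exact fun h => P.S_min y (hS ▸ h) x hl
  · exact (congrArg (f ⁻¹' ·) haB).trans Set.preimage_empty
  · rw [hS, ← haS, Set.range_comp, ← f.image_symm_eq_preimage]
  · exact (congrArg φ.app (a.map_comap hf _)).trans ha
  · rw [b.B_eq hbA, hbT]
    exact fun h => P.T_max x (hT ▸ h) y hl
  · exact (congrArg (f ⁻¹' ·) hbA).trans Set.preimage_empty
  · rw [hT, ← hbT, Set.range_comp, ← f.image_symm_eq_preimage]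
  · exact (congrArg φ.app (b.map_comap hf _)).trans hb

end Iposet

/-! ### From maps on track objects to paths -/

namespace Iposet
variable {X : (LoSet Alph)ᵒᵖ ⥤ Type u}

theorem Cut.face_target {R : Iposet Alph} {U V : LoSet Alph} (c : Cut R V) (d : U ⟶ V)
    (h : d.A = ∅) : (c.face d).Bᶜ = c.Bᶜ \ c.emb '' (Set.range d.emb)ᶜ := by
  have : (Set.range d.emb)ᶜ = d.B := by rw [← d.union, h, Set.empty_union]
  rw [this]
  ext x
  change ¬ (x ∈ c.emb '' d.B ∨ x ∈ c.B) ↔ x ∉ c.B ∧ x ∉ c.emb '' d.B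
  tauto

/-- A map from the track object of an interval iposet to `X` gives rise to a path in `X`. -/
theorem CutMap.exists_path {R : Iposet Alph} (hR : R.IsInterval) (φ : CutMap R X) {V : LoSet Alph}
    (b : Cut R V) (hbA : b.A = ∅) (hbT : Set.range b.emb = R.T) {U : LoSet Alph}
    (c : Cut R U) (hT : ∀ x ∈ c.B, x ∉ R.T) :
    ∃ p : Path (𝟭 (LoSet Alph)) X ⟨U, φ.app c⟩ ⟨V, φ.app b⟩,
      Tracks (𝟭 (LoSet Alph)) R True p c.Bᶜ c.emb R.T b.emb := by
  have := R.finite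
  have hbB : b.Bᶜ = R.T := by rw [b.B_eq hbA, hbT, compl_compl]
  induction hn : c.Bᶜ.ncard using Nat.strong_induction_on generalizing U c with
  | _ n ih =>
  have hcd := Set.disjoint_left.1 c.disj
  -- The events that cannot be started yet: those with an unterminated predecessor. The path is
  -- greedy; it starts all other events, then terminates as much as possible.
  let A' : Set R.carrier := {y | y ∉ c.B ∧ ∃ x, x ∉ c.B ∧ R.lt x y}
  have hA' : ∀ x y, R.lt x y → x ∉ c.B → y ∈ A' := fun x y h hx => by
    refine ⟨fun hy => ?_, x, hx, h⟩
    rcases c.cut x y h with h' | h'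
    · exact hx h'
    · exact hcd h' hy
  have hAA : A' ⊆ c.A := by
    rintro y ⟨-, x, hx, h⟩
    exact (c.cut x y h).resolve_left hx
  -- The cut reached by the maximal up-step from `c`.
  obtain ⟨U₁, c₁, hcA, hcB⟩ := Cut.exists_of_disjoint (R := R) A' c.B (c.disj.mono_left hAA)
    fun x y h => by
      by_cases hx : x ∈ c.B
      · exact Or.inl hx
      · exact Or.inr (hA' x y h hx)
  obtain ⟨d₁, hd₁⟩ := c₁.exists_face c (hcA ▸ hAA) hcB.le
  have hd₁B : d₁.B = ∅ := c₁.face_B_eq d₁ (by rw [← hd₁, hcB])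
  have hup : φ.app c = X.map d₁.op (φ.app c₁) := by
    rw [← φ.face c₁ d₁, ← hd₁]
  suffices h : ∃ p : Path (𝟭 (LoSet Alph)) X ⟨U₁, φ.app c₁⟩ ⟨V, φ.app b⟩,
      Tracks (𝟭 (LoSet Alph)) R True p c.Bᶜ c₁.emb R.T b.emb by
    obtain ⟨p, hp⟩ := h
    exact ⟨.up (x := ⟨U, φ.app c⟩) (y := ⟨U₁, φ.app c₁⟩) d₁ hd₁B hup p,
      c.isStage True, c₁.emb, congrArg Cut.emb hd₁, hp⟩
  -- What remains is a down-step from `c₁` and a path after it. The events it terminates must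
  -- precede all of `A'`, as the path ipomset orders them before everything that is started later.
  suffices h : ∃ (U₂ : LoSet Alph) (c₂ : Cut R U₂) (p : Path (𝟭 (LoSet Alph)) X ⟨U₂, φ.app c₂⟩
      ⟨V, φ.app b⟩), Tracks (𝟭 (LoSet Alph)) R True p c₂.Bᶜ c₂.emb R.T b.emb ∧ c₂.A = A' ∧
      c.B ⊆ c₂.B ∧ ∀ x ∈ c₂.B, x ∉ c.B → ∀ y ∈ A', R.lt x y by
    obtain ⟨U₂, c₂, p, hp, hA₂, hB₂, hlt⟩ := h
    obtain ⟨d₂, rfl⟩ := c₁.exists_face c₂ (hcA.trans hA₂.symm).le (hcB ▸ hB₂)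
    have hd₂A : d₂.A = ∅ := c₁.face_A_eq d₂ (hA₂.trans hcA.symm)
    refine ⟨.down (x := ⟨U₁, φ.app c₁⟩) (y := ⟨U₂, φ.app (c₁.face d₂)⟩) d₂ hd₂A (φ.face c₁ d₂) p,
      hcB ▸ c₁.isStage True, fun i hi y hy hyr => ?_, ?_⟩
    · refine hlt _ (Or.inl ⟨i, ?_, rfl⟩) (hcB ▸ (c₁.emb_not_mem i).2) y ?_
      · have : i ∈ d₂.A ∪ d₂.B := by rw [d₂.union]; exact hi
        rwa [hd₂A, Set.empty_union] at this
      · by_contra hyA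
        exact hyr (c₁.mem_range (hcA ▸ hyA) (hcB ▸ hy))
    · have := c₁.face_target d₂ hd₂A
      rw [hcB] at this
      exact this ▸ hp
  by_cases hne : A'.Nonempty
  · obtain ⟨y₀, hy₀, x₀, hx₀, hxy₀⟩ := hne
    obtain ⟨bb, e, hbe, hlt⟩ := hR
    -- Intervality is used here: an unterminated event with minimal end precedes every event that
    -- has any unterminated predecessor, so the down-step is not trivial and the induction
    -- progresses.
    obtain ⟨m, hm, hmin⟩ := (Set.toFinite c.Bᶜ).exists_minimalFor e _ ⟨x₀, hx₀⟩
    have hmA : ∀ y ∈ A', R.lt m y := by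
      rintro y ⟨-, x, hx, hxy⟩
      rw [hlt] at hxy ⊢
      rcases le_total (e m) (e x) with h | h
      · exact h.trans_lt hxy
      · exact (hmin hx h).trans_lt hxy
    -- The events to terminate. None lies in `T_R`, since each has a successor in `A'`.
    let D : Set R.carrier := {x | x ∉ c.B ∧ ∀ y ∈ A', R.lt x y}
    have hmD : m ∈ D := ⟨hm, hmA⟩
    obtain ⟨U₂, c₂, hA₂, hB₂⟩ := Cut.exists_of_disjoint (R := R) A' (c.B ∪ D) (by
        rw [Set.disjoint_left]
        rintro x hx (h | h)
        · exact hx.1 h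
        · exact R.lt_irrefl _ (h.2 x hx))
      fun x y h => by
        by_cases hx : x ∈ c.B
        · exact Or.inl (Or.inl hx)
        · exact Or.inr (hA' x y h hx)
    have hcard : c₂.Bᶜ.ncard < n := by
      rw [← hn, hB₂]
      refine Set.ncard_lt_ncard ⟨Set.compl_subset_compl.2 Set.subset_union_left, fun h => ?_⟩
      exact h hm (Or.inr hmD)
    obtain ⟨p, hp⟩ := ih _ hcard c₂ (by
      rw [hB₂]
      rintro x (hx | hx)
      · exact hT x hx
      · exact fun h => R.T_max x h y₀ (hx.2 y₀ ⟨hy₀, x₀, hx₀, hxy₀⟩)) rfl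
    refine ⟨U₂, c₂, p, hp, hA₂, hB₂ ▸ Set.subset_union_left, fun x hx hxB => ?_⟩
    rw [hB₂] at hx
    exact (hx.resolve_left hxB).2
  -- With nothing left to start, one down-step terminates all events outside the target interface.
  · rw [Set.not_nonempty_iff_eq_empty] at hne
    refine ⟨V, b, .nil _, ⟨b.isStage True, hbB, rfl⟩, hbA.trans hne.symm, ?_, ?_⟩
    · intro x hx
      by_contra hxb
      exact hT x hx (hbB ▸ hxb)
    · rw [hne]
      exact fun _ _ _ _ h => h.elim

/-- The path from `CutMap.exists_path` is tracked strictly, so the resulting subsumption is an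
isomorphism and its ipomset is exactly `R`. -/
theorem HasTrack.exists_path {R : Iposet Alph} (hR : R.IsInterval) {x y : Cells X}
    {s : Fin x.1.len → R.carrier} {t : Fin y.1.len → R.carrier} (h : HasTrack R x y s t) :
    ∃ p : Path (𝟭 (LoSet Alph)) X x y,
      pathEv (𝟭 (LoSet Alph)) p = (Quotient.mk _ R : Ipomset Alph) := by
  obtain ⟨φ, ⟨a, rfl, haB, haS, ha⟩, b, rfl, hbA, hbT, hb⟩ := h
  obtain ⟨p, hp⟩ := φ.exists_path hR b hbA hbT a (by simp [haB])
  have hx : (⟨x.1, φ.app a⟩ : Cells X) = x := by rw [ha]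
  have hy : (⟨y.1, φ.app b⟩ : Cells X) = y := by rw [hb]
  rw [← hx, ← hy]
  refine ⟨p, (Quotient.sound ?_).symm⟩
  rw [haB, Set.compl_empty] at hp
  obtain ⟨g, hg, hs, ht⟩ := hp.embeds
  obtain ⟨k, hk, hlt⟩ := hg.subsumed (by
      rw [← haS]
      ext r
      constructor
      · rintro ⟨q, hq, rfl⟩
        refine ⟨(evAux _ p).2.equiv.symm ⟨q, hq⟩, ?_⟩
        rw [← hs, Equiv.apply_symm_apply]
      · rintro ⟨i, rfl⟩
        exact ⟨_, ((evAux _ p).2.equiv i).2, hs i⟩) (by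
      rw [← hbT]
      rintro r ⟨i, rfl⟩
      exact ⟨_, ht i⟩)
  exact ⟨k, hk, hlt trivial⟩

/-! ### Track objects of gluings and of paths -/

section Glue

variable {P Q : Iposet Alph} (f : Matching P Q)

/-- The track object of `P * Q` is covered by those of `P` and `Q`, which overlap in the cube of the
shared interface. The two maps agree there because both send this cube to the cell `y`. -/
theorem HasTrack.glue {x y z : Cells X} {s : Fin x.1.len → P.carrier} {t : Fin y.1.len → P.carrier}
    {s' : Fin y.1.len → Q.carrier} {t' : Fin z.1.len → Q.carrier} (hP : HasTrack P x y s t)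
    (hQ : HasTrack Q y z s' t') (hf : ∀ i, glueInr f (s' i) = Sum.inl (t i)) :
    HasTrack (Iposet.glue f) x z (fun i => Sum.inl (s i)) (fun i => glueInr f (t' i)) := by
  obtain ⟨φ, ⟨a, rfl, haB, haS, ha⟩, b, rfl, hbA, hbT, hb⟩ := hP
  obtain ⟨ψ, ⟨a', rfl, haB', haS', ha'⟩, b', rfl, hbA', hbT', hb'⟩ := hQ
  have hbB := b.B_eq hbA
  have haA' := a'.A_eq haB'
  rw [hbT] at hbB
  rw [haS'] at haA'
  let inl : P.carrier → (Iposet.glue f).carrier := Sum.inl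
  let inr : Q.carrier → (Iposet.glue f).carrier := glueInr f
  have hl : IsFull inl := isFull_inl f
  have hr : IsFull inr := isFull_glueInr f
  -- A cut lies on the left if nothing outside `S_Q` has started, and on the right if everything
  -- outside `T_P` has terminated. As `P ∖ T_P` precedes `Q ∖ S_Q`, one of the two always holds.
  let IsL : ∀ {W : LoSet Alph}, Cut (Iposet.glue f) W → Prop := fun c => ∀ q ∉ Q.S, inr q ∈ c.A
  let IsR : ∀ {W : LoSet Alph}, Cut (Iposet.glue f) W → Prop := fun c => ∀ p ∉ P.T, inl p ∈ c.B
  have hLR : ∀ {W : LoSet Alph} (c : Cut (Iposet.glue f) W), ¬ IsL c → IsR c := by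
    intro W c hc p hp
    simp only [IsL, not_forall] at hc
    obtain ⟨q, hq, hqA⟩ := hc
    exact (c.cut _ _ (GlueLt.cross hp hq)).resolve_right hqA
  have hLe : ∀ {W : LoSet Alph} (c : Cut (Iposet.glue f) W), IsL c → ∀ i, ∃ p, inl p = c.emb i := by
    intro W c hc i
    have hi := c.emb_not_mem i
    revert hi
    generalize c.emb i = w
    intro hi
    rcases w with p | q
    · exact ⟨p, rfl⟩
    · have := hc q.1 q.2
      rw [show inr q.1 = Sum.inr q from glueInr_not_mem f q.2] at this
      exact absurd this hi.1
  have hRe : ∀ {W : LoSet Alph} (c : Cut (Iposet.glue f) W), IsR c → ∀ i, ∃ q, inr q = c.emb i := by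
    intro W c hc i
    have hi := c.emb_not_mem i
    revert hi
    generalize c.emb i = w
    intro hi
    rcases w with p | q
    · by_cases hp : p ∈ P.T
      · exact ⟨_, glueInr_equiv f ⟨p, hp⟩⟩
      · exact absurd (hc p hp) hi.2
    · exact ⟨q.1, glueInr_not_mem f q.2⟩
  have hagree : ∀ {W : LoSet Alph} (c : Cut (Iposet.glue f) W) (h : IsL c) (h' : IsR c),
      φ.app (c.restrict hl (hLe c h)) = ψ.app (c.restrict hr (hRe c h')) := by
    intro W c h h'
    have hcd := Set.disjoint_left.1 c.disj
    -- A cut of both kinds restricts on `P` to a face of the final cut `b`; the same coface map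
    -- presents its restriction to `Q` as a face of the initial cut `a'`.
    obtain ⟨d, hd⟩ := b.exists_face (c.restrict hl (hLe c h)) (by simp [hbA]) (by
      rw [hbB]
      exact fun p hp => h' p hp)
    have hd' : c.restrict hr (hRe c h') = a'.face d := by
      have hA := congrArg Cut.A hd
      have hB := congrArg Cut.B hd
      have key : ∀ (s : Set (Fin y.1.len)) (t : Set (Iposet.glue f).carrier) (r : Set P.carrier),
          inl ⁻¹' t = b.emb '' s ∪ r → (∀ i, b.emb i ∉ r) → ∀ i, inr (a'.emb i) ∈ t ↔ i ∈ s := by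
        intro s t r hst hr i
        have : inr (a'.emb i) = inl (b.emb i) := hf i
        rw [this]
        change b.emb i ∈ inl ⁻¹' t ↔ _
        rw [hst]
        constructor
        · rintro (⟨j, hj, hij⟩ | h)
          · exact b.inj hij ▸ hj
          · exact absurd h (hr i)
        · exact fun hi => Or.inl ⟨i, hi, rfl⟩
      have hA' := key _ _ _ hA fun i => (b.emb_not_mem i).1
      have hB' := key _ _ _ hB fun i => (b.emb_not_mem i).2
      have hS : ∀ q, q ∈ Q.S → ∃ i, a'.emb i = q := fun q hq => by
        rw [← haS'] at hq; exact hq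
      apply Cut.ext
      · funext i
        apply hr.inj
        exact (Cut.restrict_emb hr c (hRe c h') i).trans
          ((Cut.restrict_emb hl c (hLe c h) i).symm.trans
            ((congrArg (fun e => inl (e.emb i)) hd).trans (hf _).symm))
      · ext q
        change inr q ∈ c.A ↔ q ∈ a'.emb '' d.A ∪ a'.A
        by_cases hq : q ∈ Q.S
        · obtain ⟨i, rfl⟩ := hS q hq
          rw [hA' i]
          constructor
          · exact fun hi => Or.inl ⟨i, hi, rfl⟩
          · rintro (⟨j, hj, hij⟩ | hi)
            · exact a'.inj hij ▸ hj
            · exact absurd hi (a'.emb_not_mem i).1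
        · exact iff_of_true (h q hq) (Or.inr (haA' ▸ hq))
      · ext q
        change inr q ∈ c.B ↔ q ∈ a'.emb '' d.B ∪ a'.B
        rw [haB', Set.union_empty]
        by_cases hq : q ∈ Q.S
        · obtain ⟨i, rfl⟩ := hS q hq
          rw [hB' i]
          exact a'.inj.mem_set_image.symm
        · refine iff_of_false (hcd (h q hq)) ?_
          rintro ⟨j, -, rfl⟩
          exact hq (haS' ▸ ⟨j, rfl⟩)
    rw [hd, hd', φ.face, ψ.face, hb, ha']
  classical
  let app : ∀ {W : LoSet Alph}, Cut (Iposet.glue f) W → X.obj (op W) := fun c =>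
    if h : IsL c then φ.app (c.restrict hl (hLe c h)) else ψ.app (c.restrict hr (hRe c (hLR c h)))
  have appL : ∀ {W : LoSet Alph} (c : Cut (Iposet.glue f) W) (h : IsL c),
      app c = φ.app (c.restrict hl (hLe c h)) := fun c h => dif_pos h
  have appR : ∀ {W : LoSet Alph} (c : Cut (Iposet.glue f) W) (h : IsR c),
      app c = ψ.app (c.restrict hr (hRe c h)) := fun c h => by
    by_cases h' : IsL c
    · rw [appL c h', hagree c h' h]
    · exact dif_neg h'
  refine ⟨⟨app, fun c d => ?_⟩, ?_, ?_⟩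
  · by_cases h : IsL c
    · have h1 : IsL (c.face d) := fun q hq => Or.inr (h q hq)
      rw [appL c h, appL _ h1, ← φ.face, ← Cut.restrict_face]
    · have h0 := hLR c h
      have h1 : IsR (c.face d) := fun q hq => Or.inr (h0 q hq)
      rw [appR c h0, appR _ h1, ← ψ.face, ← Cut.restrict_face]
  · have hS : Set.range (fun i => inl (a.emb i)) = (Iposet.glue f).S := by
      change Set.range (inl ∘ a.emb) = Sum.inl '' P.S
      rw [Set.range_comp, haS]
      rfl
    let c : Cut (Iposet.glue f) x.1 :=
      { emb := fun i => inl (a.emb i)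
        A := (Set.range fun i => inl (a.emb i))ᶜ
        B := ∅
        inj := hl.inj.comp a.inj
        lab := a.lab
        ev := fun i j h => .single (.left (a.ev i j h))
        disj := Set.disjoint_empty _
        union := Set.union_empty _
        cut := fun x y h => Or.inr (by
          rw [hS]
          exact fun hy => (Iposet.glue f).S_min y hy x h) }
    have hc : IsL c := by
      rintro q hq ⟨i, hi⟩
      rw [show inr q = Sum.inr ⟨q, hq⟩ from glueInr_not_mem f hq] at hi
      cases hi
    refine ⟨c, rfl, rfl, hS, ?_⟩
    refine (appL c hc).trans (Eq.trans (congrArg φ.app ?_) ha)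
    apply Cut.ext
    · exact funext fun i => hl.inj (Cut.restrict_emb hl c _ i)
    · rw [a.A_eq haB]
      ext p
      refine not_congr (exists_congr fun i => ?_)
      exact hl.inj.eq_iff
    · exact haB.symm
  · have hT : Set.range (fun i => inr (b'.emb i)) = (Iposet.glue f).T := by
      change Set.range (inr ∘ b'.emb) = glueInr f '' Q.T
      rw [Set.range_comp, hbT']
      rfl
    let c : Cut (Iposet.glue f) z.1 :=
      { emb := fun i => inr (b'.emb i)
        A := ∅
        B := (Set.range fun i => inr (b'.emb i))ᶜ
        inj := hr.inj.comp b'.inj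
        lab := fun i => (hr.lab _).trans (b'.lab i)
        ev := fun i j h => .single (.right (b'.ev i j h))
        disj := Set.empty_disjoint _
        union := Set.empty_union _
        cut := fun x y h => Or.inl (by
          rw [hT]
          exact fun hy => (Iposet.glue f).T_max x hy y h) }
    have hc : IsR c := by
      rintro p hp ⟨i, hi⟩
      obtain ⟨t, rfl, -⟩ := glueInr_eq_inl f hi
      exact hp t.2
    refine ⟨c, rfl, rfl, hT, ?_⟩
    refine (appR c hc).trans (Eq.trans (congrArg ψ.app ?_) hb')
    apply Cut.ext
    · exact funext fun i => hr.inj (Cut.restrict_emb hr c _ i)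
    · exact hbA'.symm
    · rw [b'.B_eq hbA']
      ext p
      refine not_congr (exists_congr fun i => ?_)
      exact hr.inj.eq_iff

end Glue

/-! ### Track objects of discrete iposets and of path ipomsets -/

section Cube

variable {V : LoSet Alph} {S T : Set (Fin V.len)}

/-- A cell of the track object of a discrete iposet, as a coface map. -/
def Cut.toHom {U : LoSet Alph} (c : Cut (ofILoSet ⟨V, S, T⟩) U) : U ⟶ V where
  emb := OrderEmbedding.ofStrictMono c.emb c.ev
  A := c.A
  B := c.B
  lab_emb := c.lab
  disj := c.disj
  union := c.union

/-- A coface map, as a cell of the track object of a discrete iposet. -/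
def Cut.ofHom {U : LoSet Alph} (d : U ⟶ V) : Cut (ofILoSet ⟨V, S, T⟩) U where
  emb := d.emb
  A := d.A
  B := d.B
  inj := d.emb.injective
  lab := d.lab_emb
  ev _ _ h := d.emb.lt_iff_lt.2 h
  disj := d.disj
  union := d.union
  cut _ _ h := h.elim

/-- The map from the track object of a discrete iposet given by a cell. -/
def cubeMap (S T : Set (Fin V.len)) (x : X.obj (op V)) : CutMap (ofILoSet ⟨V, S, T⟩) X where
  app c := X.map c.toHom.op x
  face c d := by
    rw [← Functor.map_comp_apply]
    rfl

theorem cubeMap_ofHom (x : X.obj (op V)) {U : LoSet Alph} (d : U ⟶ V) :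
    (cubeMap S T x).app (Cut.ofHom d) = X.map d.op x := rfl

theorem cubeMap_id (x : X.obj (op V)) : (cubeMap S T x).app (Cut.ofHom (𝟙 V)) = x := by
  rw [cubeMap_ofHom]
  simp

end Cube

/-- A step has a discrete ipomset, whose track object is the standard cube, so its upper cell gives
the map by the Yoneda lemma; the maps of the steps are then glued. -/
theorem hasTrack_evAux {x y : Cells X} (p : Path (𝟭 (LoSet Alph)) X x y) :
    HasTrack (evAux _ p).1 x y (fun i => ((evAux _ p).2.equiv i).1)
      (fun i => ((evTgt _ p).equiv i).1) := by
  have hid : ∀ U : LoSet Alph, Set.range (𝟙 U : U ⟶ U).emb = Set.univ := fun U =>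
    Set.range_eq_univ.2 fun i => ⟨i, rfl⟩
  induction p with
  | nil x =>
    exact ⟨cubeMap _ _ x.2, ⟨Cut.ofHom (𝟙 _), rfl, rfl, hid _, cubeMap_id _⟩,
      Cut.ofHom (𝟙 _), rfl, rfl, hid _, cubeMap_id _⟩
  | @up x y z d hd hx p ih =>
    have h : HasTrack (upIposet d) x y d.emb id :=
      ⟨cubeMap _ _ y.2, ⟨Cut.ofHom d, rfl, hd, rfl, hx.symm⟩,
        Cut.ofHom (𝟙 _), rfl, rfl, hid _, cubeMap_id _⟩
    exact h.glue (upMatching d (evAux _ p).2) ih fun i =>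
      glueInr_equiv (upMatching d (evAux _ p).2) ⟨i, trivial⟩
  | @down x y z d hd hx p ih =>
    have h : HasTrack (downIposet d) x y id d.emb :=
      ⟨cubeMap _ _ x.2, ⟨Cut.ofHom (𝟙 _), rfl, rfl, hid _, cubeMap_id _⟩,
        Cut.ofHom d, rfl, hd, rfl, hx.symm⟩
    refine h.glue (downMatching d (evAux _ p).2) ih fun i => ?_
    refine Eq.trans ?_ (glueInr_equiv (downMatching d (evAux _ p).2) ⟨d.emb i, ⟨i, rfl⟩⟩)
    refine congrArg (fun k => glueInr _ ((evAux _ p).2.equiv k).1) ?_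
    exact (d.emb.orderIso.symm_apply_apply i).symm

/-- No compatibility of the enumerations has to be assumed: the matching induces a strictly monotone
self-map of `Fin y.1.len`, which must be the identity. -/
theorem HasTrack.glue_of_matching {P Q : Iposet Alph} {x y z : Cells X}
    {s : Fin x.1.len → P.carrier} {t : Fin y.1.len → P.carrier} {s' : Fin y.1.len → Q.carrier}
    {t' : Fin z.1.len → Q.carrier} (hP : HasTrack P x y s t) (hQ : HasTrack Q y z s' t')
    (f : Matching P Q) :
    HasTrack (Iposet.glue f) x z (fun i => Sum.inl (s i)) (fun i => glueInr f (t' i)) := by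
  refine hP.glue f hQ ?_
  obtain ⟨φ, -, b, rfl, -, hbT, -⟩ := hP
  obtain ⟨ψ, ⟨a, rfl, -, haS, -⟩, -⟩ := hQ
  have hb : ∀ i, b.emb i ∈ P.T := fun i => hbT ▸ ⟨i, rfl⟩
  have hk : ∀ i, ∃ j, a.emb j = (f.equiv ⟨b.emb i, hb i⟩).1 := fun i => by
    exact haS.symm.subset (f.equiv ⟨b.emb i, hb i⟩).2
  choose k hk using hk
  have hmono : StrictMono k := fun i j hij => a.lt_of_ev (by
    rw [hk, hk]
    exact (f.ev_iff _ _).1 (b.ev i j hij))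
  have hid : k = id := (hmono.range_inj strictMono_id).1 (by
    rw [Set.range_id, Set.range_eq_univ]
    exact Finite.surjective_of_injective hmono.injective)
  intro i
  have := hk i
  rw [hid, id] at this
  rw [this, glueInr_equiv]

end Iposet

theorem exists_hasTrack_of_mem_langOf {X : (LoSet Alph)ᵒᵖ ⥤ Type u} {start accept : Set (Cells X)}
    {P : Iposet Alph}
    (h : (Quotient.mk _ P : Ipomset Alph) ∈ langOf (𝟭 (LoSet Alph)) start accept) :
    ∃ x ∈ start, ∃ y ∈ accept, ∃ s t, Iposet.HasTrack P x y s t := by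
  obtain ⟨x, hx, y, hy, p, hp⟩ := h
  obtain ⟨f, hf, -⟩ := Iposet.Isomorphic.symm (Quotient.exact hp)
  exact ⟨x, hx, y, hy, _, _, (Iposet.hasTrack_evAux p).of_subsumption hf⟩

/-! ### Starting early and terminating late -/

/-- A partial assignment of events of `R` to the events of `V`, given the active events of the face
along `d : W → V`; it is defined on all events that are active or terminated in this face. -/
structure IsPartialStage (R : Iposet Alph) {W V : LoSet Alph} (d : W ⟶ V) (F : Set R.carrier)
    (s : Fin W.len → R.carrier) (r : ∀ i, i ∉ d.A → R.carrier) : Prop where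
  comp : ∀ w h, r (d.emb w) h = s w
  inj : ∀ i j hi hj, r i hi = r j hj → i = j
  lab : ∀ i hi, R.lab (r i hi) = V.lab i
  ev : ∀ i j hi hj, R.ev (r i hi) (r j hj) → ¬ R.lt (r i hi) (r j hj) →
    ¬ R.lt (r j hj) (r i hi) → i < j
  not_mem : ∀ i hi, i ∈ d.B → r i hi ∉ F
  lt : ∀ i hi, i ∈ d.B → ∀ y ∈ F, y ∉ Set.range s → R.lt (r i hi) y

/-- Every partial assignment at the face along `d : W → V` extends to a stage at `V` that satisfies
`Out`, where the events unstarted in the face are started early and those terminated in the face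
are terminated late. -/
def ExtendsTo (R : Iposet Alph) {W V : LoSet Alph} (d : W ⟶ V) (F : Set R.carrier)
    (s : Fin W.len → R.carrier) (Out : Set R.carrier → (Fin V.len → R.carrier) → Prop) : Prop :=
  ∀ r, IsPartialStage R d F s r → ∃ r' : Fin V.len → R.carrier, (∀ i hi, r' i = r i hi) ∧
    (∀ i ∈ d.A, r' i ∈ F ∧ r' i ∉ Set.range s) ∧ Out (F ∪ r' '' d.B) r'

section Extends

variable {R : Iposet Alph} {W W' V V' M : LoSet Alph} {F : Set R.carrier}

theorem LoSet.Hom.cases (d : W ⟶ V) (i : Fin V.len) : (∃ w, d.emb w = i) ∨ i ∈ d.A ∨ i ∈ d.B := by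
  by_cases h : i ∈ Set.range d.emb
  · exact Or.inl h
  · exact Or.inr (by rwa [← Set.mem_compl_iff, ← d.union] at h)

theorem LoSet.Hom.emb_not_mem (d : W ⟶ V) (w : Fin W.len) : d.emb w ∉ d.A ∧ d.emb w ∉ d.B := by
  have : d.emb w ∉ d.A ∪ d.B := by rw [d.union]; exact fun h => h ⟨w, rfl⟩
  exact ⟨fun h => this (Or.inl h), fun h => this (Or.inr h)⟩

/-- Terminating late: the events terminated by `D` become terminated events of the composite face,
and the extension puts them back among the unterminated ones. -/
theorem ExtendsTo.of_down {Out : Set R.carrier → (Fin V.len → R.carrier) → Prop} {d : W ⟶ V}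
    {D : W' ⟶ W} {s : Fin W.len → R.carrier} (hD : D.A = ∅) (hs : R.IsStage False W F s)
    (hlt : ∀ i ∉ Set.range D.emb, ∀ y ∈ F, y ∉ Set.range s → R.lt (s i) y)
    (h : ExtendsTo R (D ≫ d) (F \ s '' (Set.range D.emb)ᶜ) (s ∘ D.emb) Out) :
    ExtendsTo R d F s Out := by
  intro r hr
  have hA : (D ≫ d).A = d.A := by
    change d.emb '' D.A ∪ d.A = d.A
    rw [hD, Set.image_empty, Set.empty_union]
  have hB : (D ≫ d).B = d.emb '' D.B ∪ d.B := rfl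
  have hDB : (Set.range D.emb)ᶜ = D.B := by rw [← D.union, hD, Set.empty_union]
  -- An unterminated event that is inactive after the down-step was inactive before it.
  have hy : ∀ y ∈ F \ s '' (Set.range D.emb)ᶜ, y ∉ Set.range (s ∘ D.emb) → y ∉ Set.range s := by
    rintro _ ⟨-, hy⟩ hyr ⟨i, rfl⟩
    exact hy ⟨i, fun ⟨w, hw⟩ => hyr ⟨w, congrArg s hw⟩, rfl⟩
  obtain ⟨r', h1, h2, h3⟩ := h (fun i hi => r i (hA ▸ hi))
    { comp := fun w h => hr.comp _ _
      inj := fun i j hi hj => hr.inj i j _ _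
      lab := fun i hi => hr.lab i _
      ev := fun i j hi hj => hr.ev i j _ _
      not_mem := by
        rintro i hi (⟨k, hk, rfl⟩ | hiB) hm
        · rw [hr.comp] at hm
          exact hm.2 ⟨k, hDB ▸ hk, rfl⟩
        · exact hr.not_mem i _ hiB hm.1
      lt := by
        rintro i hi (⟨k, hk, rfl⟩ | hiB) y hyF hyr
        · rw [hr.comp]
          rw [← hDB] at hk
          exact hlt k hk y hyF.1 (hy y hyF hyr)
        · exact hr.lt i _ hiB y hyF.1 (hy y hyF hyr) }
  refine ⟨r', fun i hi => h1 i (hA ▸ hi), fun i hi => ?_, ?_⟩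
  · obtain ⟨h4, h5⟩ := h2 i (hA ▸ hi)
    exact ⟨h4.1, hy _ h4 h5⟩
  · convert h3 using 1
    have hrs : r' '' (d.emb '' D.B) = s '' D.B := by
      rw [← Set.image_comp]
      refine Set.image_congr fun k _ => ?_
      have hk := (LoSet.Hom.emb_not_mem d k).1
      rw [Function.comp_apply, h1 _ (hA ▸ hk), hr.comp]
    rw [hB, Set.image_union, hrs, hDB, ← Set.union_assoc, Set.sdiff_union_of_subset]
    rintro _ ⟨k, -, rfl⟩
    exact hs.mem k

/-- Starting early: the positions not yet started before the up-step receive the events that `s`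
assigns to them after it. -/
theorem ExtendsTo.of_up {Out : Set R.carrier → (Fin V.len → R.carrier) → Prop} {d : W' ⟶ V}
    {g : W ⟶ W'} {s : Fin W'.len → R.carrier} (hg : g.B = ∅) (hs : R.IsStage False W' F s)
    (h : ExtendsTo R d F s Out) : ExtendsTo R (g ≫ d) F (s ∘ g.emb) Out := by
  classical
  intro r hr
  have hB : (g ≫ d).B = d.B := by
    change d.emb '' g.B ∪ d.B = d.B
    rw [hg, Set.image_empty, Set.empty_union]
  have hA : (g ≫ d).A = d.emb '' g.A ∪ d.A := rfl
  have hnA : ∀ i, i ∉ d.A → (¬ ∃ w, d.emb w = i) → i ∉ (g ≫ d).A := by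
    rintro i hi hn (⟨w, -, hw⟩ | h)
    · exact hn ⟨w, hw⟩
    · exact hi h
  -- On the positions active after the up-step take the events of `s`, on the terminated ones those
  -- already assigned by `r`.
  let r₁ : ∀ i, i ∉ d.A → R.carrier := fun i hi =>
    if hw : ∃ w, d.emb w = i then s hw.choose else r i (hnA i hi hw)
  have hr₁ : ∀ w h, r₁ (d.emb w) h = s w := fun w h => by
    have hw : ∃ v, d.emb v = d.emb w := ⟨w, rfl⟩
    exact (dif_pos hw).trans (congrArg s (d.emb.injective hw.choose_spec))
  have hr₂ : ∀ i h (hi : i ∈ d.B), ∃ h', r₁ i h = r i h' := fun i h hi => by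
    have hw : ¬ ∃ v, d.emb v = i := by
      rintro ⟨w, rfl⟩
      exact (LoSet.Hom.emb_not_mem d w).2 hi
    exact ⟨_, dif_neg hw⟩
  have hcases : ∀ i, i ∉ d.A → (∃ w, d.emb w = i) ∨ i ∈ d.B := fun i hi =>
    (LoSet.Hom.cases d i).imp_right fun h => h.resolve_left hi
  -- A terminated event compared with an active one: if the active one was started by this step, it
  -- comes after the terminated one; otherwise `r` already assigns both, and the conditions on `r`
  -- decide.
  have hmix : ∀ i (h' : i ∉ (g ≫ d).A) w, i ∈ d.B →
      R.lt (r i h') (s w) ∨ ∃ h, r (d.emb w) h = s w := by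
    intro i h' w hi
    by_cases hw : ∃ v, g.emb v = w
    · obtain ⟨v, rfl⟩ := hw
      exact Or.inr ⟨(LoSet.Hom.emb_not_mem (g ≫ d) v).1, hr.comp v _⟩
    · refine Or.inl (hr.lt i h' (hB ▸ hi) _ (hs.mem w) ?_)
      rintro ⟨v, hv⟩
      exact hw ⟨v, hs.inj hv⟩
  obtain ⟨r', h1, h2, h3⟩ := h r₁
    { comp := hr₁
      inj := by
        intro i j hi hj hij
        rcases hcases i hi with ⟨w, rfl⟩ | hiB <;> rcases hcases j hj with ⟨v, rfl⟩ | hjB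
        · rw [hr₁ w hi, hr₁ v hj] at hij
          rw [hs.inj hij]
        · obtain ⟨h', he⟩ := hr₂ j hj hjB
          rw [hr₁ w hi, he] at hij
          exact absurd (hij ▸ hs.mem w) (hr.not_mem j h' (hB ▸ hjB))
        · obtain ⟨h', he⟩ := hr₂ i hi hiB
          rw [hr₁ v hj, he] at hij
          exact absurd (hij ▸ hs.mem v) (hr.not_mem i h' (hB ▸ hiB))
        · obtain ⟨h', he⟩ := hr₂ i hi hiB
          obtain ⟨h'', he'⟩ := hr₂ j hj hjB
          rw [he, he'] at hij
          exact hr.inj _ _ _ _ hij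
      lab := by
        intro i hi
        rcases hcases i hi with ⟨w, rfl⟩ | hiB
        · rw [hr₁ w hi, hs.lab]
          exact (d.lab_emb w).symm
        · obtain ⟨h', he⟩ := hr₂ i hi hiB
          rw [he, hr.lab]
      ev := by
        intro i j hi hj h1 h2 h3
        rcases hcases i hi with ⟨w, rfl⟩ | hiB <;> rcases hcases j hj with ⟨v, rfl⟩ | hjB
        · rw [hr₁ w hi, hr₁ v hj] at h1 h2 h3
          exact d.emb.lt_iff_lt.2 (hs.ev _ _ h1 h2 h3)
        · obtain ⟨h', he⟩ := hr₂ j hj hjB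
          rw [hr₁ w hi, he] at h1 h2 h3
          rcases hmix j h' w hjB with h | ⟨h, he⟩
          · exact absurd h h3
          · rw [← he] at h1 h2 h3
            exact hr.ev _ _ _ _ h1 h2 h3
        · obtain ⟨h', he⟩ := hr₂ i hi hiB
          rw [hr₁ v hj, he] at h1 h2 h3
          rcases hmix i h' v hiB with h | ⟨h, he⟩
          · exact absurd h h2
          · rw [← he] at h1 h2 h3
            exact hr.ev _ _ _ _ h1 h2 h3
        · obtain ⟨h', he⟩ := hr₂ i hi hiB
          obtain ⟨h'', he'⟩ := hr₂ j hj hjB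
          rw [he, he'] at h1 h2 h3
          exact hr.ev _ _ _ _ h1 h2 h3
      not_mem := by
        intro i hi hiB
        obtain ⟨h', he⟩ := hr₂ i hi hiB
        rw [he]
        exact hr.not_mem i _ (hB ▸ hiB)
      lt := by
        intro i hi hiB y hy hyr
        obtain ⟨h', he⟩ := hr₂ i hi hiB
        rw [he]
        exact hr.lt i _ (hB ▸ hiB) y hy fun ⟨v, hv⟩ => hyr ⟨_, hv⟩ }
  refine ⟨r', fun i hi => ?_, ?_, hB ▸ h3⟩
  · have hi' : i ∉ d.A := fun h => hi (Or.inr h)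
    rw [h1 i hi']
    rcases hcases i hi' with ⟨w, rfl⟩ | hiB
    · have hw : ∃ v, g.emb v = w := by
        rcases LoSet.Hom.cases g w with h | h | h
        · exact h
        · exact absurd (Or.inl ⟨w, h, rfl⟩) hi
        · rw [hg] at h
          exact h.elim
      obtain ⟨v, rfl⟩ := hw
      rw [hr₁ _ hi']
      exact (hr.comp v hi).symm
    · obtain ⟨h', he⟩ := hr₂ i hi' hiB
      exact he
  · rintro i (⟨w, hw, rfl⟩ | hi)
    · have := (LoSet.Hom.emb_not_mem d w).1
      rw [h1 _ this, hr₁ _ this]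
      refine ⟨hs.mem w, ?_⟩
      rintro ⟨v, hv⟩
      exact (LoSet.Hom.emb_not_mem g v).1 (by rwa [hs.inj hv])
    · obtain ⟨h4, h5⟩ := h2 i hi
      exact ⟨h4, fun ⟨v, hv⟩ => h5 ⟨_, hv⟩⟩

/-- A change of representative costs a down-step from `V` to `M` and an up-step from `M` to `V'`.
The down-step is legitimate because the events it terminates are already terminated in the face `W`,
hence precede every unterminated inactive event, including those started early. -/
theorem ExtendsTo.of_common_face {Out : Set R.carrier → (Fin V.len → R.carrier) → Prop}
    {Out' : Set R.carrier → (Fin V'.len → R.carrier) → Prop} {d : W ⟶ M} {e : M ⟶ V} {e' : M ⟶ V'}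
    {s : Fin W.len → R.carrier} (he : e.A = ∅) (he' : e'.B = ∅)
    (hstage : ∀ F r, Out' F r → R.IsStage False V' F r)
    (hOut : ∀ F r r', R.IsStage False V F r →
      (∀ i ∉ Set.range e.emb, ∀ y ∈ F, y ∉ Set.range r → R.lt (r i) y) →
      Out' (F \ r '' (Set.range e.emb)ᶜ) r' → r ∘ e.emb = r' ∘ e'.emb → Out F r)
    (h : ExtendsTo R (d ≫ e') F s Out') : ExtendsTo R (d ≫ e) F s Out := by
  classical
  intro r hr
  have hcongr : ∀ i j hi hj, i = j → r i hi = r j hj := by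
    rintro i _ hi hj rfl
    rfl
  have hAe : (d ≫ e).A = e.emb '' d.A := by
    change e.emb '' d.A ∪ e.A = e.emb '' d.A
    rw [he, Set.union_empty]
  have hAe' : ∀ i, i ∈ (d ≫ e').A ↔ i ∈ e'.emb '' d.A ∨ i ∈ e'.A := fun _ => Iff.rfl
  have hBe' : (d ≫ e').B = e'.emb '' d.B := by
    change e'.emb '' d.B ∪ e'.B = e'.emb '' d.B
    rw [he', Set.union_empty]
  have heB : (Set.range e.emb)ᶜ = e.B := by rw [← e.union, he, Set.empty_union]
  have hA : ∀ k, e.emb k ∈ (d ≫ e).A ↔ k ∈ d.A := fun k => by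
    rw [hAe, e.emb.injective.mem_set_image]
  have hA' : ∀ k, e'.emb k ∈ (d ≫ e').A ↔ k ∈ d.A := fun k => by
    rw [hAe', e'.emb.injective.mem_set_image]
    exact or_iff_left (LoSet.Hom.emb_not_mem e' k).1
  have hB' : ∀ k, e'.emb k ∈ (d ≫ e').B → e.emb k ∈ (d ≫ e).B := fun k hk => by
    rw [hBe', e'.emb.injective.mem_set_image] at hk
    exact Or.inl ⟨k, hk, rfl⟩
  have hex : ∀ i, i ∉ (d ≫ e').A → ∃ k, e'.emb k = i := by
    intro i hi
    rcases LoSet.Hom.cases e' i with h | h | h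
    · exact h
    · exact absurd (Or.inr h) hi
    · rw [he'] at h
      exact h.elim
  have hex' : ∀ i hi, e.emb (hex i hi).choose ∉ (d ≫ e).A := fun i hi => by
    rw [hA, ← hA', (hex i hi).choose_spec]
    exact hi
  -- Restrict the assignment to `M` and read it on `V'`. This covers all required positions since
  -- `e'` terminates nothing.
  let r₁ : ∀ i, i ∉ (d ≫ e').A → R.carrier := fun i hi => r (e.emb (hex i hi).choose) (hex' i hi)
  have hr₁ : ∀ k h h', r₁ (e'.emb k) h = r (e.emb k) h' := fun k h h' =>
    hcongr _ _ _ _ (congrArg e.emb (e'.emb.injective (hex _ h).choose_spec))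
  have hr₁' : ∀ i hi, ∃ k h', e'.emb k = i ∧ r₁ i hi = r (e.emb k) h' := fun i hi =>
    ⟨_, hex' i hi, (hex i hi).choose_spec, rfl⟩
  obtain ⟨q, h1, h2, h3⟩ := h r₁
    { comp := fun w h => (hr₁ (d.emb w) h (LoSet.Hom.emb_not_mem (d ≫ e) w).1).trans (hr.comp w _)
      inj := by
        intro i j hi hj hij
        obtain ⟨k, hk, rfl, hik⟩ := hr₁' i hi
        obtain ⟨l, hl, rfl, hjl⟩ := hr₁' j hj
        rw [hik, hjl] at hij
        rw [e.emb.injective (hr.inj _ _ _ _ hij)]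
      lab := by
        intro i hi
        obtain ⟨k, hk, rfl, hik⟩ := hr₁' i hi
        rw [hik, hr.lab]
        exact (e.lab_emb k).trans (e'.lab_emb k).symm
      ev := by
        intro i j hi hj h1 h2 h3
        obtain ⟨k, hk, rfl, hik⟩ := hr₁' i hi
        obtain ⟨l, hl, rfl, hjl⟩ := hr₁' j hj
        rw [hik, hjl] at h1 h2 h3
        exact e'.emb.lt_iff_lt.2 (e.emb.lt_iff_lt.1 (hr.ev _ _ _ _ h1 h2 h3))
      not_mem := by
        intro i hi hiB
        obtain ⟨k, hk, rfl, hik⟩ := hr₁' i hi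
        rw [hik]
        exact hr.not_mem _ _ (hB' k hiB)
      lt := by
        intro i hi hiB
        obtain ⟨k, hk, rfl, hik⟩ := hr₁' i hi
        rw [hik]
        exact hr.lt _ _ (hB' k hiB) }
  have hs := hstage _ _ h3
  have hnA : ∀ i, (¬ ∃ k, e.emb k = i) → i ∉ (d ≫ e).A := by
    intro i hn hi
    rw [hAe] at hi
    obtain ⟨k, -, hk⟩ := hi
    exact hn ⟨k, hk⟩
  -- Positions from `M` take the extension found on `V'`; those terminated by `e` keep their
  -- prescribed events.
  let r' : Fin V.len → R.carrier := fun i =>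
    if hk : ∃ k, e.emb k = i then q (e'.emb hk.choose) else r i (hnA i hk)
  have hr'₁ : ∀ k, r' (e.emb k) = q (e'.emb k) := fun k => by
    have hk : ∃ l, e.emb l = e.emb k := ⟨k, rfl⟩
    exact (dif_pos hk).trans (congrArg (fun l => q (e'.emb l)) (e.emb.injective hk.choose_spec))
  have hr'₂ : ∀ i, i ∈ e.B → ∃ h, r' i = r i h := fun i hi => by
    have hk : ¬ ∃ k, e.emb k = i := by
      rintro ⟨k, rfl⟩
      exact (LoSet.Hom.emb_not_mem e k).2 hi
    exact ⟨_, dif_neg hk⟩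
  have hcases : ∀ i, (∃ k, e.emb k = i) ∨ i ∈ e.B := fun i =>
    (LoSet.Hom.cases e i).imp_right fun h => h.resolve_left (by rw [he]; exact id)
  have hold : ∀ k, k ∉ d.A → ∀ h, q (e'.emb k) = r (e.emb k) h := fun k hk h =>
    (h1 _ (mt (hA' k).1 hk)).trans (hr₁ k (mt (hA' k).1 hk) h)
  have hmix : ∀ i ∈ e.B, ∀ h k, (R.lt (r i h) (q (e'.emb k)) ∧ q (e'.emb k) ∈ F) ∨
      ∃ h', q (e'.emb k) = r (e.emb k) h' := by
    intro i hi h k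
    by_cases hk : k ∈ d.A
    · obtain ⟨h4, h5⟩ := h2 _ ((hA' k).2 hk)
      exact Or.inl ⟨hr.lt i h (Or.inr hi) _ h4 h5, h4⟩
    · exact Or.inr ⟨mt (hA k).1 hk, hold k hk _⟩
  have hinj : Function.Injective r' := by
    have key : ∀ i ∈ e.B, ∀ k, r' i ≠ r' (e.emb k) := by
      intro i hi k hik
      obtain ⟨h, hi'⟩ := hr'₂ i hi
      rw [hi', hr'₁] at hik
      rcases hmix i hi h k with h4 | ⟨h4, h5⟩
      · exact hr.not_mem i h (Or.inr hi) (hik ▸ h4.2)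
      · rw [h5] at hik
        have := hr.inj _ _ _ _ hik
        exact (LoSet.Hom.emb_not_mem e k).2 (this ▸ hi)
    intro i j hij
    rcases hcases i with ⟨k, rfl⟩ | hi <;> rcases hcases j with ⟨l, rfl⟩ | hj
    · rw [hr'₁, hr'₁] at hij
      rw [e'.emb.injective (hs.inj hij)]
    · exact absurd hij.symm (key j hj k)
    · exact absurd hij (key i hi l)
    · obtain ⟨h, hi'⟩ := hr'₂ i hi
      obtain ⟨h', hj'⟩ := hr'₂ j hj
      rw [hi', hj'] at hij
      exact hr.inj _ _ _ _ hij
  -- The unterminated events after the down-step from `V` are the ones with which the extension on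
  -- `V'` starts.
  have hF : (F ∪ r' '' (d ≫ e).B) \ r' '' (Set.range e.emb)ᶜ = F ∪ q '' (d ≫ e').B := by
    rw [heB, hBe']
    ext x
    constructor
    · rintro ⟨hx | ⟨i, ⟨k, hk, rfl⟩ | hi, rfl⟩, hx'⟩
      · exact Or.inl hx
      · exact Or.inr ⟨_, ⟨k, hk, rfl⟩, (hr'₁ k).symm⟩
      · exact absurd ⟨i, hi, rfl⟩ hx'
    · rintro (hx | ⟨_, ⟨k, hk, rfl⟩, rfl⟩)
      · refine ⟨Or.inl hx, ?_⟩
        rintro ⟨i, hi, rfl⟩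
        obtain ⟨h, hi'⟩ := hr'₂ i hi
        rw [hi'] at hx
        exact hr.not_mem i h (Or.inr hi) hx
      · rw [← hr'₁]
        refine ⟨Or.inr ⟨_, Or.inl ⟨k, hk, rfl⟩, rfl⟩, ?_⟩
        rintro ⟨i, hi, hik⟩
        rw [hinj hik] at hi
        exact (LoSet.Hom.emb_not_mem e k).2 hi
  refine ⟨r', fun i hi => ?_, fun i hi => ?_, hOut _ r' q ?_ ?_ ?_ ?_⟩
  · rcases hcases i with ⟨k, rfl⟩ | hiB
    · rw [hr'₁]
      exact hold k (mt (hA k).2 hi) hi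
    · exact (hr'₂ i hiB).choose_spec
  · rw [hAe] at hi
    obtain ⟨k, hk, rfl⟩ := hi
    rw [hr'₁]
    exact h2 _ ((hA' k).2 hk)
  · refine ⟨hinj, fun i => ?_, fun i => ?_, fun i j h4 h5 h6 => ?_, fun h => h.elim⟩
    · rcases hcases i with ⟨k, rfl⟩ | hi
      · have := hs.mem (e'.emb k)
        rw [← hF, ← hr'₁] at this
        exact this.1
      · exact Or.inr ⟨i, Or.inr hi, rfl⟩
    · rcases hcases i with ⟨k, rfl⟩ | hi
      · rw [hr'₁, hs.lab]
        exact (e'.lab_emb k).trans (e.lab_emb k).symm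
      · obtain ⟨h, hi'⟩ := hr'₂ i hi
        rw [hi', hr.lab]
    · rcases hcases i with ⟨k, rfl⟩ | hi <;> rcases hcases j with ⟨l, rfl⟩ | hj
      · rw [hr'₁, hr'₁] at h4 h5 h6
        exact e.emb.lt_iff_lt.2 (e'.emb.lt_iff_lt.1 (hs.ev _ _ h4 h5 h6))
      · obtain ⟨h, hj'⟩ := hr'₂ j hj
        rw [hr'₁, hj'] at h4 h5 h6
        rcases hmix j hj h k with h7 | ⟨h7, h8⟩
        · exact absurd h7.1 h6
        · rw [h8] at h4 h5 h6
          exact hr.ev _ _ _ _ h4 h5 h6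
      · obtain ⟨h, hi'⟩ := hr'₂ i hi
        rw [hr'₁, hi'] at h4 h5 h6
        rcases hmix i hi h l with h7 | ⟨h7, h8⟩
        · exact absurd h7.1 h5
        · rw [h8] at h4 h5 h6
          exact hr.ev _ _ _ _ h4 h5 h6
      · obtain ⟨h, hi'⟩ := hr'₂ i hi
        obtain ⟨h', hj'⟩ := hr'₂ j hj
        rw [hi', hj'] at h4 h5 h6
        exact hr.ev _ _ _ _ h4 h5 h6
  · intro i hi y hy hyr
    rw [← Set.mem_compl_iff, heB] at hi
    obtain ⟨h, hi'⟩ := hr'₂ i hi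
    rw [hi']
    refine hr.lt i h (Or.inr hi) y (hy.resolve_right ?_) ?_
    · rintro ⟨j, -, hj⟩
      exact hyr ⟨j, hj⟩
    · rintro ⟨w, rfl⟩
      refine hyr ⟨e.emb (d.emb w), ?_⟩
      have hw := (LoSet.Hom.emb_not_mem d w).1
      rw [hr'₁, hold _ hw (mt (hA _).1 hw)]
      exact hr.comp w _
  · rw [hF]
    exact h3
  · exact funext hr'₁

end Extends

/-! ### Cells and paths of the closure -/

section Closure

variable {X : (ILoSet Alph)ᵒᵖ ⥤ Type u}

theorem closure_map_eq {V : ILoSet Alph} {W : LoSet Alph} (z : X.obj (op V)) (d : W ⟶ V.toLoSet)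
    (f : Factor d) : (closurePresheaf X).map d.op (closureCellOf z) =
      (⟨f.mid, X.map f.e.op z, f.d, f.hA, f.hB⟩ : ClosureCell X W) :=
  ClosureCell.face_eq (⟨V, z, 𝟙 V.toLoSet, Set.empty_subset _, Set.empty_subset _⟩ :
      ClosureCell X V.toLoSet) d
    ⟨f.mid, f.e, f.d, f.fac.trans (Category.comp_id d).symm, f.hA, f.hB⟩

/-- The cell `[z; A, B]` is the face of `[z; ∅, ∅]` along its own coface map. In this form further
faces are compositions of coface maps, with no chosen factorisation. -/
theorem closure_repr {W : LoSet Alph} (w : (closurePresheaf X).obj (op W)) :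
    ∃ (V : ILoSet Alph) (z : X.obj (op V)) (d : W ⟶ V.toLoSet), d.A ⊆ V.S ∧ d.B ⊆ V.T ∧
      w = (closurePresheaf X).map d.op (closureCellOf z) := by
  obtain ⟨V, z, d, hA, hB⟩ := w
  refine ⟨V, z, d, hA, hB, ?_⟩
  rw [closure_map_eq z d ⟨V, 𝟙 V, d, Category.comp_id d, hA, hB⟩]
  simp
  rfl

/-- Two faces of cells of `X` agree in the closure only if they come from a common face. -/
theorem exists_common_face {V V' : ILoSet Alph} {W : LoSet Alph} {z : X.obj (op V)}
    {z' : X.obj (op V')} {d : W ⟶ V.toLoSet} {d' : W ⟶ V'.toLoSet}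
    (h : (closurePresheaf X).map d.op (closureCellOf z) =
      (closurePresheaf X).map d'.op (closureCellOf z')) :
    ∃ (M : ILoSet Alph) (e : M ⟶ V) (e' : M ⟶ V') (c : W ⟶ M.toLoSet),
      d = c ≫ (forgetIface Alph).map e ∧ d' = c ≫ (forgetIface Alph).map e' ∧
      X.map e.op z = X.map e'.op z' ∧ e.A = d.A \ V.S ∧ e.B = d.B \ V.T ∧
      e'.A = d'.A \ V'.S ∧ e'.B = d'.B \ V'.T := by
  have key : ∀ (f : Factor d) (f' : Factor d'),
      (⟨f.mid, X.map f.e.op z, f.d, f.hA, f.hB⟩ : ClosureCell X W) =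
        ⟨f'.mid, X.map f'.e.op z', f'.d, f'.hA, f'.hB⟩ →
      ∃ (M : ILoSet Alph) (e : M ⟶ V) (e' : M ⟶ V') (c : W ⟶ M.toLoSet),
        d = c ≫ (forgetIface Alph).map e ∧ d' = c ≫ (forgetIface Alph).map e' ∧
        X.map e.op z = X.map e'.op z' ∧ e.A = d.A \ V.S ∧ e.B = d.B \ V.T ∧
        e'.A = d'.A \ V'.S ∧ e'.B = d'.B \ V'.T := by
    intro f f' h0
    have h1 := f.e_A
    have h2 := f.e_B
    have h3 := f'.e_A
    have h4 := f'.e_B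
    obtain ⟨M, e, c, hc, hA, hB⟩ := f
    obtain ⟨M', e', c', hc', hA', hB'⟩ := f'
    injection h0 with hM hx hd
    subst hM
    obtain rfl := eq_of_heq hd
    exact ⟨M, e, e', c, hc.symm, hc'.symm, eq_of_heq hx, h1, h2, h3, h4⟩
  refine key (factor d) (factor d') ?_
  rw [← closure_map_eq z d (factor d), ← closure_map_eq z' d' (factor d'), h]

/-- The cell `x` generates a cube of `X` that is closed under the up-steps. -/
structure IsFinalCube (x : Cells X) : Prop where
  inj : ∀ {W : ILoSet Alph} (e e' : W ⟶ x.1), X.map e.op x.2 = X.map e'.op x.2 → e = e'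
  closed : ∀ {M V : ILoSet Alph} (e : M ⟶ V) (z : X.obj (op V)) (e' : M ⟶ x.1), e.B = ∅ →
    X.map e.op z = X.map e'.op x.2 → ∃ q : V ⟶ x.1, z = X.map q.op x.2

/-- With one accept cell the accept map starts from a single cube: its injectivity gives `inj`, and
up-closedness applied to a path of one up-step gives `closed`. -/
theorem IHDA.isFinalCube {X : IHDA Alph} (hs : X.AcceptSimple) (hp : X.AcceptProper)
    {x : Cells X.cell} (hx : x ∈ X.accept) : IsFinalCube x := by
  obtain ⟨y, hy⟩ := hs
  have hxy : ∀ c ∈ X.accept, c = x := fun c hc => by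
    rw [hy] at hc hx
    exact hc.trans hx.symm
  constructor
  · intro W e e' h
    have h1 := @hp.1 (op W) ⟨⟨x, hx⟩, e⟩ ⟨⟨x, hx⟩, e'⟩ h
    exact eq_of_heq (Sigma.mk.inj h1).2
  · intro M V e z e' he h
    obtain ⟨⟨⟨c, hc⟩, q⟩, hq⟩ := hp.2 ⟨M, X.cell.map e'.op x.2⟩ ⟨V, z⟩
      ⟨.up (x := ⟨M, X.cell.map e'.op x.2⟩) (y := ⟨V, z⟩) e he h.symm (.nil _)⟩
      ⟨⟨⟨x, hx⟩, e'⟩, rfl⟩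
    obtain rfl := hxy c hc
    exact ⟨q, hq.symm⟩

theorem IsFinalCube.closure_inj {x : Cells X} (h : IsFinalCube x) {W : LoSet Alph}
    {d d' : W ⟶ x.1.toLoSet} (hd : (closurePresheaf X).map d.op (closureCellOf x.2) =
      (closurePresheaf X).map d'.op (closureCellOf x.2)) : d = d' := by
  obtain ⟨M, e, e', c, rfl, rfl, he, -⟩ := exists_common_face hd
  rw [h.inj e e' he]

/-- Write the upper cell as `[z; A, B]`. Comparing its face with a face of `x` shows that `z` has a
lower face in the cube of `x`, so `z` itself lies in this cube, and with it the upper cell. -/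
theorem IsFinalCube.closure_closed {x : Cells X} (h : IsFinalCube x) {W W' : LoSet Alph}
    (g : W ⟶ W') (hg : g.B = ∅) (w : (closurePresheaf X).obj (op W')) (d : W ⟶ x.1.toLoSet)
    (hd : (closurePresheaf X).map g.op w = (closurePresheaf X).map d.op (closureCellOf x.2)) :
    ∃ d' : W' ⟶ x.1.toLoSet, w = (closurePresheaf X).map d'.op (closureCellOf x.2) := by
  obtain ⟨V, z, c, hA, hB, rfl⟩ := closure_repr w
  rw [← Functor.map_comp_apply, ← op_comp] at hd
  obtain ⟨M, e, e', b, -, -, he, -, heB, -, -⟩ := exists_common_face hd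
  -- The common face terminates no event of `V`: `g` terminates nothing, and what `c` terminates
  -- lies in the target interface.
  obtain ⟨q, rfl⟩ := h.closed e z e' (by
    rw [heB, Set.sdiff_eq_empty]
    rintro i (⟨k, hk, rfl⟩ | hi)
    · rw [hg] at hk
      exact hk.elim
    · exact hB hi) he
  refine ⟨c ≫ (forgetIface Alph).map q, ?_⟩
  rw [closure_map_eq _ c ⟨V, 𝟙 V, c, Category.comp_id c, hA, hB⟩,
    closure_map_eq _ (c ≫ (forgetIface Alph).map q) ⟨V, q, c, rfl, hA, hB⟩]
  simp
  rfl

/-- There is a path in `X` from `z` to `y`, tracked by `R` from the stage `(F, r)` to a stage that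
satisfies `K`. -/
def ReachesStage (R : Iposet Alph) (y : Cells X)
    (K : Set R.carrier → (Fin y.1.len → R.carrier) → Prop) {V : ILoSet Alph} (z : X.obj (op V))
    (F : Set R.carrier) (r : Fin V.len → R.carrier) : Prop :=
  ∃ (q : Path (forgetIface Alph) X ⟨V, z⟩ y) (F' : Set R.carrier) (s' : Fin y.1.len → R.carrier),
    Tracks (forgetIface Alph) R False q F r F' s' ∧ K F' s'

/-- As `e` leaves nothing unstarted and `e'` terminates nothing, `z` goes down to the common face
and then up to `z'`; these two steps of `X` are put in front of the lifted path. -/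
theorem ExtendsTo.reaches_of_common_face {R : Iposet Alph} {y : Cells X}
    {K : Set R.carrier → (Fin y.1.len → R.carrier) → Prop} {W : LoSet Alph} {M V V' : ILoSet Alph}
    {z : X.obj (op V)} {z' : X.obj (op V')} {e : M ⟶ V} {e' : M ⟶ V'} {c : W ⟶ M.toLoSet}
    {F : Set R.carrier} {s : Fin W.len → R.carrier} (he : e.A = ∅) (he' : e'.B = ∅)
    (hz : X.map e.op z = X.map e'.op z')
    (h : ExtendsTo R (c ≫ (forgetIface Alph).map e') F s (ReachesStage R y K z')) :
    ExtendsTo R (c ≫ (forgetIface Alph).map e) F s (ReachesStage R y K z) := by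
  refine h.of_common_face he he' (fun F r ⟨q, F', s', hq, _⟩ => hq.stage) ?_
  rintro F r r' hr hlt ⟨q, F', s', hq, hK⟩ hrr
  refine ⟨.down (x := ⟨V, z⟩) (y := ⟨M, X.map e.op z⟩) e he rfl
    (.up (x := ⟨M, X.map e.op z⟩) (y := ⟨V', z'⟩) e' he' hz q), F', s', ⟨hr, hlt, ?_⟩, hK⟩
  refine ⟨hr.comp ((forgetIface Alph).map e) fun i => ⟨hr.mem _, ?_⟩, r', hrr, hq⟩
  rintro ⟨j, hj, hij⟩
  exact hj ⟨i, (hr.inj hij).symm⟩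

/-- Paths through the closure of `X` up to an exit lift to paths in `X`, where events are started as
early and terminated as late as possible. -/
theorem extendsTo_of_tracks {Z : (LoSet Alph)ᵒᵖ ⥤ Type u}
    (j : CellMap (𝟭 (LoSet Alph)) (closurePresheaf X) Z) {R : Iposet Alph} {t : Cells Z}
    {F' : Set R.carrier} {s' : Fin t.1.len → R.carrier} {y : Cells X}
    {K : Set R.carrier → (Fin y.1.len → R.carrier) → Prop}
    (E : ∀ {x : Cells Z}, Path (𝟭 (LoSet Alph)) Z x t → Prop)
    (hexit : ∀ {x : Cells Z} (α : Path (𝟭 (LoSet Alph)) Z x t) {V : ILoSet Alph} (z : X.obj (op V))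
      (d : x.1 ⟶ V.toLoSet), d.A ⊆ V.S →
      x.2 = j.app x.1 ((closurePresheaf X).map d.op (closureCellOf z)) → E α →
      ∀ F s, Tracks (𝟭 (LoSet Alph)) R False α F s F' s' →
      ExtendsTo R d F s (ReachesStage R y K z))
    (hnil : E (.nil t))
    (hup : ∀ {x x' : Cells Z} (g : x.1 ⟶ x'.1) (hg : g.B = ∅) (hx : x.2 = Z.map g.op x'.2)
      (α : Path (𝟭 (LoSet Alph)) Z x' t) (w : (closurePresheaf X).obj (op x.1)),
      x.2 = j.app x.1 w → ¬ E (.up g hg hx α) →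
      ∃ w' : (closurePresheaf X).obj (op x'.1), w = (closurePresheaf X).map g.op w' ∧
        x'.2 = j.app x'.1 w')
    {x : Cells Z} (α : Path (𝟭 (LoSet Alph)) Z x t) {V : ILoSet Alph} (z : X.obj (op V))
    (d : x.1 ⟶ V.toLoSet) (hA : d.A ⊆ V.S)
    (hx : x.2 = j.app x.1 ((closurePresheaf X).map d.op (closureCellOf z)))
    (F : Set R.carrier) (s : Fin x.1.len → R.carrier)
    (ht : Tracks (𝟭 (LoSet Alph)) R False α F s F' s') :
    ExtendsTo R d F s (ReachesStage R y K z) := by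
  induction α generalizing V F with
  | nil x => exact hexit _ z d hA hx hnil F s ht
  | @up x x' t g hg hxx α ih =>
    by_cases hE : E (.up g hg hxx α)
    · exact hexit _ z d hA hx hE F s ht
    obtain ⟨w', hw, hx'⟩ := hup g hg hxx α _ hx hE
    obtain ⟨V', z', d', hA', hB', rfl⟩ := closure_repr w'
    obtain ⟨-, s₁, rfl, ht'⟩ := ht
    have h := ih E hexit hnil hup z' d' hA' hx' F s₁ ht'
    have h : ExtendsTo R (g ≫ d') F (s₁ ∘ g.emb) (ReachesStage R y K z') := h.of_up hg ht'.stage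
    rw [← Functor.map_comp_apply, ← op_comp] at hw
    -- The lower cell is represented both by `z` and by `z'`. Discarding interface events from both
    -- representations leaves a down-step from `z` to the common face and an up-step to `z'`.
    obtain ⟨M, e, e', c, rfl, hc, he, heA, -, -, heB⟩ := exists_common_face hw
    rw [hc] at h
    refine h.reaches_of_common_face ?_ ?_ he
    · rw [heA, Set.sdiff_eq_empty]
      exact hA
    · rw [heB, Set.sdiff_eq_empty]
      rintro i (⟨k, hk, rfl⟩ | hi)
      · exact (hg.subset hk).elim
      · exact hB' hi
  | @down x x' t D hD hxx α ih =>
    by_cases hE : E (.down D hD hxx α)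
    · exact hexit _ z d hA hx hE F s ht
    obtain ⟨hs, hlt, ht'⟩ := ht
    refine ExtendsTo.of_down hD hs hlt (ih E hexit hnil hup z (D ≫ d) ?_ ?_ _ _ ht')
    · rintro i (⟨k, hk, rfl⟩ | hi)
      · exact (hD.subset hk).elim
      · exact hA hi
    · rw [hxx, hx, op_comp, Functor.map_comp_apply]
      exact (j.naturality D _).symm

end Closure

/-! ### Maps into the sequential composition -/

/-- The composition of maps. -/
def CellMap.comp {C : Type u} [SmallCategory C] {G : C ⥤ LoSet Alph} {X : Cᵒᵖ ⥤ Type u}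
    {Y Z : (LoSet Alph)ᵒᵖ ⥤ Type u} (h : CellMap G X Y) (j : CellMap (𝟭 (LoSet Alph)) Y Z) :
    CellMap G X Z where
  app U x := j.app _ (h.app U x)
  naturality d x := by rw [h.naturality]; exact j.naturality _ _

/-- The inclusion of an ipc-set in its closure. -/
noncomputable def closureMap (X : (ILoSet Alph)ᵒᵖ ⥤ Type u) :
    CellMap (forgetIface Alph) X (closurePresheaf X) where
  app _ x := closureCellOf x
  naturality {U _} d x := (closure_map_eq x ((forgetIface Alph).map d)
    ⟨U, d, 𝟙 _, Category.id_comp _, Set.empty_subset _, Set.empty_subset _⟩).symm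

section Glue
variable {C : Type u} [SmallCategory C] 

theorem seqGluing_sound {n : ℕ} {X : Fin (n + 1) → Cᵒᵖ ⥤ Type u} {U : Fin n → C}
    (x : ∀ k, (X k.castSucc).obj (op (U k))) (y : ∀ k, (X k.succ).obj (op (U k)))
    (k : Fin n) {W : C} (d : W ⟶ U k) :
    GlueStep X (fun k => yoneda.obj (U k)) (fun k => yonedaEquiv.symm (y k))
      (fun k => yonedaEquiv.symm (x k)) (op W) ⟨k.castSucc, (X k.castSucc).map d.op (x k)⟩
      ⟨k.succ, (X k.succ).map d.op (y k)⟩ :=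
  GlueStep.mk (Y := fun k => yoneda.obj (U k)) (W := op W) k d

theorem GlueStep.succ {n : ℕ} {X : Fin (n + 1 + 1) → Cᵒᵖ ⥤ Type u} {Y : Fin (n + 1) → Cᵒᵖ ⥤ Type u}
    {f : ∀ k, Y k ⟶ X k.succ} {g : ∀ k, Y k ⟶ X k.castSucc} {W : Cᵒᵖ}
    {a b : Σ k : Fin (n + 1), (X k.succ).obj W}
    (h : GlueStep (fun k => X k.succ) (fun k => Y k.succ) (fun k => f k.succ) (fun k => g k.succ)
      W a b) : GlueStep X Y f g W ⟨a.1.succ, a.2⟩ ⟨b.1.succ, b.2⟩ := by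
  obtain ⟨k, y⟩ := h
  exact GlueStep.mk k.succ y

end Glue

section SeqComp

variable {n : ℕ} (X : Fin (n + 1) → IHDA Alph) (U : Fin n → LoSet Alph)
  (S T : ∀ k, Set (Fin (U k).len))
  (xacc : ∀ k : Fin n, (X k.castSucc).cell.obj (op ⟨U k, S k, Set.univ⟩))
  (xst : ∀ k : Fin n, (X k.succ).cell.obj (op ⟨U k, Set.univ, T k⟩))

/-- The structural maps of the sequential composition. -/
noncomputable def seqIncl (k : Fin (n + 1)) :
    CellMap (𝟭 (LoSet Alph)) (closurePresheaf (X k).cell) (seqComp X U S T xacc xst).cell where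
  app _ w := Quot.mk _ ⟨k, w⟩
  naturality _ _ := rfl

/-- The map from the first automaton. -/
noncomputable abbrev headMap :
    CellMap (forgetIface Alph) (X 0).cell (seqComp X U S T xacc xst).cell :=
  (closureMap _).comp (seqIncl X U S T xacc xst 0)

theorem seqIncl_glue (k : Fin n) {W : LoSet Alph} (d : W ⟶ U k) :
    (seqIncl X U S T xacc xst k.castSucc).app W
        ((closurePresheaf (X k.castSucc).cell).map d.op (closureCellOf (xacc k))) =
      (seqIncl X U S T xacc xst k.succ).app W
        ((closurePresheaf (X k.succ).cell).map d.op (closureCellOf (xst k))) :=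
  Quot.sound (seqGluing_sound (X := fun k => (X k).closure.cell) (U := U)
    (fun k => closureCellOf (xacc k)) (fun k => closureCellOf (xst k)) k d)

end SeqComp

/-! ### The composition of a single automaton -/

section Single

theorem eq_of_glueStep_zero {C : Type u} [SmallCategory C] {X : Fin (0 + 1) → Cᵒᵖ ⥤ Type u}
    {Y : Fin 0 → Cᵒᵖ ⥤ Type u} {f : ∀ k : Fin 0, Y k ⟶ X k.succ}
    {g : ∀ k : Fin 0, Y k ⟶ X k.castSucc} {W : Cᵒᵖ} {a b : Σ k, (X k).obj W}
    (h : Relation.EqvGen (GlueStep X Y f g W) a b) : a = b := by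
  induction h with
  | rel _ _ h => obtain ⟨k, -⟩ := h; exact k.elim0
  | refl => rfl
  | symm _ _ _ h => exact h.symm
  | trans _ _ _ _ _ h h' => exact h.trans h'

variable (X : Fin (0 + 1) → IHDA Alph) (U : Fin 0 → LoSet Alph)
  (S T : ∀ k, Set (Fin (U k).len))
  (xacc : ∀ k : Fin 0, (X k.castSucc).cell.obj (op ⟨U k, S k, Set.univ⟩))
  (xst : ∀ k : Fin 0, (X k.succ).cell.obj (op ⟨U k, Set.univ, T k⟩))

theorem seqIncl_single_injective (W : LoSet Alph) :
    Function.Injective ((seqIncl X U S T xacc xst 0).app W) := by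
  intro w w' h
  exact eq_of_heq (Sigma.mk.inj (eq_of_glueStep_zero (Quot.eqvGen_exact h))).2

theorem seqIncl_single_surjective (W : LoSet Alph) :
    Function.Surjective ((seqIncl X U S T xacc xst 0).app W) := by
  rintro ⟨⟨k, w⟩⟩
  obtain rfl : k = 0 := Fin.eq_zero k
  exact ⟨w, rfl⟩

end Single

/-! ### The composition as a gluing of the first closure and the tail -/

section Tail

variable {n : ℕ} (X : Fin (n + 1 + 1) → IHDA Alph) (U : Fin (n + 1) → LoSet Alph)
  (S T : ∀ k, Set (Fin (U k).len))
  (xacc : ∀ k : Fin (n + 1), (X k.castSucc).cell.obj (op ⟨U k, S k, Set.univ⟩))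
  (xst : ∀ k : Fin (n + 1), (X k.succ).cell.obj (op ⟨U k, Set.univ, T k⟩))

/-- The sequential composition of all automata but the first one. -/
noncomputable abbrev tailComp : HDA Alph :=
  seqComp (fun k => X k.succ) (fun k => U k.succ) (fun k => S k.succ) (fun k => T k.succ)
    (fun k => xacc k.succ) (fun k => xst k.succ)

/-- The map from the sequential composition of all automata but the first one. -/
noncomputable def tailMap : CellMap (𝟭 (LoSet Alph)) (tailComp X U S T xacc xst).cell
    (seqComp X U S T xacc xst).cell where
  app W := Quot.map (fun p => ⟨p.1.succ, p.2⟩)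
    fun _ _ h => GlueStep.succ (X := fun k => (X k).closure.cell) (Y := fun k => yoneda.obj (U k))
      (f := fun k => yonedaEquiv.symm (closureCellOf (xst k)))
      (g := fun k => yonedaEquiv.symm (closureCellOf (xacc k))) (W := op W) h
  naturality d x := by
    induction x using Quot.ind
    rfl

/-- The first structural map of the tail. -/
noncomputable abbrev tailIncl :
    CellMap (𝟭 (LoSet Alph)) (closurePresheaf (X (Fin.succ 0)).cell)
      (tailComp X U S T xacc xst).cell :=
  seqIncl (fun k => X k.succ) (fun k => U k.succ) (fun k => S k.succ) (fun k => T k.succ)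
    (fun k => xacc k.succ) (fun k => xst k.succ) 0

/-- The accept cell of the first automaton. -/
abbrev headAcc : Cells (X 0).cell := ⟨⟨U 0, S 0, Set.univ⟩, xacc 0⟩

theorem seqIncl_headAcc {W : LoSet Alph} (d : W ⟶ U 0) :
    (seqIncl X U S T xacc xst 0).app W
        ((closurePresheaf (X 0).cell).map d.op (closureCellOf (headAcc X U S xacc).2)) =
      (tailMap X U S T xacc xst).app W ((tailIncl X U S T xacc xst).app W
        ((closurePresheaf (X (Fin.succ 0)).cell).map d.op (closureCellOf (xst 0)))) :=
  seqIncl_glue X U S T xacc xst 0 d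

theorem seqComp_cases {W : LoSet Alph} (z : (seqComp X U S T xacc xst).cell.obj (op W)) :
    (∃ w, z = (seqIncl X U S T xacc xst 0).app W w) ∨
      ∃ c, z = (tailMap X U S T xacc xst).app W c := by
  obtain ⟨⟨k, w⟩⟩ := z
  induction k using Fin.cases with
  | zero => exact Or.inl ⟨w, rfl⟩
  | succ k => exact Or.inr ⟨Quot.mk _ ⟨k, w⟩, rfl⟩

open Classical in
/-- The cell of the tail identified with a cell of the closure of the first automaton, or this cell
itself if it is not a face of the accept cell. -/
noncomputable def headNormalForm {W : LoSet Alph} (w : (closurePresheaf (X 0).cell).obj (op W)) :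
    (closurePresheaf (X 0).cell).obj (op W) ⊕ (tailComp X U S T xacc xst).cell.obj (op W) :=
  if h : ∃ d : W ⟶ U 0,
      w = (closurePresheaf (X 0).cell).map d.op (closureCellOf (headAcc X U S xacc).2) then
    Sum.inr ((tailIncl X U S T xacc xst).app W
      ((closurePresheaf (X (Fin.succ 0)).cell).map h.choose.op (closureCellOf (xst 0))))
  else Sum.inl w

variable {X U S T xacc xst}
variable (h0 : IsFinalCube (headAcc X U S xacc))

include h0

/-- Because the cube of the accept cell embeds in the closure, the chosen coface map has to be `d`.
-/
theorem headNormalForm_acc {W : LoSet Alph} (d : W ⟶ U 0) :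
    headNormalForm X U S T xacc xst
        ((closurePresheaf (X 0).cell).map d.op (closureCellOf (headAcc X U S xacc).2)) =
      Sum.inr ((tailIncl X U S T xacc xst).app W
        ((closurePresheaf (X (Fin.succ 0)).cell).map d.op (closureCellOf (xst 0)))) := by
  have h : ∃ d' : W ⟶ U 0, (closurePresheaf (X 0).cell).map d.op
      (closureCellOf (headAcc X U S xacc).2) =
      (closurePresheaf (X 0).cell).map d'.op (closureCellOf (headAcc X U S xacc).2) := ⟨d, rfl⟩
  rw [headNormalForm, dif_pos h, ← h0.closure_inj h.choose_spec]

/-- A normal form decides equality in the quotient: a cell is recorded in the tail whenever it can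
be, and in the first closure otherwise. The facts on overlaps and injectivity below are read off
from it. -/
theorem exists_normalForm (W : LoSet Alph) :
    ∃ nf : (seqComp X U S T xacc xst).cell.obj (op W) →
        (closurePresheaf (X 0).cell).obj (op W) ⊕ (tailComp X U S T xacc xst).cell.obj (op W),
      (∀ w, nf ((seqIncl X U S T xacc xst 0).app W w) = headNormalForm X U S T xacc xst w) ∧
      ∀ c, nf ((tailMap X U S T xacc xst).app W c) = Sum.inr c := by
  -- Compatibility with the first gluing is `headNormalForm_acc`; all later gluings already hold in
  -- the tail.
  refine ⟨Quot.lift (fun p => Fin.cases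
      (motive := fun k => (closurePresheaf (X k).cell).obj (op W) →
        (closurePresheaf (X 0).cell).obj (op W) ⊕ (tailComp X U S T xacc xst).cell.obj (op W))
      (fun w => headNormalForm X U S T xacc xst w) (fun k w => Sum.inr (Quot.mk _ ⟨k, w⟩))
      p.1 p.2) ?_, fun _ => rfl, ?_⟩
  · rintro _ _ ⟨k, d⟩
    induction k using Fin.cases with
    | zero => exact headNormalForm_acc h0 d
    | succ k =>
      exact congrArg Sum.inr (seqIncl_glue (fun k => X k.succ) (fun k => U k.succ)
        (fun k => S k.succ) (fun k => T k.succ) (fun k => xacc k.succ) (fun k => xst k.succ) k d)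
  · rintro ⟨c⟩
    rfl

theorem tailMap_injective (W : LoSet Alph) :
    Function.Injective ((tailMap X U S T xacc xst).app W) := by
  intro c c' h
  obtain ⟨nf, -, hnf⟩ := exists_normalForm (T := T) (xst := xst) h0 W
  have := congrArg nf h
  rw [hnf, hnf] at this
  exact Sum.inr_injective this

theorem exists_of_seqIncl_eq_tailMap {W : LoSet Alph}
    {w : (closurePresheaf (X 0).cell).obj (op W)} {c : (tailComp X U S T xacc xst).cell.obj (op W)}
    (h : (seqIncl X U S T xacc xst 0).app W w = (tailMap X U S T xacc xst).app W c) :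
    ∃ d : W ⟶ U 0,
      w = (closurePresheaf (X 0).cell).map d.op (closureCellOf (headAcc X U S xacc).2) ∧
      c = (tailIncl X U S T xacc xst).app W
        ((closurePresheaf (X (Fin.succ 0)).cell).map d.op (closureCellOf (xst 0))) := by
  obtain ⟨nf, hnf, hnf'⟩ := exists_normalForm (T := T) (xst := xst) h0 W
  have h := congrArg nf h
  rw [hnf, hnf'] at h
  by_cases hw : ∃ d : W ⟶ U 0,
      w = (closurePresheaf (X 0).cell).map d.op (closureCellOf (headAcc X U S xacc).2)
  · obtain ⟨d, rfl⟩ := hw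
    rw [headNormalForm_acc h0 d] at h
    exact ⟨d, rfl, (Sum.inr_injective h).symm⟩
  · rw [headNormalForm, dif_neg hw] at h
    cases h

/-- A cell that is not a face of the accept cell is its own normal form, so identifications within
the first closure occur only for cells that also lie in the tail. -/
theorem seqIncl_injective_or {W : LoSet Alph} {w w' : (closurePresheaf (X 0).cell).obj (op W)}
    (h : (seqIncl X U S T xacc xst 0).app W w = (seqIncl X U S T xacc xst 0).app W w') :
    w = w' ∨ ∃ c, (seqIncl X U S T xacc xst 0).app W w = (tailMap X U S T xacc xst).app W c := by
  obtain ⟨nf, hnf, -⟩ := exists_normalForm (T := T) (xst := xst) h0 W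
  have h' := congrArg nf h
  rw [hnf, hnf] at h'
  by_cases hw : ∃ d : W ⟶ U 0,
      w = (closurePresheaf (X 0).cell).map d.op (closureCellOf (headAcc X U S xacc).2)
  · obtain ⟨d, rfl⟩ := hw
    exact Or.inr ⟨_, seqIncl_headAcc X U S T xacc xst d⟩
  by_cases hw' : ∃ d : W ⟶ U 0,
      w' = (closurePresheaf (X 0).cell).map d.op (closureCellOf (headAcc X U S xacc).2)
  · obtain ⟨d, rfl⟩ := hw'
    exact Or.inr ⟨_, h.trans (seqIncl_headAcc X U S T xacc xst d)⟩
  rw [headNormalForm, dif_neg hw, headNormalForm, dif_neg hw'] at h'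
  exact Or.inl (Sum.inl_injective h')

/-- Paths that start in the tail stay there. -/
theorem exists_tail_path {x t : Cells (seqComp X U S T xacc xst).cell}
    (α : Path (𝟭 (LoSet Alph)) (seqComp X U S T xacc xst).cell x t)
    (c : (tailComp X U S T xacc xst).cell.obj (op x.1))
    (hc : x.2 = (tailMap X U S T xacc xst).app x.1 c) :
    ∃ c' : (tailComp X U S T xacc xst).cell.obj (op t.1),
      t.2 = (tailMap X U S T xacc xst).app t.1 c' ∧
      ∃ p : Path (𝟭 (LoSet Alph)) (tailComp X U S T xacc xst).cell ⟨x.1, c⟩ ⟨t.1, c'⟩,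
        ∀ (R : Iposet Alph) (F F' : Set R.carrier) (s : Fin x.1.len → R.carrier)
          (s' : Fin t.1.len → R.carrier), Tracks (𝟭 (LoSet Alph)) R False α F s F' s' →
          Tracks (𝟭 (LoSet Alph)) R False p F s F' s' := by
  induction α with
  | nil x => exact ⟨c, hc, .nil _, fun _ _ _ _ _ h => h⟩
  | @up x x' t g hg hx α ih =>
    -- If the upper cell comes from the first closure, its lower face is a face of the accept cell;
    -- by closedness under up-steps so is the upper cell, which therefore lies in the tail.
    obtain ⟨c₁, hc₁⟩ : ∃ c₁, x'.2 = (tailMap X U S T xacc xst).app x'.1 c₁ := by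
      rcases seqComp_cases X U S T xacc xst x'.2 with ⟨w, hw⟩ | h
      · have h := (seqIncl X U S T xacc xst 0).naturality g w
        rw [← hw] at h
        obtain ⟨d, hd, -⟩ := exists_of_seqIncl_eq_tailMap h0 ((h.trans hx.symm).trans hc)
        obtain ⟨d', rfl⟩ := h0.closure_closed g hg w d hd
        exact ⟨_, hw.trans (seqIncl_headAcc X U S T xacc xst d')⟩
      · exact h
    obtain ⟨c', hc', p, hp⟩ := ih c₁ hc₁
    have hcg : c = (tailComp X U S T xacc xst).cell.map g.op c₁ := by
      apply tailMap_injective h0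
      rw [← hc, hx, hc₁]
      exact ((tailMap X U S T xacc xst).naturality g c₁).symm
    exact ⟨c', hc', .up (x := ⟨x.1, c⟩) (y := ⟨x'.1, c₁⟩) g hg hcg p,
      fun R F F' s s' ⟨h, s₁, hs, ht⟩ => ⟨h, s₁, hs, hp R _ _ _ _ ht⟩⟩
  | @down x x' t g hg hx α ih =>
    obtain ⟨c', hc', p, hp⟩ := ih ((tailComp X U S T xacc xst).cell.map g.op c) (by
      rw [hx, hc]
      exact ((tailMap X U S T xacc xst).naturality g c).symm)
    exact ⟨c', hc', .down (x := ⟨x.1, c⟩)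
      (y := ⟨x'.1, (tailComp X U S T xacc xst).cell.map g.op c⟩) g hg rfl p,
      fun R F F' s s' ⟨h, hlt, ht⟩ => ⟨h, hlt, hp R _ _ _ _ ht⟩⟩

end Tail

/-! ### Paths of the sequential composition -/

section Extends

variable {R : Iposet Alph} {W V : LoSet Alph} {F : Set R.carrier}

theorem ExtendsTo.mono {Out Out' : Set R.carrier → (Fin V.len → R.carrier) → Prop} {d : W ⟶ V}
    {s : Fin W.len → R.carrier} (h : ExtendsTo R d F s Out)
    (hO : ∀ F r, Out F r → Out' F r) : ExtendsTo R d F s Out' := fun r hr =>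
  let ⟨r', h1, h2, h3⟩ := h r hr
  ⟨r', h1, h2, hO _ _ h3⟩

theorem extendsTo_id {Out : Set R.carrier → (Fin V.len → R.carrier) → Prop}
    {s : Fin V.len → R.carrier} (h : Out F s) : ExtendsTo R (𝟙 V) F s Out := by
  refine fun r hr => ⟨s, fun i hi => (hr.comp i hi).symm, fun _ hi => hi.elim, ?_⟩
  have hF : F ∪ s '' (𝟙 V : V ⟶ V).B = F := by
    rw [show (𝟙 V : V ⟶ V).B = ∅ from rfl, Set.image_empty, Set.union_empty]
  rwa [hF]

theorem ExtendsTo.of_id {Out : Set R.carrier → (Fin V.len → R.carrier) → Prop}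
    {s : Fin V.len → R.carrier} (h : ExtendsTo R (𝟙 V) F s Out) (hs : R.IsStage False V F s) :
    Out F s := by
  obtain ⟨r', h1, -, h3⟩ := h (fun i _ => s i)
    { comp := fun _ _ => rfl
      inj := fun i j _ _ h => hs.inj h
      lab := fun i _ => hs.lab i
      ev := fun i j _ _ => hs.ev i j
      not_mem := fun i _ hi => hi.elim
      lt := fun i _ hi => hi.elim }
  obtain rfl : r' = s := funext fun i => h1 i fun hi => hi.elim
  rwa [show (𝟙 V : V ⟶ V).B = ∅ from rfl, Set.image_empty, Set.union_empty] at h3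

end Extends

/-- Paths of length zero. -/
def Path.IsNil {C : Type u} [SmallCategory C] {G : C ⥤ LoSet Alph} {X : Cᵒᵖ ⥤ Type u} :
    {x y : Cells X} → Path G X x y → Prop
  | _, _, .nil _ => True
  | _, _, .up .. => False
  | _, _, .down .. => False

theorem Path.isNil_nil {C : Type u} [SmallCategory C] {G : C ⥤ LoSet Alph} {X : Cᵒᵖ ⥤ Type u}
    (x : Cells X) : (Path.nil (G := G) x).IsNil := trivial

/-- Paths in the closure that end in a cell `[y; ∅, ∅]` lift to `X`. -/
theorem extendsTo_of_closed_path {X : (ILoSet Alph)ᵒᵖ ⥤ Type u} {Z : (LoSet Alph)ᵒᵖ ⥤ Type u}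
    (j : CellMap (𝟭 (LoSet Alph)) (closurePresheaf X) Z)
    (hj : ∀ W, Function.Injective (j.app W)) (hj' : ∀ W, Function.Surjective (j.app W))
    {R : Iposet Alph} {y : Cells X} {x : Cells Z}
    (α : Path (𝟭 (LoSet Alph)) Z x (((closureMap X).comp j).cell y))
    {V : ILoSet Alph} (z : X.obj (op V)) (d : x.1 ⟶ V.toLoSet) (hA : d.A ⊆ V.S)
    (hx : x.2 = j.app x.1 ((closurePresheaf X).map d.op (closureCellOf z)))
    (F F' : Set R.carrier) (s : Fin x.1.len → R.carrier) (s' : Fin y.1.len → R.carrier)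
    (ht : Tracks (𝟭 (LoSet Alph)) R False α F s F' s') :
    ExtendsTo R d F s (ReachesStage R y (fun Fm sm => Fm = F' ∧ sm = s') z) := by
  refine extendsTo_of_tracks j Path.IsNil ?_ (Path.isNil_nil _) ?_ α z d hA hx F s ht
  · intro x α V z d hA hx hα F s ht
    cases α with
    | up => exact hα.elim
    | down => exact hα.elim
    | nil =>
      obtain ⟨hs, rfl, rfl⟩ := ht
      have h : (closurePresheaf X).map d.op (closureCellOf z) =
          (closurePresheaf X).map (𝟙 y.1.toLoSet).op (closureCellOf y.2) := by
        refine hj _ (hx.symm.trans ?_)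
        rw [op_id, Functor.map_id_apply]
        rfl
      obtain ⟨M, e, e', c, rfl, hc, he, heA, -, -, heB⟩ := exists_common_face h
      refine ExtendsTo.reaches_of_common_face (z' := y.2) ?_ ?_ he ?_
      · rw [heA, Set.sdiff_eq_empty]
        exact hA
      · rw [heB, Set.sdiff_eq_empty]
        exact Set.empty_subset _
      · rw [← hc]
        exact extendsTo_id ⟨.nil _, _, _, ⟨hs, rfl, rfl⟩, rfl, rfl⟩
  · intro x x' g hg hx α w hw _
    obtain ⟨w', hw'⟩ := hj' _ x'.2
    refine ⟨w', hj _ ?_, hw'.symm⟩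
    rw [← hw, hx, ← hw']
    exact (j.naturality g w').symm

theorem exists_path_of_eq {Z : (LoSet Alph)ᵒᵖ ⥤ Type u} {R : Iposet Alph} {V : LoSet Alph}
    {a b : Z.obj (op V)} (hab : a = b) {t : Cells Z} {F F' : Set R.carrier}
    {s : Fin V.len → R.carrier} {s' : Fin t.1.len → R.carrier}
    (p : Path (𝟭 (LoSet Alph)) Z ⟨V, b⟩ t) (hp : Tracks (𝟭 (LoSet Alph)) R False p F s F' s') :
    ∃ p : Path (𝟭 (LoSet Alph)) Z ⟨V, a⟩ t, Tracks (𝟭 (LoSet Alph)) R False p F s F' s' := by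
  subst hab
  exact ⟨p, hp⟩

/-- There is a path from the cell `z` to `t`, tracked by `R` from a given stage to `(F', s')`. -/
def TracksFrom {Z : (LoSet Alph)ᵒᵖ ⥤ Type u} (R : Iposet Alph) {V : LoSet Alph}
    (z : Z.obj (op V)) (t : Cells Z) (F' : Set R.carrier) (s' : Fin t.1.len → R.carrier)
    (F : Set R.carrier) (s : Fin V.len → R.carrier) : Prop :=
  ∃ p : Path (𝟭 (LoSet Alph)) Z ⟨V, z⟩ t, Tracks (𝟭 (LoSet Alph)) R False p F s F' s'

section Tail

variable {n : ℕ} {X : Fin (n + 1 + 1) → IHDA Alph} {U : Fin (n + 1) → LoSet Alph}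
  {S T : ∀ k, Set (Fin (U k).len)}
  {xacc : ∀ k : Fin (n + 1), (X k.castSucc).cell.obj (op ⟨U k, S k, Set.univ⟩)}
  {xst : ∀ k : Fin (n + 1), (X k.succ).cell.obj (op ⟨U k, Set.univ, T k⟩)}

theorem exists_tail_accept {t : Cells (seqComp X U S T xacc xst).cell}
    (ht : t ∈ (seqComp X U S T xacc xst).accept) :
    ∃ t' ∈ (tailComp X U S T xacc xst).accept, t = (tailMap X U S T xacc xst).cell t' := by
  obtain ⟨x, hx, rfl⟩ := ht
  exact ⟨_, ⟨x, hx, rfl⟩, rfl⟩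

theorem tailMap_accept {t : Cells (tailComp X U S T xacc xst).cell}
    (ht : t ∈ (tailComp X U S T xacc xst).accept) :
    (tailMap X U S T xacc xst).cell t ∈ (seqComp X U S T xacc xst).accept := by
  obtain ⟨x, hx, rfl⟩ := ht
  exact ⟨x, hx, rfl⟩

/-- Paths from the first automaton to an accept cell lift to a path in the first automaton followed
by a path in the tail, provided that paths in the tail lift. -/
theorem extendsTo_head (h0 : IsFinalCube (headAcc X U S xacc)) {R : Iposet Alph}
    {t : Cells (tailComp X U S T xacc xst).cell} {F' : Set R.carrier} {s' : Fin t.1.len → R.carrier}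
    (htail : ∀ {x : Cells (tailComp X U S T xacc xst).cell}
      (p : Path (𝟭 (LoSet Alph)) (tailComp X U S T xacc xst).cell x t) {V : ILoSet Alph}
      (z : (X (Fin.succ 0)).cell.obj (op V)) (d : x.1 ⟶ V.toLoSet), d.A ⊆ V.S →
      x.2 = (tailIncl X U S T xacc xst).app x.1 ((closurePresheaf _).map d.op (closureCellOf z)) →
      ∀ (F : Set R.carrier) (s : Fin x.1.len → R.carrier),
      Tracks (𝟭 (LoSet Alph)) R False p F s F' s' →
      ExtendsTo R d F s (TracksFrom R ((tailIncl X U S T xacc xst).app _ (closureCellOf z)) t F' s'))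
    {x : Cells (seqComp X U S T xacc xst).cell}
    (α : Path (𝟭 (LoSet Alph)) (seqComp X U S T xacc xst).cell x
      ((tailMap X U S T xacc xst).cell t)) {V : ILoSet Alph}
    (z : (X 0).cell.obj (op V)) (d : x.1 ⟶ V.toLoSet) (hA : d.A ⊆ V.S)
    (hx : x.2 = (seqIncl X U S T xacc xst 0).app x.1
      ((closurePresheaf _).map d.op (closureCellOf z)))
    (F : Set R.carrier) (s : Fin x.1.len → R.carrier)
    (ht : Tracks (𝟭 (LoSet Alph)) R False α F s F' s') :
    ExtendsTo R d F s (ReachesStage R (headAcc X U S xacc)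
      (TracksFrom R ((tailIncl X U S T xacc xst).app (U 0) (closureCellOf (xst 0))) t F' s') z) := by
  refine extendsTo_of_tracks (seqIncl X U S T xacc xst 0)
    (fun {x} _ => ∃ c, x.2 = (tailMap X U S T xacc xst).app x.1 c) ?_ ⟨t.2, rfl⟩ ?_
    α z d hA hx F s ht
  · rintro x α V z d hA hx ⟨c, hc⟩ F s ht
    obtain ⟨D, hD, hcD⟩ := exists_of_seqIncl_eq_tailMap h0 (hx.symm.trans hc)
    obtain ⟨c', hc', p, hp⟩ := exists_tail_path h0 α c hc
    obtain rfl : t.2 = c' := tailMap_injective h0 _ hc'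
    -- The start cell has full source interface, so any of its faces may be lifted to it.
    have h := htail p (xst 0) D (Set.subset_univ _) hcD F s (hp R F F' s s' ht)
    obtain ⟨M, e, e', b, rfl, rfl, he, heA, -, -, heB⟩ := exists_common_face hD
    -- The accept cell has full target interface, so passing from the common face to it is an
    -- up-step.
    refine ExtendsTo.reaches_of_common_face (z' := xacc 0) ?_ ?_ he (h.mono ?_)
    · rw [heA, Set.sdiff_eq_empty]
      exact hA
    · rw [heB, Set.sdiff_eq_empty]
      exact Set.subset_univ _
    · rintro F r ⟨p, hp⟩
      exact ⟨.nil _, F, r, ⟨hp.stage, rfl, rfl⟩, p, hp⟩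
  · intro x x' g hg hx α w hw hE
    -- The lower cell is not in the tail. Hence neither is the upper one, whose faces would be there
    -- too, and the step takes place in the first closure.
    rcases seqComp_cases X U S T xacc xst x'.2 with ⟨w', hw'⟩ | ⟨c, hc⟩
    · refine ⟨w', ?_, hw'⟩
      have h := (seqIncl X U S T xacc xst 0).naturality g w'
      rw [← hw'] at h
      rcases seqIncl_injective_or h0 (hw.symm.trans (hx.trans h.symm)) with h | ⟨c, hc⟩
      · exact h
      · exact (hE ⟨c, hw.trans hc⟩).elim
    · refine (hE ⟨(tailComp X U S T xacc xst).cell.map g.op c, ?_⟩).elim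
      rw [hx, hc]
      exact ((tailMap X U S T xacc xst).naturality g c).symm

theorem headMap_acc : (headMap X U S T xacc xst).app _ (headAcc X U S xacc).2 =
    (tailMap X U S T xacc xst).app (U 0)
      ((tailIncl X U S T xacc xst).app (U 0) (closureCellOf (xst 0))) := by
  have h := seqIncl_headAcc X U S T xacc xst (𝟙 (U 0))
  rw [op_id] at h
  erw [Functor.map_id_apply, Functor.map_id_apply] at h
  exact h

end Tail

/-- Paths of the sequential composition from its first automaton to an accept cell lift to paths
from a cell of the first automaton. -/
theorem extendsTo_seqComp {n : ℕ} {X : Fin (n + 1) → IHDA Alph} {U : Fin n → LoSet Alph}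
    {S T : ∀ k, Set (Fin (U k).len)}
    {xacc : ∀ k : Fin n, (X k.castSucc).cell.obj (op ⟨U k, S k, Set.univ⟩)}
    {xst : ∀ k : Fin n, (X k.succ).cell.obj (op ⟨U k, Set.univ, T k⟩)}
    (hcube : ∀ k, IsFinalCube (X := (X k.castSucc).cell) ⟨_, xacc k⟩) {R : Iposet Alph}
    {x t : Cells (seqComp X U S T xacc xst).cell} (hacc : t ∈ (seqComp X U S T xacc xst).accept)
    {F' : Set R.carrier} {s' : Fin t.1.len → R.carrier}
    (α : Path (𝟭 (LoSet Alph)) (seqComp X U S T xacc xst).cell x t) {V : ILoSet Alph}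
    (z : (X 0).cell.obj (op V)) (d : x.1 ⟶ V.toLoSet) (hA : d.A ⊆ V.S)
    (hx : x.2 = (seqIncl X U S T xacc xst 0).app x.1
      ((closurePresheaf _).map d.op (closureCellOf z)))
    (F : Set R.carrier) (s : Fin x.1.len → R.carrier)
    (ht : Tracks (𝟭 (LoSet Alph)) R False α F s F' s') :
    ExtendsTo R d F s (TracksFrom R
      ((seqIncl X U S T xacc xst 0).app _ (closureCellOf z)) t F' s') := by
  induction n generalizing V F with
  | zero =>
    obtain ⟨_, ⟨y, hy, rfl⟩, rfl⟩ := hacc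
    refine (extendsTo_of_closed_path (seqIncl X U S T xacc xst 0)
      (seqIncl_single_injective X U S T xacc xst) (seqIncl_single_surjective X U S T xacc xst)
      (y := y) α z d hA hx F F' s s' ht).mono ?_
    rintro F r ⟨q, _, _, hq, rfl, rfl⟩
    exact ⟨(headMap X U S T xacc xst).path q, (CellMap.tracks_path _ q).2 hq⟩
  | succ n ih =>
    obtain ⟨t, hacc', rfl⟩ := exists_tail_accept hacc
    refine (extendsTo_head (hcube 0) ?_ α z d hA hx F s ht).mono ?_
    · intro x p V z d hA hx F s ht
      exact ih (fun k => hcube k.succ) hacc' p z d hA hx F s ht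
    -- The path to the accept cell and the path in the tail are concatenated at the cell where the
    -- two automata are glued.
    · rintro F r ⟨q, Fm, sm, hq, p, hp⟩
      obtain ⟨p', hp'⟩ := exists_path_of_eq headMap_acc ((tailMap X U S T xacc xst).path p)
        ((CellMap.tracks_path _ p).2 hp)
      exact ⟨((headMap X U S T xacc xst).path q).comp p',
        Tracks.comp ((CellMap.tracks_path _ q).2 hq) hp'⟩

/-! ### The language of a closure -/

section Closure

variable {X : (ILoSet Alph)ᵒᵖ ⥤ Type u}

theorem closure_map_id {W : LoSet Alph} (w : (closurePresheaf X).obj (op W)) :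
    (closurePresheaf X).map (𝟙 W).op w = w := by
  rw [op_id, Functor.map_id_apply]

theorem ClosureCell.exists_eq_closureCellOf {W : LoSet Alph} (c : ClosureCell X W)
    (hA : c.d.A = ∅) (hB : c.d.B = ∅) :
    ∃ x : Cells X, (⟨W, c⟩ : Cells (closurePresheaf X)) = (closureMap X).cell x := by
  obtain ⟨n, l⟩ := W
  obtain ⟨⟨⟨m, l'⟩, S, T⟩, x, ⟨f, A, B, hl, hd, hu⟩, hA', hB'⟩ := c
  obtain rfl : A = (∅ : Set (Fin m)) := hA
  obtain rfl : B = (∅ : Set (Fin m)) := hB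
  have hr : Set.range f = Set.univ := by
    rw [← compl_compl (Set.range f), ← hu, Set.union_empty, Set.compl_empty]
  have hb : Function.Bijective f := ⟨f.injective, Set.range_eq_univ.1 hr⟩
  obtain rfl : n = m := by simpa using Fintype.card_of_bijective hb
  -- A strictly monotone bijection of a finite ordinal is the identity, so nothing remains of the
  -- coface map.
  obtain rfl : f = RelEmbedding.refl _ := by
    ext1 i
    exact congrFun ((StrictMono.range_inj f.strictMono strictMono_id).1 (by simpa using hr)) i
  obtain rfl : l' = l := funext hl
  exact ⟨⟨⟨⟨n, l'⟩, S, T⟩, x⟩, rfl⟩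

/-- The cell `[x; ∅, ∅]` has trivial inserted part, so in the factorisation of `g` the whole map is
the coface map of ilo-sets. -/
theorem exists_face_of_closure {V V' : ILoSet Alph} {x : X.obj (op V)} {x' : X.obj (op V')}
    {g : V.toLoSet ⟶ V'.toLoSet}
    (h : closureCellOf x = (closurePresheaf X).map g.op (closureCellOf x')) :
    ∃ e : V ⟶ V', g = (forgetIface Alph).map e ∧ x = X.map e.op x' := by
  have key : ∀ f : Factor g, (⟨V, x, 𝟙 V.toLoSet, Set.empty_subset _, Set.empty_subset _⟩ :
      ClosureCell X V.toLoSet) = ⟨f.mid, X.map f.e.op x', f.d, f.hA, f.hB⟩ →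
      ∃ e : V ⟶ V', g = (forgetIface Alph).map e ∧ x = X.map e.op x' := by
    rintro ⟨M, e, c, hc, hA, hB⟩ h
    injection h with hM hx hd
    subst hM
    obtain rfl := eq_of_heq hd
    exact ⟨e, hc.symm.trans (Category.id_comp _), eq_of_heq hx⟩
  exact key (factor g) (h.trans (closure_map_eq x' g (factor g)))

theorem closureMap_cell_injective : Function.Injective (closureMap X).cell := by
  rintro ⟨V, x⟩ ⟨V', x'⟩ h
  have h1 : (⟨V.toLoSet, closureCellOf x⟩ : Cells (closurePresheaf X)) =
    ⟨V'.toLoSet, closureCellOf x'⟩ := h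
  have h2 := congrArg (fun c : Cells (closurePresheaf X) =>
    (⟨ClosureCell.base c.2, ClosureCell.x c.2⟩ : Cells X)) h1
  exact h2

/-- In a factorisation the first map inserts exactly the interface events; the second one, applied
in `X`, omits only events outside the respective interface. -/
theorem ClosureCell.face_d {W W' : LoSet Alph} (c : ClosureCell X W) (g : W' ⟶ W) :
    ((c.face g).d.A = ∅ ↔ (g ≫ c.d).A ∩ c.base.S = ∅) ∧
      ((c.face g).d.B = ∅ ↔ (g ≫ c.d).B ∩ c.base.T = ∅) := by
  have key : ∀ f : Factor (g ≫ c.d), (f.d.A = ∅ ↔ (g ≫ c.d).A ∩ c.base.S = ∅) ∧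
      (f.d.B = ∅ ↔ (g ≫ c.d).B ∩ c.base.T = ∅) := by
    intro f
    have h1 : f.e.emb '' f.d.A ∪ f.e.A = (g ≫ c.d).A := congrArg LoSet.Hom.A f.fac
    have h2 : f.e.emb '' f.d.B ∪ f.e.B = (g ≫ c.d).B := congrArg LoSet.Hom.B f.fac
    have h3 : f.e.emb '' f.d.A ⊆ c.base.S := by
      rintro _ ⟨i, hi, rfl⟩
      have := f.hA hi
      rwa [f.e.S_pre] at this
    have h4 : f.e.emb '' f.d.B ⊆ c.base.T := by
      rintro _ ⟨i, hi, rfl⟩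
      have := f.hB hi
      rwa [f.e.T_pre] at this
    rw [← h1, ← h2, Set.union_inter_distrib_right, Set.union_inter_distrib_right,
      f.e.A_S.inter_eq, f.e.B_T.inter_eq, Set.inter_eq_left.2 h3, Set.inter_eq_left.2 h4]
    simp
  exact key _

/-- Paths in the closure from a cell `[x; ∅, ∅]` to a cell `[y; ∅, ∅]` are paths in `X`. -/
theorem exists_path_of_closed_path {Z : (LoSet Alph)ᵒᵖ ⥤ Type u}
    (j : CellMap (𝟭 (LoSet Alph)) (closurePresheaf X) Z)
    (hj : ∀ W, Function.Injective (j.app W)) (hj' : ∀ W, Function.Surjective (j.app W))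
    {w w' : Cells Z} (α : Path (𝟭 (LoSet Alph)) Z w w') (a : ClosureCell X w.1)
    (b : ClosureCell X w'.1) (ha : w.2 = j.app w.1 a) (hb : w'.2 = j.app w'.1 b)
    (hA : a.d.A = ∅) (hB : b.d.B = ∅) :
    a.d.B = ∅ ∧ ∃ (x y : Cells X) (q : Path (forgetIface Alph) X x y),
      w = ((closureMap X).comp j).cell x ∧ w' = ((closureMap X).comp j).cell y ∧
        HEq α (((closureMap X).comp j).path q) := by
  have hcell : ∀ {W : LoSet Alph} {w : Z.obj (op W)} {a : ClosureCell X W}, w = j.app W a →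
      a.d.A = ∅ → a.d.B = ∅ → ∃ x : Cells X, (⟨W, w⟩ : Cells Z) =
        ((closureMap X).comp j).cell x := by
    rintro W _ a rfl hA hB
    obtain ⟨x, hx⟩ := a.exists_eq_closureCellOf hA hB
    exact ⟨x, congrArg j.cell hx⟩
  induction α with
  | nil w =>
    obtain rfl : a = b := hj _ (ha.symm.trans hb)
    obtain ⟨x, rfl⟩ : ∃ x, w = ((closureMap X).comp j).cell x := hcell ha hA hB
    exact ⟨hB, x, x, .nil x, rfl, rfl, HEq.rfl⟩
  | @up w w₁ w' g hg hx α ih =>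
    obtain ⟨c, hc⟩ : ∃ c : ClosureCell X w₁.1, j.app w₁.1 c = w₁.2 := hj' _ w₁.2
    obtain rfl : a = ClosureCell.face c g := hj _ (by
      rw [← ha, hx, ← hc]
      exact (j.naturality g c).symm)
    -- Along a path the unstarted set of closure cells never grows and the terminated set never
    -- shrinks. So emptiness of the first is passed forward from the start, and emptiness of the
    -- second backward from the end.
    have hcA : c.d.A = ∅ := by
      rw [(c.face_d g).1] at hA
      exact Set.subset_empty_iff.1 fun i hi => hA.subset ⟨Or.inr hi, c.hA hi⟩
    obtain ⟨hcB, x₁, y, q, rfl, rfl, hq⟩ := ih c b hc.symm hb hcA hB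
    have hB' : (c.face g).d.B = ∅ := by
      rw [(c.face_d g).2, show (g ≫ c.d).B = c.d.emb '' g.B ∪ c.d.B from rfl, hcB,
        show g.B = ∅ from hg]
      simp
    obtain ⟨x, rfl⟩ : ∃ x, w = ((closureMap X).comp j).cell x := hcell ha hA hB'
    obtain ⟨e, rfl, he⟩ := exists_face_of_closure (hj _ (hx.trans (j.naturality g _).symm))
    obtain rfl := eq_of_heq hq
    exact ⟨hB', x, y, .up e hg he q, rfl, rfl, HEq.rfl⟩
  | @down w w₁ w' g hg hx α ih =>
    have hcA : (a.face g).d.A = ∅ := by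
      rw [(a.face_d g).1, show (g ≫ a.d).A = a.d.emb '' g.A ∪ a.d.A from rfl, hA,
        show g.A = ∅ from hg]
      simp
    have hc : w₁.2 = j.app w₁.1 (a.face g) := by
      rw [hx, ha]
      exact (j.naturality g a).symm
    obtain ⟨hcB, x₁, y, q, rfl, rfl, hq⟩ := ih (a.face g) b hc hb hcA hB
    have hB' : a.d.B = ∅ := by
      rw [(a.face_d g).2] at hcB
      exact Set.subset_empty_iff.1 fun i hi => hcB.subset ⟨Or.inr hi, a.hB hi⟩
    obtain ⟨x, rfl⟩ : ∃ x, w = ((closureMap X).comp j).cell x := hcell ha hA hB'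
    obtain ⟨e, rfl, he⟩ := exists_face_of_closure (hj _ (hx.trans (j.naturality g _).symm))
    obtain rfl := eq_of_heq hq
    exact ⟨hB', x, y, .down e hg he q, rfl, rfl, HEq.rfl⟩

end Closure

theorem seqComp_lang_zero (X : Fin (0 + 1) → IHDA Alph) (U : Fin 0 → LoSet Alph)
    (S T : ∀ k, Set (Fin (U k).len))
    (xacc : ∀ k : Fin 0, (X k.castSucc).cell.obj (op ⟨U k, S k, Set.univ⟩))
    (xst : ∀ k : Fin 0, (X k.succ).cell.obj (op ⟨U k, Set.univ, T k⟩)) :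
    (seqComp X U S T xacc xst).Lang = (X 0).Lang := by
  ext P
  constructor
  · rintro ⟨_, ⟨_, ⟨a, ha, rfl⟩, rfl⟩, _, ⟨_, ⟨b, hb, rfl⟩, rfl⟩, α, rfl⟩
    have hinj := seqIncl_single_injective X U S T xacc xst
    obtain ⟨-, x, y, q, hx, hy, hq⟩ := exists_path_of_closed_path (seqIncl X U S T xacc xst 0) hinj
      (seqIncl_single_surjective X U S T xacc xst) α (closureCellOf a.2) (closureCellOf b.2)
      rfl rfl rfl rfl
    have hcell : Function.Injective (headMap X U S T xacc xst).cell := by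
      refine Function.Injective.comp (g := (seqIncl X U S T xacc xst 0).cell) ?_
        closureMap_cell_injective
      rintro ⟨W, w⟩ ⟨W', w'⟩ h
      obtain rfl : W = W' := congrArg Sigma.fst h
      exact congrArg _ (hinj W (eq_of_heq (Sigma.mk.inj h).2))
    obtain rfl : a = x := hcell hx
    obtain rfl : b = y := hcell hy
    obtain rfl := eq_of_heq hq
    exact ⟨a, ha, b, hb, q, ((headMap X U S T xacc xst).pathEv_path q).symm⟩
  · rintro ⟨a, ha, b, hb, q, rfl⟩
    exact ⟨_, ⟨_, ⟨a, ha, rfl⟩, rfl⟩, _, ⟨_, ⟨b, hb, rfl⟩, rfl⟩, (headMap X U S T xacc xst).path q,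
      (headMap X U S T xacc xst).pathEv_path q⟩

/-! ### The language of a sequential composition -/

theorem Iposet.HasTrack.glue_of_eq {Z : (LoSet Alph)ᵒᵖ ⥤ Type u} {P Q : Iposet Alph}
    {x y y' z : Cells Z} {s : Fin x.1.len → P.carrier} {t : Fin y.1.len → P.carrier}
    {s' : Fin y'.1.len → Q.carrier} {t' : Fin z.1.len → Q.carrier} (hP : HasTrack P x y s t)
    (hy : y = y') (hQ : HasTrack Q y' z s' t') (f : Matching P Q) :
    ∃ s t, HasTrack (Iposet.glue f) x z s t := by
  subst hy
  exact ⟨_, _, hP.glue_of_matching hQ f⟩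

section Succ

variable {n : ℕ} {X : Fin (n + 1 + 1) → IHDA Alph} {U : Fin (n + 1) → LoSet Alph}
  {S T : ∀ k, Set (Fin (U k).len)}
  {xacc : ∀ k : Fin (n + 1), (X k.castSucc).cell.obj (op ⟨U k, S k, Set.univ⟩)}
  {xst : ∀ k : Fin (n + 1), (X k.succ).cell.obj (op ⟨U k, Set.univ, T k⟩)}

/-- Map both paths into the composition, glue their track maps at the shared cell, restrict along
the subsumption, and read off a path with the required interval ipomset. -/
theorem langMul_subset_seqComp_lang (hacc : (X 0).accept = {headAcc X U S xacc})
    (hst : (X (Fin.succ 0)).start = {⟨_, xst 0⟩}) :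
    langMul (X 0).Lang (tailComp X U S T xacc xst).Lang ⊆ (seqComp X U S T xacc xst).Lang := by
  rintro _ ⟨P, Q, R, f, ⟨x, hx, y, hy, p, hp⟩, ⟨x', hx', y', hy', p', hp'⟩, rfl, hR, hsub, hf⟩
  obtain rfl : y = headAcc X U S xacc := by rwa [hacc] at hy
  obtain ⟨_, ⟨x', hx', rfl⟩, rfl⟩ := hx'
  obtain rfl : x' = ⟨_, xst 0⟩ := by
    have : x' ∈ (X (Fin.succ 0)).start := hx'
    rwa [hst] at this
  -- Singleton start and accept sets keep the endpoints of the track map fixed.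
  obtain ⟨_, rfl, _, rfl, s, t, h1⟩ := exists_hasTrack_of_mem_langOf (P := P)
    (start := {(headMap X U S T xacc xst).cell x})
    (accept := {(headMap X U S T xacc xst).cell (headAcc X U S xacc)})
    ⟨_, rfl, _, rfl, (headMap X U S T xacc xst).path p, (CellMap.pathEv_path _ p).trans hp⟩
  obtain ⟨_, rfl, _, rfl, s', t', h2⟩ := exists_hasTrack_of_mem_langOf (P := Q)
    (start := {(tailMap X U S T xacc xst).cell ⟨U 0, (tailIncl X U S T xacc xst).app (U 0)
      (closureCellOf (xst 0))⟩})
    (accept := {(tailMap X U S T xacc xst).cell y'})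
    ⟨_, rfl, _, rfl, (tailMap X U S T xacc xst).path p', (CellMap.pathEv_path _ p').trans hp'⟩
  have heq : (headMap X U S T xacc xst).cell (headAcc X U S xacc) =
      (tailMap X U S T xacc xst).cell ⟨U 0, (tailIncl X U S T xacc xst).app (U 0)
        (closureCellOf (xst 0))⟩ := congrArg (Sigma.mk (U 0)) headMap_acc
  obtain ⟨_, _, h⟩ := h1.glue_of_eq heq h2 f
  obtain ⟨q, hq⟩ := (h.of_subsumption hf).exists_path hR
  exact ⟨_, ⟨_, ⟨x, hx, rfl⟩, rfl⟩, _, tailMap_accept hy', q, hq⟩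

/-- The path is tracked by its own ipomset. Its lifts to the first automaton and to the tail are
tracked by the same iposet, so the gluing of their ipomsets subsumes it. -/
theorem seqComp_lang_subset_langMul
    (hcube : ∀ k, IsFinalCube (X := (X k.castSucc).cell) ⟨_, xacc k⟩)
    (hacc : headAcc X U S xacc ∈ (X 0).accept)
    (hst : (⟨_, xst 0⟩ : Cells (X (Fin.succ 0)).cell) ∈ (X (Fin.succ 0)).start) :
    (seqComp X U S T xacc xst).Lang ⊆ langMul (X 0).Lang (tailComp X U S T xacc xst).Lang := by
  rintro _ ⟨_, ⟨_, ⟨x, hx, rfl⟩, rfl⟩, t, ht, α, rfl⟩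
  obtain ⟨t, ht', rfl⟩ := exists_tail_accept ht
  have hα := tracks_evAux α
  have h := extendsTo_head (hcube 0) (R := (evAux _ α).1)
    (fun p V z d hA hx F s ht => extendsTo_seqComp (fun k => hcube k.succ) ht' p z d hA hx F s ht)
    α x.2 (𝟙 x.1.toLoSet) (Set.empty_subset _) 
    (congrArg ((seqIncl X U S T xacc xst 0).app _) (closure_map_id (closureCellOf x.2)).symm) _ _ hα
  -- The path begins at a cell `[x; ∅, ∅]`, where there is nothing to start early or terminate late,
  -- so the lift begins at the same stage.
  obtain ⟨q, Fm, sm, hq, p, hp⟩ := h.of_id hα.stage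
  obtain ⟨g₁, hg₁, hs₁, ht₁⟩ := hq.embeds
  obtain ⟨g₂, hg₂, hs₂, ht₂⟩ := hp.embeds
  let f : Iposet.Matching (evAux _ q).1 (evAux _ p).1 := matchingOfIso (evTgt _ q) (evAux _ p).2
  have hf : ∀ t, g₁ t.1 = g₂ (f.equiv t).1 := by
    intro t
    obtain ⟨i, rfl⟩ := (evTgt _ q).equiv.surjective t
    refine (ht₁ i).trans ((hs₂ i).symm.trans ?_)
    refine congrArg (fun k => g₂ ((evAux _ p).2.equiv k).1) ?_
    exact ((evTgt _ q).equiv.symm_apply_apply i).symm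
  obtain ⟨k, hk, -⟩ := (hg₁.glue f hg₂ hf).subsumed (by
    ext r
    constructor
    · rintro ⟨_, ⟨a, ha, rfl⟩, rfl⟩
      obtain ⟨i, hi⟩ := (evAux _ q).2.equiv.surjective ⟨a, ha⟩
      have := hs₁ i
      rw [hi] at this
      rw [show Iposet.glueElim f g₁ g₂ (Sum.inl a) = g₁ a from rfl, this]
      exact ((evAux _ α).2.equiv i).2
    · intro hr
      obtain ⟨i, hi⟩ := (evAux _ α).2.equiv.surjective ⟨r, hr⟩
      refine ⟨_, ⟨_, ((evAux _ q).2.equiv i).2, rfl⟩, (hs₁ i).trans ?_⟩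
      exact congrArg Subtype.val hi) (by
    intro r hr
    obtain ⟨i, hi⟩ := (evTgt _ α).equiv.surjective ⟨r, hr⟩
    refine ⟨Iposet.glueInr f ((evTgt _ p).equiv i).1, (Iposet.glueElim_glueInr f hf _).trans ?_⟩
    exact (ht₂ i).trans (congrArg Subtype.val hi))
  exact ⟨_, _, _, f, ⟨x, hx, _, hacc, q, rfl⟩, ⟨_, ⟨_, ⟨_, hst, rfl⟩, rfl⟩, t, ht', p, rfl⟩, rfl,
    evAux_interval _ α, k, hk⟩

end Succ

theorem seqComp_lang {n : ℕ} (X : Fin (n + 1) → IHDA Alph) (U : Fin n → LoSet Alph)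
    (S T : ∀ k, Set (Fin (U k).len))
    (xacc : ∀ k : Fin n, (X k.castSucc).cell.obj (op ⟨U k, S k, Set.univ⟩))
    (xst : ∀ k : Fin n, (X k.succ).cell.obj (op ⟨U k, Set.univ, T k⟩))
    (hcube : ∀ k, IsFinalCube (X := (X k.castSucc).cell) ⟨_, xacc k⟩)
    (hacc : ∀ k, (X k.castSucc).accept = {⟨_, xacc k⟩})
    (hst : ∀ k, (X k.succ).start = {⟨_, xst k⟩}) :
    (seqComp X U S T xacc xst).Lang = langProd fun k => (X k).Lang := by
  induction n with
  | zero => exact seqComp_lang_zero X U S T xacc xst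
  | succ n ih =>
    have ih := ih (fun k => X k.succ) (fun k => U k.succ) (fun k => S k.succ) (fun k => T k.succ)
      (fun k => xacc k.succ) (fun k => xst k.succ) (fun k => hcube k.succ) (fun k => hacc k.succ)
      (fun k => hst k.succ)
    change _ = langMul (X 0).Lang (langProd fun k : Fin (n + 1) => (X k.succ).Lang)
    rw [← ih]
    exact (seqComp_lang_subset_langMul hcube ((hacc 0).superset rfl) ((hst 0).superset rfl)).antisymm
      (langMul_subset_seqComp_lang (hacc 0) (hst 0))

end HDAGluing


theorem mainTheorem7 {Alph : Type u} {n : ℕ} (X : Fin (n + 1) → HDAGluing.IHDA Alph)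
    (h_first : (X 0).AcceptSimple ∧ (X 0).AcceptProper)
    (h_mid : ∀ k, k ≠ 0 → k ≠ Fin.last n → (X k).Simple ∧ (X k).Proper)
    (h_last : (X (Fin.last n)).StartSimple ∧ (X (Fin.last n)).StartProper)
    (U : Fin n → HDAGluing.LoSet Alph) (S T : ∀ k, Set (Fin (U k).len))
    (xacc : ∀ k : Fin n, (X k.castSucc).cell.obj (op ⟨U k, S k, Set.univ⟩))
    (xst : ∀ k : Fin n, (X k.succ).cell.obj (op ⟨U k, Set.univ, T k⟩))
    (hxacc : ∀ k : Fin n, ⟨_, xacc k⟩ ∈ (X k.castSucc).accept)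
    (hxst : ∀ k : Fin n, ⟨_, xst k⟩ ∈ (X k.succ).start) :
    (HDAGluing.seqComp X U S T xacc xst).Lang = HDAGluing.langProd fun k => (X k).Lang := by
  have hacc : ∀ k : Fin n, (X k.castSucc).AcceptSimple ∧ (X k.castSucc).AcceptProper := by
    intro k
    -- An automaton before a gluing is the first one or a middle one; it is never the last.
    by_cases hk : k.castSucc = 0
    · rwa [hk]
    · obtain ⟨h1, h2⟩ := h_mid k.castSucc hk (Fin.castSucc_lt_last k).ne
      exact ⟨h1.2, h2.2.1⟩
  have hst : ∀ k : Fin n, (X k.succ).StartSimple := by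
    intro k
    by_cases hk : k.succ = Fin.last n
    · rw [hk]
      exact h_last.1
    · exact (h_mid k.succ (Fin.succ_ne_zero k) hk).1.1
  refine HDAGluing.seqComp_lang X U S T xacc xst
    (fun k => HDAGluing.IHDA.isFinalCube (hacc k).1 (hacc k).2 (hxacc k)) (fun k => ?_) fun k => ?_
  · obtain ⟨y, hy⟩ := (hacc k).1
    have h := hxacc k
    rw [hy] at h ⊢
    rw [Set.mem_singleton_iff.1 h]
  · obtain ⟨y, hy⟩ := hst k
    have h := hxst k
    rw [hy] at h ⊢
    rw [Set.mem_singleton_iff.1 h]
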